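/- **Setting.** An operator space is a closed subspace $X$ of $B(H)$, $H$ a complex Hilbert space, with the norms on $M_n(X)\subset M_n(B(H))=B(H^{\oplus n})$; a linear map is a complete isometry if all its amplifications $\mathrm{id}_{M_n}\otimes\phi$ are isometric; $\|\phi\|_{cb}=\sup_n\|\mathrm{id}_{M_n}\otimes\phi\|$. A finite-dimensional operator space $E$ is $1$-exact if for every $\varepsilon>0$ there are $n$, a subspace $F\subset M_n$ and a linear isomorphism $\phi:E\to F$ with $\|\phi\|_{cb}\|\phi^{-1}\|_{cb}<1+\varepsilon$. Let $\mathcal E_1$ be the class of finite-dimensional $1$-exact operator spaces. Embeddings are complete isometries, and $\langle\bar a\rangle$ denotes the linear span of a finite tuple $\bar a$. For a class $\mathcal C$ of finite-dimensional operator spaces, $\mathcal C(k)$ is the set of pairs $(\bar a,X)$ with $X\in\mathcal C$ and $\bar a$ a $k$-tuple in $X$ with $X=\langle\bar a\rangle$, where $(\bar a,X)$ and $(\bar b,Y)$ are identified if a surjective complete isometry $X\to Y$ maps $\bar a$ to $\bar b$. A $\mathcal C$-structure is an operator space all of whose finite-dimensional subspaces are in $\mathcal C$. An approximate isometry from $X$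 to $Y$ is a function $\psi:X\times Y\to[0,\infty]$ with $|\psi(a,b)-\psi(a',b)|\le\|a-a'\|\le\psi(a,b)+\psi(a',b)$ and $|\psi(a,b)-\psi(a,b')|\le\|b-b'\|\le\psi(a,b)+\psi(a,b')$. A partial isomorphism from $X$ to $Y$, i.e. an embedding $f:\langle\bar c\rangle\to Y$ with $\bar c$ a finite tuple in $X$, is identified with the function $\psi_f(x,y)=\inf_{z\in\langle\bar c\rangle}(\|x-z\|+\|f(z)-y\|)$. $\mathrm{Apx}_{\mathcal C}(X,Y)$ is the closure, in the topology of pointwise convergence, of the set of approximate isometries $\phi$ from $X$ to $Y$ such that $\phi(x,y)\ge\inf_{z\in Z}(\psi_f(x,z)+\psi_g(y,z))$ for all $x,y$, for some $\mathcal C$-structure $Z$ and partial isomorphisms $f$ from $X$ to $Z$ and $g$ from $Y$ to $Z$. The Fraïssé metric on $\mathcal C(k)$ is $$d_{\mathcal C}(\bar a,\bar b)=\inf_{\phi\in\mathrm{Apx}_{\mathcal C}(\langle\bar a\rangle,\langle\bar b\rangle)}\ \max_i\phi(a_i,b_i).$$ $\mathcal C$ is a Fraïssé class if it has the following properties. Hereditary: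 subspaces of elements of $\mathcal C$ are in $\mathcal C$. Joint embedding: any two elements of $\mathcal C$ embed into a common element of $\mathcal C$. Near amalgamation: for $A,B_0,B_1\in\mathcal C$, embeddings $\iota:A\to B_0$, $\phi:A\to B_1$, a finite tuple $\bar a$ in $A$ and $\varepsilon>0$, there are $Z\in\mathcal C$ and embeddings $\psi_j:B_j\to Z$ with $\|\psi_0(\iota(a_i))-\psi_1(\phi(a_i))\|\le\varepsilon$ for all $i$. Finally, $(\mathcal C(k),d_{\mathcal C})$ is a complete separable metric space for every $k$. **Proposition.** For every $k\in\mathbb N$: 1. $(\mathcal E_1(k),d_{\mathcal E_1})$ is a complete metric space. 2. The set of $(\bar a,X)\in\mathcal E_1(k)$ such that $X$ embeds completely isometrically into some $M_n$ is dense in $\mathcal E_1(k)$; and $\mathcal E_1(k)$ is separable. 3. Consider the subspace of those $(\bar a,X)\in\mathcal E_1(k)$ for which $\bar a$ is a basis of $X$ (so $\dim X=k$). For each $N$, the set of those bases with $\|a_i\|\le N$ and $\|a_i^*\|\le N$ for all $i$, $\bar a^*$ being the dual basis, is complete. The bases of spaces that embed into some $M_n$ are dense in the subspace of all bases, and this subspace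 is separable. Moreover, $\mathcal E_1$ is a Fraïssé class. -/

import Mathlib

open scoped ENNReal Topology

noncomputable section

/-- An operator space: a closed linear subspace of `B(H)`, `H` a complex Hilbert space. -/
structure OperatorSpace : Type 1 where
  H : Type
  [normedAddCommGroup : NormedAddCommGroup H]
  [innerProductSpace : InnerProductSpace ℂ H]
  [completeSpace : CompleteSpace H]
  carrier : Submodule ℂ (H →L[ℂ] H)
  isClosed : IsClosed (carrier : Set (H →L[ℂ] H))

namespace OperatorSpace

attribute [instance] OperatorSpace.normedAddCommGroup OperatorSpace.innerProductSpace
  OperatorSpace.completeSpace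

instance : CoeSort OperatorSpace Type := ⟨fun X => X.carrier⟩

/-- The operator on the Hilbert space sum `H ⊕ ⋯ ⊕ H` (`n` summands) given by an `n × n` matrix of
operators on `H`: its `i`-th coordinate sends `ξ` to `∑ j, x i j (ξ j)`. -/
def blockOperator {H : Type} [NormedAddCommGroup H] [InnerProductSpace ℂ H] {n : ℕ}
    (x : Matrix (Fin n) (Fin n) (H →L[ℂ] H)) :
    PiLp 2 (fun _ : Fin n => H) →L[ℂ] PiLp 2 (fun _ : Fin n => H) :=
  ((PiLp.continuousLinearEquiv 2 ℂ (fun _ : Fin n => H)).symm :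
      (Fin n → H) →L[ℂ] PiLp 2 (fun _ : Fin n => H)) ∘L
    ContinuousLinearMap.pi (fun i : Fin n =>
      ∑ j : Fin n, (x i j) ∘L (PiLp.proj 2 (fun _ : Fin n => H) j))

/-- The norm of `M_n(X)`, inherited from `M_n(B(H)) = B(H ⊕ ⋯ ⊕ H)`. -/
def matNorm (X : OperatorSpace) {n : ℕ} (x : Matrix (Fin n) (Fin n) X) : ℝ :=
  ‖blockOperator (x.map (fun t : X => (t : X.H →L[ℂ] X.H)))‖

/-- The completely bounded norm `sup_n ‖id_{M_n} ⊗ φ‖`, with value `∞` when `φ` is not completely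
bounded. -/
def cbNorm {X Y : OperatorSpace} (φ : X →ₗ[ℂ] Y) : ℝ≥0∞ :=
  ⨆ (n : ℕ) (x : Matrix (Fin n) (Fin n) X) (_ : X.matNorm x ≤ 1),
    ENNReal.ofReal (Y.matNorm (x.map φ))

/-- Completely isometric linear maps; these are the embeddings of operator spaces. -/
def IsCompleteIsometry {X Y : OperatorSpace} (φ : X →ₗ[ℂ] Y) : Prop :=
  ∀ (n : ℕ) (x : Matrix (Fin n) (Fin n) X), Y.matNorm (x.map φ) = X.matNorm x

/-- A linear subspace of `M_n = B(ℂⁿ)` as an operator space. -/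
def ofMatrixSubspace (n : ℕ)
    (F : Submodule ℂ (EuclideanSpace ℂ (Fin n) →L[ℂ] EuclideanSpace ℂ (Fin n))) :
    OperatorSpace where
  H := EuclideanSpace ℂ (Fin n)
  carrier := F
  isClosed := F.closed_of_finiteDimensional

/-- The operator space `M_n`. -/
def matrixAlgebra (n : ℕ) : OperatorSpace := ofMatrixSubspace n ⊤

/-- The substructure `⟨a⟩` of `X` generated by a finite tuple `a`: its linear span. -/
def gen (X : OperatorSpace) {m : ℕ} (a : Fin m → X) : OperatorSpace where
  H := X.H
  carrier := Submodule.span ℂ (Set.range fun i => (a i : X.H →L[ℂ] X.H))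
  isClosed :=
    haveI : FiniteDimensional ℂ
        (Submodule.span ℂ (Set.range fun i => (a i : X.H →L[ℂ] X.H))) :=
      FiniteDimensional.span_of_finite ℂ (Set.finite_range _)
    Submodule.closed_of_finiteDimensional _

/-- The inclusion of `⟨a⟩` into `X`. -/
def genInclusion (X : OperatorSpace) {m : ℕ} (a : Fin m → X) : X.gen a →ₗ[ℂ] X :=
  Submodule.inclusion (Submodule.span_le.2 (by rintro _ ⟨i, rfl⟩; exact (a i).2))

/-- `d_cb(E, F)`: the infimum of `‖φ‖_cb ‖φ⁻¹‖_cb` over the linear isomorphisms `φ : E → F`. -/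
def dcb (E F : OperatorSpace) : ℝ≥0∞ :=
  ⨅ φ : E ≃ₗ[ℂ] F, cbNorm (φ : E →ₗ[ℂ] F) * cbNorm (φ.symm : F →ₗ[ℂ] E)

/-- The exactness constant of a finite-dimensional operator space: the infimum of `d_cb(E, F)`,
where `F` ranges over all subspaces of all matrix algebras `M_n`. -/
def exactnessConstant (E : OperatorSpace) : ℝ≥0∞ :=
  ⨅ (n : ℕ) (F : Submodule ℂ (EuclideanSpace ℂ (Fin n) →L[ℂ] EuclideanSpace ℂ (Fin n))),
    dcb E (ofMatrixSubspace n F)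

/-- The class `𝓔₁` of finite-dimensional `1`-exact operator spaces. A nonzero space has exactness
constant at least `1`, so for it `≤ 1` says `= 1`; the zero space (whose constant is `0` here)
belongs to the class. -/
def E1 (X : OperatorSpace) : Prop :=
  FiniteDimensional ℂ X ∧ exactnessConstant X ≤ 1

/-- `X` has a completely isometric embedding into some matrix algebra `M_n`. -/
def EmbedsInMatrixAlgebra (X : OperatorSpace) : Prop :=
  ∃ (n : ℕ) (φ : X →ₗ[ℂ] matrixAlgebra n), IsCompleteIsometry φ

/-! ### Approximate isometries and approximate morphisms -/

/-- Approximate isometries from `X` to `Y`. -/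
def IsApproxIsometry {X Y : OperatorSpace} (ψ : X → Y → ℝ≥0∞) : Prop :=
  (∀ (a a' : X) (b : Y), ψ a b ≤ ψ a' b + edist a a' ∧ edist a a' ≤ ψ a b + ψ a' b) ∧
  (∀ (a : X) (b b' : Y), ψ a b ≤ ψ a b' + edist b b' ∧ edist b b' ≤ ψ a b + ψ a b')

/-- The approximate isometry `ψ_f` (distance to the graph of `f`) of a partial isomorphism `f`
from `X` to `Y`, defined on the substructure generated by the tuple `a`. -/
def graphDist {X Y : OperatorSpace} {m : ℕ} {a : Fin m → X} (f : X.gen a →ₗ[ℂ] Y)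
    (x : X) (y : Y) : ℝ≥0∞ :=
  ⨅ z : X.gen a, edist x (X.genInclusion a z) + edist (f z) y

/-- Partial isomorphisms from `X` to `Y`: embeddings into `Y` of substructures generated by finite
tuples, regarded as approximate isometries. -/
def Apx1 (X Y : OperatorSpace) : Set (X → Y → ℝ≥0∞) :=
  {ψ | ∃ (m : ℕ) (a : Fin m → X) (f : X.gen a →ₗ[ℂ] Y), IsCompleteIsometry f ∧ ψ = graphDist f}

/-- `X` is a `C`-structure: all its finitely generated substructures are in the class `C`. -/
def IsStructureOf (C : OperatorSpace → Prop) (X : OperatorSpace) : Prop :=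
  ∀ (m : ℕ) (a : Fin m → X), C (X.gen a)

/-- Approximate isometries of the form `g* f`, with `f` and `g` partial isomorphisms from `X` and
from `Y` to a common `C`-structure. -/
def Apx2 (C : OperatorSpace → Prop) (X Y : OperatorSpace) : Set (X → Y → ℝ≥0∞) :=
  {ψ | ∃ Z : OperatorSpace, IsStructureOf C Z ∧ ∃ f ∈ Apx1 X Z, ∃ g ∈ Apx1 Y Z,
    ψ = fun x y => ⨅ z : Z, f x z + g y z}

/-- The (`C`-intrinsic) approximate morphisms from `X` to `Y`: the closure, for the topology of
pointwise convergence, of the set of approximate isometries that coarsen an element of `Apx2`. -/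
def Apx (C : OperatorSpace → Prop) (X Y : OperatorSpace) : Set (X → Y → ℝ≥0∞) :=
  closure {φ | IsApproxIsometry φ ∧ ∃ ψ ∈ Apx2 C X Y, ∀ x y, ψ x y ≤ φ x y}

/-! ### The Fraïssé metric space of a class of operator spaces -/

/-- Pairs `(a, X)` with `X` in the class `C` and `a` a `k`-tuple that generates `X`. -/
structure GenTuple (C : OperatorSpace → Prop) (k : ℕ) : Type 1 where
  X : OperatorSpace
  mem : C X
  a : Fin k → X
  span_eq_top : Submodule.span ℂ (Set.range a) = ⊤

/-- `(a, X)` and `(b, Y)` are identified when a surjective complete isometry `X → Y` sends `a` to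
`b`. -/
instance genTupleSetoid (C : OperatorSpace → Prop) (k : ℕ) : Setoid (GenTuple C k) where
  r p q := ∃ φ : p.X ≃ₗ[ℂ] q.X, IsCompleteIsometry (φ : p.X →ₗ[ℂ] q.X) ∧ ∀ i, φ (p.a i) = q.a i
  iseqv :=
    { refl := fun p => ⟨LinearEquiv.refl ℂ p.X, fun n x => by
          congr 1, fun i => rfl⟩
      symm := by
        rintro p q ⟨φ, hφ, h⟩
        refine ⟨φ.symm, fun n x => ?_, fun i => ?_⟩
        · refine (hφ n (x.map φ.symm)).symm.trans ?_
          congr 1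
          ext i j
          simp
        · rw [← h i]; simp
      trans := by
        rintro p q r ⟨φ, hφ, h⟩ ⟨ψ, hψ, h'⟩
        refine ⟨φ.trans ψ, fun n x => ?_, fun i => ?_⟩
        · exact (hψ n (x.map φ)).trans (hφ n x)
        · simp [h, h'] }

/-- The space `C(k)`. -/
def FraisseSpace (C : OperatorSpace → Prop) (k : ℕ) : Type 1 :=
  Quotient (genTupleSetoid C k)

/-- The class in `C(k)` of a generating tuple. -/
def GenTuple.toSpace {C : OperatorSpace → Prop} {k : ℕ} (p : GenTuple C k) : FraisseSpace C k :=
  Quotient.mk (genTupleSetoid C k) p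

/-- The Fraïssé metric `d_C(a, b) = inf_φ max_i φ(a_i, b_i)`, where `φ` ranges over the approximate
morphisms from `⟨a⟩` to `⟨b⟩`. -/
def fraisseDist (C : OperatorSpace → Prop) {k : ℕ} (p q : GenTuple C k) : ℝ≥0∞ :=
  ⨅ φ ∈ Apx C p.X q.X, ⨆ i : Fin k, φ (p.a i) (q.a i)

/-- The given metric on `C(k)` is the Fraïssé metric. -/
def IsFraisseMetric (C : OperatorSpace → Prop) (k : ℕ) [MetricSpace (FraisseSpace C k)] : Prop :=
  ∀ p q : GenTuple C k, edist p.toSpace q.toSpace = fraisseDist C p q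

/-- The points of `C(k)` whose underlying space embeds into some `M_n`. -/
def matricialPoints (C : OperatorSpace → Prop) (k : ℕ) : Set (FraisseSpace C k) :=
  {P | ∃ p : GenTuple C k, p.toSpace = P ∧ EmbedsInMatrixAlgebra p.X}

/-- The points of `C(k)` given by a `k`-dimensional space with a linear basis. -/
def basisPoints (C : OperatorSpace → Prop) (k : ℕ) : Set (FraisseSpace C k) :=
  {P | ∃ p : GenTuple C k, p.toSpace = P ∧ LinearIndependent ℂ p.a}

/-- The `N`-Auerbach points: bases `a` with `‖a i‖ ≤ N` and `‖a i*‖ ≤ N`, where `a*` is the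
dual basis, which sends `∑ j, c j • a j` to `c i`. -/
def auerbachPoints (C : OperatorSpace → Prop) (k : ℕ) (N : ℝ) : Set (FraisseSpace C k) :=
  {P | ∃ p : GenTuple C k, p.toSpace = P ∧ LinearIndependent ℂ p.a ∧
    ∀ i, ‖p.a i‖ ≤ N ∧ ∀ c : Fin k → ℂ, ‖c i‖ ≤ N * ‖∑ j, c j • p.a j‖}

/-! ### Fraïssé classes of operator spaces -/

/-- The hereditary property. -/
def HereditaryProperty (C : OperatorSpace → Prop) : Prop :=
  ∀ X, C X → ∀ (m : ℕ) (a : Fin m → X), C (X.gen a)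

/-- The joint embedding property. -/
def JointEmbeddingProperty (C : OperatorSpace → Prop) : Prop :=
  ∀ X Y, C X → C Y → ∃ Z, C Z ∧
    ∃ (φ : X →ₗ[ℂ] Z) (ψ : Y →ₗ[ℂ] Z), IsCompleteIsometry φ ∧ IsCompleteIsometry ψ

/-- The near amalgamation property. -/
def NearAmalgamationProperty (C : OperatorSpace → Prop) : Prop :=
  ∀ A B₀ B₁, C A → C B₀ → C B₁ →
    ∀ (ι : A →ₗ[ℂ] B₀) (φ : A →ₗ[ℂ] B₁), IsCompleteIsometry ι → IsCompleteIsometry φ →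
    ∀ (m : ℕ) (a : Fin m → A) (ε : ℝ), 0 < ε →
    ∃ Z, C Z ∧ ∃ (ψ₀ : B₀ →ₗ[ℂ] Z) (ψ₁ : B₁ →ₗ[ℂ] Z),
      IsCompleteIsometry ψ₀ ∧ IsCompleteIsometry ψ₁ ∧
      ∀ i, dist (ψ₀ (ι (a i))) (ψ₁ (φ (a i))) ≤ ε

/-- A Fraïssé class of operator spaces: a class of finitely generated (i.e. finite-dimensional)
spaces with the hereditary, joint embedding and near amalgamation properties such that every `C(k)`
is a complete separable metric space under the Fraïssé metric. -/
structure IsFraisseClass (C : OperatorSpace → Prop) : Prop where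
  finitelyGenerated : ∀ X, C X → FiniteDimensional ℂ X
  hereditary : HereditaryProperty C
  jointEmbedding : JointEmbeddingProperty C
  nearAmalgamation : NearAmalgamationProperty C
  complete_separable : ∀ k : ℕ, ∃ _ : MetricSpace (FraisseSpace C k),
    IsFraisseMetric C k ∧ CompleteSpace (FraisseSpace C k) ∧
      TopologicalSpace.SeparableSpace (FraisseSpace C k)

end OperatorSpace

end

/-!
# The `1`-exact operator spaces form a Fraïssé class

Everything reduces to one comparison of tuples: `Approximates a b δ` says that each image of `a`
under a complete contraction into a matrix algebra lies within `δ` of such an image of `b`.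
The Fraïssé distance of two tuples generating `1`-exact spaces is the infimum of the `δ` for which
each of them approximates the other (`approximates_of_fraisseDist_lt`, `fraisseDist_le`).

One half of this is the extension theorem for complete contractions into `M_m`
(`exists_extension`). A map into `M_m` is regarded as a functional on matrices, the functionals
coming from complete contractions are those dominated by the gauge `factorSeminorm` of
factorizations through scalar matrices, and the Hahn–Banach theorem extends them. The other half,
which also gives joint embedding and near amalgamation, is `exists_common_embedding`: tuples which
approximate each other up to `δ` come within `δ + ε` in a common `1`-exact space. For this,
`exists_nuclear_embedding` embeds a `1`-exact space `B` into a `1`-exact space `Z` so that the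
embedding almost factors through a complete contraction `T : B → M_n` and a complete contraction
`M_n → Z`. The space `Z` comes from a tower of almost completely isometric maps of `B` into matrix
algebras, each of which is rescaled so that it factors through the preceding one by a complete
contraction (`exists_tower`). It is spanned by `B` and `M_n`, both of which map to every stage of
the tower, and its matrix norms are the suprema over the stages. Since the scaling factors converge
and the norms on `M_n` decrease along the tower, finitely many stages determine the norms up to a
factor `1 + ε`, hence `Z` is `1`-exact (`E1_of_finite_families`).

Given these facts, the triangle inequality is composition of approximations, and distance zero
forces equality of all matrix norms, since a `1`-exact space is normed by complete contractions into
matrix algebras. For a fast Cauchy sequence, the tuples of matrices which are close to images of all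
its members define the matrix norms of a limit space (`exists_limit`). It is the limit by
`exists_limit_values` in one direction and by `approximates_of_coordinates` in the other, and it is
`1`-exact by `E1_of_approximates`. An almost completely isometric complete contraction `X → M_n`
moves a tuple only a little (`exists_matrixTuple_near`); this gives density of the matricial points,
and separability, because `M_n ^ k` maps Lipschitz continuously to `𝓔₁(k)`. Finally, the conditions
on Auerbach bases are inequalities between norms of linear combinations and so pass to limits.
-/

noncomputable section

namespace OperatorSpace

/-! ### Matrices of operators and scalar contractions -/

/-- The algebra `M_n = B(ℂⁿ)`. -/
abbrev MatOp (n : ℕ) : Type := EuclideanSpace ℂ (Fin n) →L[ℂ] EuclideanSpace ℂ (Fin n)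

section Amplification

variable {V : Type*} [AddCommGroup V] [Module ℂ V]
  {H : Type} [NormedAddCommGroup H] [InnerProductSpace ℂ H]
  {K : Type} [NormedAddCommGroup K] [InnerProductSpace ℂ K]
  {r : ℕ}

theorem blockOperator_apply (x : Matrix (Fin r) (Fin r) (H →L[ℂ] H))
    (ξ : PiLp 2 (fun _ : Fin r => H)) (i : Fin r) :
    blockOperator x ξ i = ∑ j, x i j (ξ j) := by
  simp [blockOperator]

/-- The norm of the amplification of a linear map `f : V → B(H)` at a matrix over `V`; for the
inclusion of an operator space this is `matNorm`. -/
def ampNorm (f : V →ₗ[ℂ] (H →L[ℂ] H)) (x : Matrix (Fin r) (Fin r) V) : ℝ :=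
  ‖blockOperator (x.map f)‖

theorem ampNorm_nonneg (f : V →ₗ[ℂ] (H →L[ℂ] H)) (x : Matrix (Fin r) (Fin r) V) :
    0 ≤ ampNorm f x := norm_nonneg (blockOperator (x.map f))

theorem ampNorm_le_iff {f : V →ₗ[ℂ] (H →L[ℂ] H)} {x : Matrix (Fin r) (Fin r) V} {C : ℝ}
    (hC : 0 ≤ C) : ampNorm f x ≤ C ↔
      ∀ ξ : Fin r → H, ∑ i, ‖∑ j, f (x i j) (ξ j)‖ ^ 2 ≤ C ^ 2 * ∑ j, ‖ξ j‖ ^ 2 := by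
  rw [ampNorm, ContinuousLinearMap.opNorm_le_iff hC]
  have key : ∀ ξ : PiLp 2 (fun _ : Fin r => H), ‖blockOperator (x.map f) ξ‖ ≤ C * ‖ξ‖ ↔
      ∑ i, ‖∑ j, f (x i j) (ξ j)‖ ^ 2 ≤ C ^ 2 * ∑ j, ‖ξ j‖ ^ 2 := by
    intro ξ
    rw [← PiLp.norm_sq_eq_of_L2, ← mul_pow]
    have : ∑ i, ‖∑ j, f (x i j) (ξ j)‖ ^ 2 = ‖blockOperator (x.map f) ξ‖ ^ 2 := by
      rw [PiLp.norm_sq_eq_of_L2]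
      simp [blockOperator_apply]
    rw [this, pow_le_pow_iff_left₀ (norm_nonneg _) (by positivity) two_ne_zero]
  constructor
  · intro h ξ
    exact (key (WithLp.toLp 2 ξ)).1 (h _)
  · intro h ξ
    exact (key ξ).2 (h ξ)

theorem sum_norm_sq_le_ampNorm (f : V →ₗ[ℂ] (H →L[ℂ] H)) (x : Matrix (Fin r) (Fin r) V)
    (ξ : Fin r → H) :
    ∑ i, ‖∑ j, f (x i j) (ξ j)‖ ^ 2 ≤ ampNorm f x ^ 2 * ∑ j, ‖ξ j‖ ^ 2 :=
  (ampNorm_le_iff (ampNorm_nonneg f x)).1 le_rfl ξ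

theorem ampNorm_comp {W : Type*} [AddCommGroup W] [Module ℂ W] (f : V →ₗ[ℂ] (H →L[ℂ] H))
    (s : W →ₗ[ℂ] V) (x : Matrix (Fin r) (Fin r) W) :
    ampNorm (f ∘ₗ s) x = ampNorm f (x.map s) := rfl

theorem blockOperator_add (x y : Matrix (Fin r) (Fin r) (H →L[ℂ] H)) :
    blockOperator (x + y) = blockOperator x + blockOperator y := by
  ext ξ i
  simp [blockOperator_apply, Finset.sum_add_distrib]

theorem ampNorm_add_le (f g : V →ₗ[ℂ] (H →L[ℂ] H)) (x : Matrix (Fin r) (Fin r) V) :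
    ampNorm (f + g) x ≤ ampNorm f x + ampNorm g x := by
  have : x.map (f + g) = x.map f + x.map g := by ext; simp
  rw [ampNorm, this, blockOperator_add]
  exact norm_add_le (blockOperator (x.map f)) (blockOperator (x.map g))

theorem ampNorm_smul (c : ℂ) (f : V →ₗ[ℂ] (H →L[ℂ] H)) (x : Matrix (Fin r) (Fin r) V) :
    ampNorm (c • f) x = ‖c‖ * ampNorm f x := by
  have key : ∀ (c : ℂ) (f : V →ₗ[ℂ] (H →L[ℂ] H)), ampNorm (c • f) x ≤ ‖c‖ * ampNorm f x := by
    intro c f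
    rw [ampNorm_le_iff (mul_nonneg (norm_nonneg _) (ampNorm_nonneg f x))]
    intro ξ
    have h := mul_le_mul_of_nonneg_left (sum_norm_sq_le_ampNorm f x ξ) (sq_nonneg ‖c‖)
    refine le_trans (le_of_eq ?_) (h.trans (by rw [mul_pow, mul_assoc]))
    simp [Finset.mul_sum, ← Finset.smul_sum, norm_smul, mul_pow]
  refine le_antisymm (key c f) ?_
  rcases eq_or_ne c 0 with rfl | hc
  · simpa using ampNorm_nonneg _ x
  · have h := key c⁻¹ (c • f)
    rw [smul_smul, inv_mul_cancel₀ hc, one_smul, norm_inv] at h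
    have hc' : 0 < ‖c‖ := norm_pos_iff.2 hc
    calc ‖c‖ * ampNorm f x ≤ ‖c‖ * (‖c‖⁻¹ * ampNorm (c • f) x) := by gcongr
      _ = ampNorm (c • f) x := by field_simp

theorem ampNorm_zero (x : Matrix (Fin r) (Fin r) V) :
    ampNorm (0 : V →ₗ[ℂ] (H →L[ℂ] H)) x = 0 := by
  simpa using ampNorm_smul (0 : ℂ) (0 : V →ₗ[ℂ] (H →L[ℂ] H)) x

theorem ampNorm_sum_le {ι : Type*} (s : Finset ι) (f : ι → V →ₗ[ℂ] (H →L[ℂ] H))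
    (x : Matrix (Fin r) (Fin r) V) : ampNorm (∑ i ∈ s, f i) x ≤ ∑ i ∈ s, ampNorm (f i) x := by
  classical
  induction s using Finset.induction_on with
  | empty => simp [ampNorm_zero]
  | insert a s ha ih =>
    rw [Finset.sum_insert ha, Finset.sum_insert ha]
    exact (ampNorm_add_le _ _ _).trans (by gcongr)

/-- At matrices of size one the amplified norm is the operator norm. -/
theorem ampNorm_one (f : V →ₗ[ℂ] (H →L[ℂ] H)) (v : V) :
    ampNorm f (Matrix.of fun _ _ : Fin 1 => v) = ‖f v‖ := by
  apply le_antisymm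
  · refine (ampNorm_le_iff (norm_nonneg _)).2 fun ξ => ?_
    simp only [Finset.univ_unique, Finset.sum_singleton, ← mul_pow, Matrix.of_apply]
    gcongr
    exact (f v).le_opNorm _
  · refine ContinuousLinearMap.opNorm_le_bound _ (ampNorm_nonneg _ _) fun ξ => ?_
    have := sum_norm_sq_le_ampNorm f (Matrix.of fun _ _ : Fin 1 => v) (fun _ => ξ)
    simp only [Finset.univ_unique, Finset.sum_singleton, ← mul_pow, Matrix.of_apply] at this
    exact le_of_sq_le_sq this (mul_nonneg (ampNorm_nonneg _ _) (norm_nonneg _))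

/-- A crude bound, used only where matrices of a fixed size matter. -/
theorem ampNorm_le_sum (f : V →ₗ[ℂ] (H →L[ℂ] H)) (x : Matrix (Fin r) (Fin r) V) :
    ampNorm f x ≤ ∑ i, ∑ j, ‖f (x i j)‖ := by
  refine (ampNorm_le_iff (by positivity)).2 fun ξ => ?_
  set t := √(∑ j, ‖ξ j‖ ^ 2)
  have ht : t ^ 2 = ∑ j, ‖ξ j‖ ^ 2 := Real.sq_sqrt (by positivity)
  have ht' : ∀ j, ‖ξ j‖ ≤ t := fun j => Real.le_sqrt_of_sq_le
    (Finset.single_le_sum (f := fun j => ‖ξ j‖ ^ 2) (fun _ _ => by positivity) (Finset.mem_univ j))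
  have h : ∀ i, ‖∑ j, f (x i j) (ξ j)‖ ≤ (∑ j, ‖f (x i j)‖) * t := fun i => by
    rw [Finset.sum_mul]
    refine (norm_sum_le _ _).trans (Finset.sum_le_sum fun j _ => ?_)
    exact ((f (x i j)).le_opNorm _).trans (by gcongr; exact ht' j)
  calc ∑ i, ‖∑ j, f (x i j) (ξ j)‖ ^ 2 ≤ ∑ i, ((∑ j, ‖f (x i j)‖) * t) ^ 2 := by
        gcongr with i; exact h i
    _ = (∑ i, (∑ j, ‖f (x i j)‖) ^ 2) * t ^ 2 := by
        rw [Finset.sum_mul]; simp only [mul_pow]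
    _ ≤ (∑ i, ∑ j, ‖f (x i j)‖) ^ 2 * ∑ j, ‖ξ j‖ ^ 2 := by
        rw [ht]
        gcongr
        exact Finset.sum_sq_le_sq_sum_of_nonneg fun _ _ => by positivity

/-- `f` is dominated by `g` at all matrix levels. If `g` is the inclusion of an operator space this
says that `f` is completely contractive. -/
def CompLE (f : V →ₗ[ℂ] (H →L[ℂ] H)) (g : V →ₗ[ℂ] (K →L[ℂ] K)) : Prop :=
  ∀ (r : ℕ) (x : Matrix (Fin r) (Fin r) V), ampNorm f x ≤ ampNorm g x

theorem CompLE.norm_le {f : V →ₗ[ℂ] (H →L[ℂ] H)} {g : V →ₗ[ℂ] (K →L[ℂ] K)} (h : CompLE f g)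
    (v : V) : ‖f v‖ ≤ ‖g v‖ := by
  rw [← ampNorm_one f, ← ampNorm_one g]
  exact h 1 _

theorem CompLE.comp {W : Type*} [AddCommGroup W] [Module ℂ W]
    {f : V →ₗ[ℂ] (H →L[ℂ] H)} {g : V →ₗ[ℂ] (K →L[ℂ] K)} (h : CompLE f g) (s : W →ₗ[ℂ] V) :
    CompLE (f ∘ₗ s) (g ∘ₗ s) := fun r x => h r (x.map s)

theorem CompLE.refl (f : V →ₗ[ℂ] (H →L[ℂ] H)) : CompLE f f := fun _ _ => le_rfl

theorem CompLE.trans {L : Type} [NormedAddCommGroup L] [InnerProductSpace ℂ L]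
    {f : V →ₗ[ℂ] (H →L[ℂ] H)} {g : V →ₗ[ℂ] (K →L[ℂ] K)}
    {h : V →ₗ[ℂ] (L →L[ℂ] L)} (h₁ : CompLE f g) (h₂ : CompLE g h) : CompLE f h :=
  fun r x => (h₁ r x).trans (h₂ r x)

end Amplification

section ScalarContraction

variable {H : Type*} [NormedAddCommGroup H] [InnerProductSpace ℂ H]
  {ι κ : Type*} [Fintype ι] [Fintype κ]

theorem sum_norm_sq_smul_eq (α : Matrix ι κ ℂ) (y : κ → H) :
    ∑ i, ‖∑ k, α i k • y k‖ ^ 2 =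
      (∑ k, ∑ l, (α.conjTranspose * α) k l * inner ℂ (y k) (y l)).re := by
  have h : ∀ i, ‖∑ k, α i k • y k‖ ^ 2 =
      (∑ k, ∑ l, (star (α i k) * α i l) * inner ℂ (y k) (y l)).re := by
    intro i
    rw [← inner_self_eq_norm_sq (𝕜 := ℂ), sum_inner]
    refine congrArg Complex.re (Finset.sum_congr rfl fun k _ => ?_)
    rw [inner_sum]
    refine Finset.sum_congr rfl fun l _ => ?_
    rw [inner_smul_left, inner_smul_right, starRingEnd_apply]; ring
  simp only [h, ← Complex.re_sum]
  congr 1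
  rw [Finset.sum_comm]
  refine Finset.sum_congr rfl fun k _ => ?_
  rw [Finset.sum_comm]
  refine Finset.sum_congr rfl fun l _ => ?_
  simp [Matrix.mul_apply, Finset.sum_mul]

open scoped MatrixOrder ComplexOrder in
/-- A scalar matrix `α` with `αᴴ α ≤ C` acts on columns of vectors of any inner product space with
norm at most `√C`: the defect is a sum of squares because `C - αᴴ α` has the form `βᴴ β`. -/
theorem sum_norm_sq_smul_le [DecidableEq κ] (α : Matrix ι κ ℂ) {C : ℝ}
    (h : ((C : ℂ) • (1 : Matrix κ κ ℂ) - α.conjTranspose * α).PosSemidef) (y : κ → H) :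
    ∑ i, ‖∑ k, α i k • y k‖ ^ 2 ≤ C * ∑ k, ‖y k‖ ^ 2 := by
  obtain ⟨β, hβ⟩ := CStarAlgebra.nonneg_iff_eq_star_mul_self.mp h.nonneg
  have h1 := sum_norm_sq_smul_eq α y
  have h2 := sum_norm_sq_smul_eq β y
  have h3 : 0 ≤ ∑ i, ‖∑ k, β i k • y k‖ ^ 2 := by positivity
  have h4 : (C * ∑ k, ‖y k‖ ^ 2 : ℝ) =
      (∑ k, ∑ l, ((C : ℂ) • (1 : Matrix κ κ ℂ)) k l * inner ℂ (y k) (y l)).re := by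
    simp only [Matrix.smul_apply, Matrix.one_apply, smul_eq_mul, mul_ite, mul_one, mul_zero,
      ite_mul, zero_mul, Finset.sum_ite_eq, Finset.mem_univ, if_true, Complex.re_sum,
      Complex.re_ofReal_mul, Finset.mul_sum]
    refine Finset.sum_congr rfl fun k _ => ?_
    rw [← inner_self_eq_norm_sq (𝕜 := ℂ)]; rfl
  rw [← Matrix.star_eq_conjTranspose, ← hβ] at h2
  rw [h2] at h3
  rw [h1, h4, ← sub_nonneg, ← Complex.sub_re, ← Finset.sum_sub_distrib]
  simpa only [← Finset.sum_sub_distrib, ← sub_mul, Matrix.sub_apply] using h3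

theorem star_dotProduct_self_eq (w : κ → ℂ) :
    star w ⬝ᵥ w = ((∑ k, ‖w k‖ ^ 2 : ℝ) : ℂ) := by
  simp only [dotProduct, Pi.star_apply, RCLike.star_def, Complex.ofReal_sum]
  refine Finset.sum_congr rfl fun k _ => ?_
  rw [Complex.conj_mul']; simp

open scoped ComplexOrder in
/-- The bound of a scalar matrix on `ℂ^κ` persists on columns of vectors of any inner product
space. -/
theorem sum_norm_sq_smul_le_of_scalar [DecidableEq κ] (α : Matrix ι κ ℂ) {C : ℝ}
    (h : ∀ z : κ → ℂ, ∑ i, ‖∑ k, α i k * z k‖ ^ 2 ≤ C * ∑ k, ‖z k‖ ^ 2) (y : κ → H) :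
    ∑ i, ‖∑ k, α i k • y k‖ ^ 2 ≤ C * ∑ k, ‖y k‖ ^ 2 := by
  apply sum_norm_sq_smul_le
  refine Matrix.PosSemidef.of_dotProduct_mulVec_nonneg ?_ fun z => ?_
  · refine Matrix.IsHermitian.sub ?_ (Matrix.isHermitian_conjTranspose_mul_self α)
    rw [Matrix.IsHermitian, Matrix.conjTranspose_smul]; simp
  · have e1 : star z ⬝ᵥ (((C : ℂ) • (1 : Matrix κ κ ℂ) - α.conjTranspose * α).mulVec z)
        = ((C * ∑ k, ‖z k‖ ^ 2 - ∑ i, ‖∑ k, α i k * z k‖ ^ 2 : ℝ) : ℂ) := by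
      rw [Matrix.sub_mulVec, dotProduct_sub, Matrix.smul_mulVec, Matrix.one_mulVec,
        dotProduct_smul, ← Matrix.mulVec_mulVec, Matrix.dotProduct_mulVec,
        Matrix.vecMul_conjTranspose, star_star]
      rw [star_dotProduct_self_eq, star_dotProduct_self_eq]
      simp [Matrix.mulVec, dotProduct]
    rw [e1]
    exact_mod_cast sub_nonneg.2 (h z)

end ScalarContraction

/-! ### Extension of completely contractive maps into matrix algebras -/

section Sandwich

variable {ι κ μ ν ρ σ : Type*} [Fintype ι] [Fintype κ]
  {E F : Type*} [AddCommGroup E] [Module ℂ E] [AddCommGroup F] [Module ℂ F]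

/-- The product `P w Q` of a matrix `w` over a vector space with scalar matrices `P` and `Q`. -/
def sandwich (P : Matrix μ ι ℂ) (w : Matrix ι κ E) (Q : Matrix κ ν ℂ) : Matrix μ ν E :=
  Matrix.of fun a b => ∑ i, ∑ j, (P a i * Q j b) • w i j

theorem map_sandwich (f : E →ₗ[ℂ] F) (P : Matrix μ ι ℂ) (w : Matrix ι κ E) (Q : Matrix κ ν ℂ) :
    (sandwich P w Q).map f = sandwich P (w.map f) Q := by
  ext a b
  simp [sandwich]

theorem sandwich_sandwich [Fintype μ] [Fintype ν] (P : Matrix ρ μ ℂ) (A : Matrix μ ι ℂ)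
    (w : Matrix ι κ E) (B : Matrix κ ν ℂ) (Q : Matrix ν σ ℂ) :
    sandwich P (sandwich A w B) Q = sandwich (P * A) w (B * Q) := by
  ext a b
  simp only [sandwich, Matrix.of_apply, Matrix.mul_apply, Finset.smul_sum, smul_smul,
    Finset.sum_mul_sum, Finset.sum_smul]
  rw [show (∑ c, ∑ d, ∑ i, ∑ j, (P a c * Q d b * (A c i * B j d)) • w i j)
      = ∑ c, ∑ i, ∑ d, ∑ j, (P a c * Q d b * (A c i * B j d)) • w i j from
      Finset.sum_congr rfl fun c _ => Finset.sum_comm, Finset.sum_comm]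
  refine Finset.sum_congr rfl fun i _ => ?_
  rw [show (∑ c, ∑ d, ∑ j, (P a c * Q d b * (A c i * B j d)) • w i j)
      = ∑ c, ∑ j, ∑ d, (P a c * Q d b * (A c i * B j d)) • w i j from
      Finset.sum_congr rfl fun c _ => Finset.sum_comm, Finset.sum_comm]
  refine Finset.sum_congr rfl fun j _ => Finset.sum_congr rfl fun c _ =>
    Finset.sum_congr rfl fun d _ => ?_
  congr 1; ring

theorem one_sandwich_one [DecidableEq ι] [DecidableEq κ] (w : Matrix ι κ E) :
    sandwich 1 w 1 = w := by
  ext a b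
  simp [sandwich, Matrix.one_apply, mul_ite]

variable {H : Type*} [NormedAddCommGroup H] [InnerProductSpace ℂ H]

theorem sum_inner_sandwich [Fintype μ] [Fintype ν] (P : Matrix μ ι ℂ)
    (w : Matrix ι κ (H →L[ℂ] H)) (Q : Matrix κ ν ℂ) (η : μ → H) (ξ : ν → H) :
    ∑ a, ∑ b, inner ℂ (η a) (sandwich P w Q a b (ξ b)) =
      ∑ i, ∑ j, inner ℂ (∑ a, P.conjTranspose i a • η a) (w i j (∑ b, Q j b • ξ b)) := by
  simp only [sandwich, Matrix.of_apply, sum_inner, inner_sum, map_sum, map_smul, inner_smul_left,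
    inner_smul_right, _root_.sum_apply, _root_.smul_apply,
    Matrix.conjTranspose_apply, Finset.mul_sum]
  rw [show (∑ a, ∑ b, ∑ i, ∑ j, (P a i * Q j b) * inner ℂ (η a) (w i j (ξ b)))
      = ∑ a, ∑ i, ∑ b, ∑ j, (P a i * Q j b) * inner ℂ (η a) (w i j (ξ b)) from
      Finset.sum_congr rfl fun c _ => Finset.sum_comm, Finset.sum_comm]
  refine Finset.sum_congr rfl fun i _ => ?_
  rw [show (∑ a, ∑ b, ∑ j, (P a i * Q j b) * inner ℂ (η a) (w i j (ξ b)))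
      = ∑ a, ∑ j, ∑ b, (P a i * Q j b) * inner ℂ (η a) (w i j (ξ b)) from
      Finset.sum_congr rfl fun c _ => Finset.sum_comm, Finset.sum_comm]
  refine Finset.sum_congr rfl fun j _ => ?_
  rw [Finset.sum_comm]
  refine Finset.sum_congr rfl fun b _ => Finset.sum_congr rfl fun a _ => ?_
  simp; ring

/-- A matrix of operators that is a contraction between Hilbert space sums. -/
def IsContr (w : Matrix ι κ (H →L[ℂ] H)) : Prop :=
  ∀ ξ : κ → H, ∑ i, ‖∑ j, w i j (ξ j)‖ ^ 2 ≤ ∑ j, ‖ξ j‖ ^ 2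

theorem isContr_iff (w : Matrix ι κ (H →L[ℂ] H)) : IsContr w ↔ ∀ (η : ι → H) (ξ : κ → H),
    (∑ i, ∑ j, inner ℂ (η i) (w i j (ξ j))).re ≤ (∑ i, ‖η i‖ ^ 2 + ∑ j, ‖ξ j‖ ^ 2) / 2 := by
  constructor
  · intro h η ξ
    have h1 : (∑ i, ∑ j, inner ℂ (η i) (w i j (ξ j))).re
        ≤ ∑ i, (‖η i‖ ^ 2 + ‖∑ j, w i j (ξ j)‖ ^ 2) / 2 := by
      rw [Complex.re_sum]
      refine Finset.sum_le_sum fun i _ => ?_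
      rw [← inner_sum]
      have := re_inner_le_norm (𝕜 := ℂ) (η i) (∑ j, w i j (ξ j))
      simp only [RCLike.re_to_complex] at this
      nlinarith [sq_nonneg (‖η i‖ - ‖∑ j, w i j (ξ j)‖)]
    rw [← Finset.sum_div, Finset.sum_add_distrib] at h1
    linarith [h ξ]
  · intro h ξ
    have h1 := h (fun i => ∑ j, w i j (ξ j)) ξ
    simp only [← inner_sum] at h1
    rw [Complex.re_sum] at h1
    have : ∀ i, (inner ℂ (∑ j, w i j (ξ j)) (∑ j, w i j (ξ j))).re = ‖∑ j, w i j (ξ j)‖ ^ 2 :=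
      fun i => inner_self_eq_norm_sq (𝕜 := ℂ) _
    simp only [this] at h1
    linarith

end Sandwich

section Extension

variable {H : Type} [NormedAddCommGroup H] [InnerProductSpace ℂ H] {m : ℕ}

theorem isContr_map_iff {V : Type*} [AddCommGroup V] [Module ℂ V] (f : V →ₗ[ℂ] (H →L[ℂ] H)) {r : ℕ}
    (x : Matrix (Fin r) (Fin r) V) : IsContr (x.map f) ↔ ampNorm f x ≤ 1 := by
  rw [ampNorm_le_iff zero_le_one]
  simp [IsContr]

/-- The values `(‖α‖₂² + ‖β‖₂²) / 2` over the factorizations `v = α w β` of a matrix of operators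
through a contraction `w`, with Hilbert-Schmidt norms. Their infimum is the norm of `v` in the
predual of the completely bounded maps into `M_m`. -/
def factorValues (v : Matrix (Fin m) (Fin m) (H →L[ℂ] H)) : Set ℝ :=
  {t | ∃ (ι : Type) (_ : Fintype ι) (α : Matrix (Fin m) ι ℂ) (w : Matrix ι ι (H →L[ℂ] H))
    (β : Matrix ι (Fin m) ℂ), IsContr w ∧ v = sandwich α w β ∧
    t = (∑ i, ∑ a, ‖α a i‖ ^ 2 + ∑ j, ∑ b, ‖β j b‖ ^ 2) / 2}

theorem factorValues_nonneg {v : Matrix (Fin m) (Fin m) (H →L[ℂ] H)} {t : ℝ}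
    (h : t ∈ factorValues v) : 0 ≤ t := by
  obtain ⟨ι, _, α, w, β, -, -, rfl⟩ := h
  positivity

theorem factorValues_bddBelow (v : Matrix (Fin m) (Fin m) (H →L[ℂ] H)) :
    BddBelow (factorValues v) := ⟨0, fun _ => factorValues_nonneg⟩

theorem factorValues_add {v v' : Matrix (Fin m) (Fin m) (H →L[ℂ] H)} {t t' : ℝ}
    (h : t ∈ factorValues v) (h' : t' ∈ factorValues v') : t + t' ∈ factorValues (v + v') := by
  obtain ⟨ι, _, α, w, β, hw, rfl, rfl⟩ := h
  obtain ⟨κ, _, α', w', β', hw', rfl, rfl⟩ := h'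
  refine ⟨ι ⊕ κ, inferInstance, Matrix.fromCols α α', Matrix.fromBlocks w 0 0 w',
    Matrix.fromRows β β', ?_, ?_, ?_⟩
  · intro ξ
    simpa [Fintype.sum_sum_type] using add_le_add (hw (ξ ∘ Sum.inl)) (hw' (ξ ∘ Sum.inr))
  · ext a b
    simp [sandwich, Fintype.sum_sum_type]
  · simp [Fintype.sum_sum_type]; ring

theorem factorValues_smul {v : Matrix (Fin m) (Fin m) (H →L[ℂ] H)} {t : ℝ}
    (h : t ∈ factorValues v) {c : ℂ} (hc : c ≠ 0) : ‖c‖ * t ∈ factorValues (c • v) := by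
  obtain ⟨ι, _, α, w, β, hw, rfl, rfl⟩ := h
  have hc' : 0 < ‖c‖ := norm_pos_iff.2 hc
  have hs : √‖c‖ ^ 2 = ‖c‖ := Real.sq_sqrt hc'.le
  have hs0 : 0 < √‖c‖ := Real.sqrt_pos.2 hc'
  refine ⟨ι, inferInstance, (c / (√‖c‖ : ℝ)) • α, w, ((√‖c‖ : ℝ) : ℂ) • β, hw, ?_, ?_⟩
  · ext1 a b
    simp only [sandwich, Matrix.smul_apply, Matrix.of_apply, Finset.smul_sum, smul_smul,
      smul_eq_mul]
    refine Finset.sum_congr rfl fun i _ => Finset.sum_congr rfl fun j _ => ?_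
    congr 1
    have : ((√‖c‖ : ℝ) : ℂ) ≠ 0 := by exact_mod_cast hs0.ne'
    field_simp
  · have e1 : (‖c‖ / √‖c‖) ^ 2 = ‖c‖ := by rw [div_pow, hs]; field_simp
    simp only [Matrix.smul_apply, norm_smul, norm_div, Complex.norm_real, Real.norm_eq_abs,
      abs_of_pos hs0, mul_pow, e1, hs, ← Finset.mul_sum]
    ring

theorem factorValues_nonempty (v : Matrix (Fin m) (Fin m) (H →L[ℂ] H)) :
    (factorValues v).Nonempty := by
  set C := ampNorm (LinearMap.id : (H →L[ℂ] H) →ₗ[ℂ] _) v + 1 with hC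
  have hC0 : 0 < C := by have := ampNorm_nonneg (LinearMap.id : (H →L[ℂ] H) →ₗ[ℂ] _) v; positivity
  refine ⟨_, Fin m, inferInstance, (C : ℂ) • 1, (C : ℂ)⁻¹ • v, 1, ?_, ?_, rfl⟩
  · have := (isContr_map_iff ((C : ℂ)⁻¹ • (LinearMap.id : (H →L[ℂ] H) →ₗ[ℂ] _)) v).2 (by
      rw [ampNorm_smul, norm_inv, Complex.norm_real, Real.norm_of_nonneg hC0.le,
        inv_mul_le_iff₀ hC0]
      linarith)
    convert this using 1
    ext1; simp
  · have : (C : ℂ) ≠ 0 := by exact_mod_cast hC0.ne'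
    ext1 a b
    simp [sandwich, Matrix.one_apply, ite_mul, mul_ite, smul_smul, this]

/-- The infimum of `factorValues`. -/
def factorSeminorm (m : ℕ) (H : Type) [NormedAddCommGroup H] [InnerProductSpace ℂ H] :
    Seminorm ℂ (Matrix (Fin m) (Fin m) (H →L[ℂ] H)) :=
  Seminorm.ofSMulLE (fun v => sInf (factorValues v))
    (le_antisymm
      (csInf_le (factorValues_bddBelow _)
        ⟨Empty, inferInstance, 0, 0, 0, fun ξ => by simp, by ext1; simp [sandwich], by simp⟩)
      (le_csInf (factorValues_nonempty _) fun _ => factorValues_nonneg))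
    (fun v v' => by
      rw [← csInf_add (factorValues_nonempty _) (factorValues_bddBelow _)
        (factorValues_nonempty _) (factorValues_bddBelow _)]
      refine le_csInf ((factorValues_nonempty _).add (factorValues_nonempty _)) ?_
      rintro _ ⟨t, ht, t', ht', rfl⟩
      exact csInf_le (factorValues_bddBelow _) (factorValues_add ht ht'))
    (fun c v => by
      rcases eq_or_ne c 0 with rfl | hc
      · rw [norm_zero, zero_mul, zero_smul]
        exact csInf_le (factorValues_bddBelow _)
          ⟨Empty, inferInstance, 0, 0, 0, fun ξ => by simp, by ext1; simp [sandwich], by simp⟩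
      · have hc' : 0 < ‖c‖ := norm_pos_iff.2 hc
        rw [← div_le_iff₀' hc']
        refine le_csInf (factorValues_nonempty _) fun t ht => ?_
        rw [div_le_iff₀' hc']
        exact csInf_le (factorValues_bddBelow _) (factorValues_smul ht hc))

theorem factorSeminorm_le {v : Matrix (Fin m) (Fin m) (H →L[ℂ] H)} {t : ℝ}
    (h : t ∈ factorValues v) : factorSeminorm m H v ≤ t :=
  csInf_le (factorValues_bddBelow _) h

open scoped MatrixOrder ComplexOrder in
/-- Every Gram matrix `A Aᴴ` becomes, after adding a small multiple of the identity, of the form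
`Xᴴ X` with `X` invertible, and then `(Xᴴ)⁻¹ A` is a contraction. -/
theorem exists_gram_perturbation {ι : Type*} [Fintype ι] (A : Matrix (Fin m) ι ℂ) {ε : ℝ}
    (hε : 0 < ε) : ∃ X P : Matrix (Fin m) (Fin m) ℂ, X.conjTranspose * P = 1 ∧
      (((1 : ℝ) : ℂ) • (1 : Matrix (Fin m) (Fin m) ℂ)
        - (P * A) * (P * A).conjTranspose).PosSemidef ∧
      ∑ c, ∑ a, ‖X c a‖ ^ 2 = ∑ i, ∑ a, ‖A a i‖ ^ 2 + m * ε := by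
  have hpd : (A * A.conjTranspose + (ε : ℂ) • 1).PosDef := by
    refine Matrix.PosDef.posSemidef_add (Matrix.posSemidef_self_mul_conjTranspose A) ?_
    exact Matrix.PosDef.smul Matrix.PosDef.one (by exact_mod_cast hε)
  obtain ⟨X, hX⟩ := CStarAlgebra.nonneg_iff_eq_star_mul_self.mp hpd.posSemidef.nonneg
  rw [Matrix.star_eq_conjTranspose] at hX
  have hu : IsUnit (X.conjTranspose * X) := hX ▸ hpd.isUnit
  have hdet : IsUnit X.conjTranspose.det := by
    have := (Matrix.isUnit_iff_isUnit_det _).1 hu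
    rw [Matrix.det_mul] at this
    exact isUnit_of_mul_isUnit_left this
  set P := (X.conjTranspose)⁻¹ with hP
  have h1 : X.conjTranspose * P = 1 := Matrix.mul_nonsing_inv _ hdet
  have h2 : P * X.conjTranspose = 1 := Matrix.nonsing_inv_mul _ hdet
  have h3 : X * P.conjTranspose = 1 := by
    have := congrArg Matrix.conjTranspose h2
    simpa [Matrix.conjTranspose_mul] using this
  refine ⟨X, P, h1, ?_, ?_⟩
  · have h4 : (P * A) * (P * A).conjTranspose = 1 - (ε : ℂ) • (P * P.conjTranspose) := by
      have : A * A.conjTranspose = X.conjTranspose * X - (ε : ℂ) • 1 := by rw [← hX]; simp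
      calc (P * A) * (P * A).conjTranspose = P * (A * A.conjTranspose) * P.conjTranspose := by
            simp only [Matrix.conjTranspose_mul, Matrix.mul_assoc]
        _ = (P * X.conjTranspose) * (X * P.conjTranspose) - (ε : ℂ) • (P * P.conjTranspose) := by
            rw [this]; simp [Matrix.mul_sub, Matrix.sub_mul, Matrix.mul_assoc]
        _ = _ := by rw [h2, h3, Matrix.one_mul]
    rw [h4]
    simp only [Complex.ofReal_one, one_smul, sub_sub_cancel]
    exact (Matrix.posSemidef_self_mul_conjTranspose P).smul (by exact_mod_cast hε.le)
  · have ht := congrArg (fun M => (Matrix.trace M).re) hX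
    simp only [Matrix.trace_add, Matrix.trace_smul, Matrix.trace_one] at ht
    simp only [Matrix.trace, Matrix.diag, Matrix.mul_apply, Matrix.conjTranspose_apply,
      Complex.add_re, Complex.re_sum, RCLike.star_def, Complex.mul_conj', Complex.conj_mul',
      Fintype.card_fin, smul_eq_mul] at ht
    norm_cast at ht
    rw [Finset.sum_comm, ← ht, Finset.sum_comm]
    ring

/-- The functional `v ↦ ∑ a b, ⟨e_a, f (v a b) e_b⟩` on `M_m(V)` associated with a linear map
`f : V → M_m`. -/
def matFunctional {V : Type*} [AddCommGroup V] [Module ℂ V]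
    (f : V →ₗ[ℂ] MatOp m) :
    Matrix (Fin m) (Fin m) V →ₗ[ℂ] ℂ where
  toFun v := ∑ a, ∑ b, inner ℂ (EuclideanSpace.single a (1 : ℂ))
    (f (v a b) (EuclideanSpace.single b (1 : ℂ)))
  map_add' v w := by simp [Finset.sum_add_distrib]
  map_smul' c v := by simp [Finset.mul_sum]

theorem matFunctional_sandwich {V : Type*} [AddCommGroup V] [Module ℂ V]
    (f : V →ₗ[ℂ] MatOp m)
    {ι : Type*} [Fintype ι]
    (P : Matrix (Fin m) ι ℂ) (w : Matrix ι ι V) (Q : Matrix ι (Fin m) ℂ) :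
    matFunctional f (sandwich P w Q) = ∑ i, ∑ j,
      inner ℂ (WithLp.toLp 2 fun a => star (P a i)) (f (w i j) (WithLp.toLp 2 fun b => Q j b)) := by
  have h := sum_inner_sandwich P (w.map f) Q
    (fun a => EuclideanSpace.single a (1 : ℂ)) (fun b => EuclideanSpace.single b (1 : ℂ))
  rw [← map_sandwich] at h
  refine Eq.trans h (Finset.sum_congr rfl fun i _ => Finset.sum_congr rfl fun j _ => ?_)
  have e : ∀ c : Fin m → ℂ, ∑ a, c a • EuclideanSpace.single a (1 : ℂ) = WithLp.toLp 2 c := by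
    intro c
    ext b
    simp [Finset.sum_apply, Pi.single_apply]
  rw [e, e]; rfl

/-- The pairing of a completely contractive `f` with a factorization of a matrix over a space larger
than the domain of `f`. The outer factors can be replaced by invertible square matrices of almost
the same Hilbert-Schmidt norm, and then the middle factor lies in the domain of `f`. -/
theorem matFunctional_re_le {V : Type*} [AddCommGroup V] [Module ℂ V] {T : V →ₗ[ℂ] (H →L[ℂ] H)}
    {f : V →ₗ[ℂ] MatOp m} (hf : CompLE f T)
    (v : Matrix (Fin m) (Fin m) V) {t : ℝ} (ht : t ∈ factorValues (v.map T)) :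
    (matFunctional f v).re ≤ t := by
  refine le_of_forall_pos_le_add fun δ hδ => ?_
  obtain ⟨ε, hε, hεδ⟩ : ∃ ε > 0, m * ε ≤ δ :=
    ⟨δ / (m + 1), by positivity, by
      rw [mul_div_assoc', div_le_iff₀ (by positivity)]; nlinarith⟩
  obtain ⟨ι, _, α, w, β, hw, hv, rfl⟩ := ht
  obtain ⟨X, P, hXP, hPα, hX⟩ := exists_gram_perturbation α hε
  obtain ⟨Y, Q, hYQ, hQβ, hY⟩ := exists_gram_perturbation β.conjTranspose hε
  have hQY : Q.conjTranspose * Y = 1 := by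
    simpa [Matrix.conjTranspose_mul] using congrArg Matrix.conjTranspose hYQ
  set u := sandwich P v Q.conjTranspose with hu
  have hvu : v = sandwich X.conjTranspose u Y := by
    rw [hu, sandwich_sandwich, hXP, hQY, one_sandwich_one]
  have hTu : u.map T = sandwich (P * α) w (β * Q.conjTranspose) := by
    rw [hu, map_sandwich, hv, sandwich_sandwich]
  have hc : IsContr (u.map T) := by
    rw [isContr_iff]
    intro η ξ
    rw [hTu, sum_inner_sandwich]
    refine ((isContr_iff w).1 hw _ _).trans ?_
    have h1 := sum_norm_sq_smul_le (P * α).conjTranspose (by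
      rw [Matrix.conjTranspose_conjTranspose]; exact hPα) η
    have h2 := sum_norm_sq_smul_le (β * Q.conjTranspose) (C := 1) (by
      simpa only [Matrix.conjTranspose_mul, Matrix.conjTranspose_conjTranspose] using hQβ) ξ
    linarith
  have hfu : IsContr (u.map f) :=
    (isContr_map_iff f u).2 ((hf m u).trans ((isContr_map_iff T u).1 hc))
  rw [hvu, matFunctional_sandwich]
  refine ((isContr_iff _).1 hfu _ _).trans ?_
  simp only [EuclideanSpace.norm_sq_eq, Matrix.conjTranspose_apply, star_star, norm_star] at hX hY ⊢
  rw [hX, hY]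
  linarith [Finset.sum_comm (f := fun (i : ι) (a : Fin m) => ‖β i a‖ ^ 2) (s := Finset.univ)
    (t := Finset.univ)]

theorem norm_matFunctional_le {V : Type*} [AddCommGroup V] [Module ℂ V] {T : V →ₗ[ℂ] (H →L[ℂ] H)}
    {f : V →ₗ[ℂ] MatOp m} (hf : CompLE f T)
    (v : Matrix (Fin m) (Fin m) V) :
    ‖matFunctional f v‖ ≤ factorSeminorm m H (v.map T) := by
  refine le_csInf (factorValues_nonempty _) fun t ht => ?_
  rcases eq_or_ne (matFunctional f v) 0 with h0 | h0
  · rw [h0, norm_zero]; exact factorValues_nonneg ht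
  set z := matFunctional f v
  -- Rotate so that the value becomes its own modulus
  have hz : ((‖z‖ : ℂ) / z) ≠ 0 := div_ne_zero (by simpa using h0) h0
  have h1 : ‖(‖z‖ : ℂ) / z‖ = 1 := by
    rw [norm_div, Complex.norm_real, norm_norm, div_self (norm_ne_zero_iff.2 h0)]
  have h2 := factorValues_smul ht hz
  rw [h1, one_mul] at h2
  have h3 := matFunctional_re_le hf (((‖z‖ : ℂ) / z) • v) (t := t) (by
    convert h2 using 2
    ext1; simp)
  rw [map_smul, smul_eq_mul, div_mul_cancel₀ _ h0] at h3
  simpa using h3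

theorem matFunctional_single {V : Type*} [AddCommGroup V] [Module ℂ V]
    (f : V →ₗ[ℂ] MatOp m) (a b : Fin m) (v : V) :
    matFunctional f (Matrix.single a b v) = inner ℂ (EuclideanSpace.single a (1 : ℂ))
      (f v (EuclideanSpace.single b (1 : ℂ))) := by
  change ∑ c, ∑ d, inner ℂ (EuclideanSpace.single c (1 : ℂ))
    (f (Matrix.single a b v c d) (EuclideanSpace.single d (1 : ℂ))) = _
  rw [Finset.sum_eq_single a, Finset.sum_eq_single b]
  · rw [Matrix.single_apply_same]
  · intro d _ hd
    rw [Matrix.single_apply_of_col_ne _ _ hd.symm]; simp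
  · simp
  · intro c _ hc
    simp [Matrix.single_apply_of_row_ne hc.symm]
  · simp

/-- Every functional on `M_m(V)` is of the form `matFunctional g`. -/
theorem exists_matFunctional_eq {V : Type*} [AddCommGroup V] [Module ℂ V]
    (s : Matrix (Fin m) (Fin m) V →ₗ[ℂ] ℂ) :
    ∃ g : V →ₗ[ℂ] MatOp m,
      matFunctional g = s := by
  refine ⟨∑ a, ∑ b, (s ∘ₗ Matrix.singleLinearMap ℂ a b).smulRight
    (InnerProductSpace.rankOne ℂ (EuclideanSpace.single a (1 : ℂ))
      (EuclideanSpace.single b (1 : ℂ))), ?_⟩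
  refine Matrix.ext_linearMap _ fun a b => LinearMap.ext fun v => ?_
  change matFunctional _ (Matrix.single a b v) = s (Matrix.single a b v)
  rw [matFunctional_single]
  simp [LinearMap.sum_apply, _root_.sum_apply, Matrix.singleLinearMap,
    EuclideanSpace.inner_single_left]

theorem eq_of_matFunctional_eq {V : Type*} [AddCommGroup V] [Module ℂ V]
    {f g : V →ₗ[ℂ] MatOp m}
    (h : ∀ (a b : Fin m) (v : V),
      matFunctional f (Matrix.single a b v) = matFunctional g (Matrix.single a b v)) : f = g := by
  ext1 v
  refine ContinuousLinearMap.coe_injective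
    ((EuclideanSpace.basisFun (Fin m) ℂ).toBasis.ext fun b => ?_)
  ext a
  simpa [matFunctional_single, EuclideanSpace.inner_single_left] using h a b v

theorem compLE_of_isContr {V : Type*} [AddCommGroup V] [Module ℂ V]
    {K : Type} [NormedAddCommGroup K] [InnerProductSpace ℂ K]
    {f : V →ₗ[ℂ] (K →L[ℂ] K)} {T : V →ₗ[ℂ] (H →L[ℂ] H)}
    (h : ∀ (r : ℕ) (x : Matrix (Fin r) (Fin r) V), IsContr (x.map T) → IsContr (x.map f)) :
    CompLE f T := by
  intro r x
  refine le_of_forall_gt_imp_ge_of_dense fun C hC => ?_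
  have hC0 : 0 < C := (ampNorm_nonneg _ _).trans_lt hC
  have hn : ‖(C : ℂ)⁻¹‖ = C⁻¹ := by rw [norm_inv, Complex.norm_real, Real.norm_of_nonneg hC0.le]
  have key := h r (x.map ((C : ℂ)⁻¹ • LinearMap.id : V →ₗ[ℂ] V))
  rw [isContr_map_iff, isContr_map_iff, ← ampNorm_comp, ← ampNorm_comp, LinearMap.comp_smul,
    LinearMap.comp_smul, ampNorm_smul, ampNorm_smul, hn, inv_mul_le_iff₀ hC0,
    inv_mul_le_iff₀ hC0, mul_one] at key
  exact key hC.le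

theorem exists_comp_eq_of_surjective {V W U : Type*} [AddCommGroup V] [Module ℂ V]
    [AddCommGroup W] [Module ℂ W] [AddCommGroup U] [Module ℂ U] (π : V →ₗ[ℂ] W)
    (hπ : Function.Surjective π) (f : V →ₗ[ℂ] U) (h : ∀ v, π v = 0 → f v = 0) :
    ∃ g : W →ₗ[ℂ] U, g ∘ₗ π = f := by
  obtain ⟨σ, hσ⟩ := π.exists_rightInverse_of_surjective (LinearMap.range_eq_top.2 hπ)
  refine ⟨f ∘ₗ σ, LinearMap.ext fun v => ?_⟩
  have h1 : π (σ (π v) - v) = 0 := by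
    rw [map_sub, ← LinearMap.comp_apply π σ, hσ]; simp
  simpa [sub_eq_zero] using h _ h1

/-- **Extension theorem** (Arveson, Wittstock): a completely contractive map into `M_m`, defined on
a space of operators on `H`, extends to a completely contractive map on `B(H)`. The space of
operators is given here as the image of a linear map `T`. The map is encoded by a functional on
matrices of size `m`, to which the Hahn-Banach theorem applies. -/
theorem exists_extension {V : Type*} [AddCommGroup V] [Module ℂ V] {T : V →ₗ[ℂ] (H →L[ℂ] H)}
    {f : V →ₗ[ℂ] MatOp m} (hf : CompLE f T) :
    ∃ g : (H →L[ℂ] H) →ₗ[ℂ] MatOp m,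
      g ∘ₗ T = f ∧ CompLE g LinearMap.id := by
  let Tm : Matrix (Fin m) (Fin m) V →ₗ[ℂ] Matrix (Fin m) (Fin m) (H →L[ℂ] H) := T.mapMatrix
  obtain ⟨s₀, hs₀⟩ := exists_comp_eq_of_surjective Tm.rangeRestrict Tm.surjective_rangeRestrict
    (matFunctional f) (by
      intro v hv
      have hv' : v.map T = 0 := congrArg Subtype.val hv
      refine norm_le_zero_iff.1 ((norm_matFunctional_le hf v).trans ?_)
      rw [hv', map_zero])
  obtain ⟨s, hs, hsp⟩ := Module.Dual.exists_extension_of_le_seminorm (LinearMap.range Tm) s₀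
    (p := factorSeminorm m H) (by
      rintro ⟨_, v, rfl⟩
      have := norm_matFunctional_le hf v
      rw [← hs₀] at this
      exact this)
  obtain ⟨g, hg⟩ := exists_matFunctional_eq s
  refine ⟨g, eq_of_matFunctional_eq fun a b v => ?_, compLE_of_isContr fun r x hx => ?_⟩
  · rw [matFunctional_single, LinearMap.comp_apply, ← matFunctional_single, hg, ← hs₀]
    refine Eq.trans ?_ (hs (Tm.rangeRestrict (Matrix.single a b v)))
    congr 1
    ext1 c d
    change _ = T _
    simp only [Matrix.single_apply]
    split_ifs <;> simp
  · -- The pairing of `g x` with vectors `η`, `ξ` is the functional at a matrix factored by `x`.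
    rw [isContr_iff]
    intro η ξ
    have h1 := matFunctional_sandwich g (Matrix.of fun a i => star (η i a)) x
      (Matrix.of fun j b => ξ j b)
    simp only [Matrix.of_apply, star_star] at h1
    have h2 : factorSeminorm m H (sandwich (Matrix.of fun a i => star (η i a)) x
        (Matrix.of fun j b => ξ j b)) ≤ (∑ i, ‖η i‖ ^ 2 + ∑ j, ‖ξ j‖ ^ 2) / 2 :=
      factorSeminorm_le ⟨Fin r, inferInstance, _, x, _, by simpa using hx, rfl, by
        simp [EuclideanSpace.norm_sq_eq]⟩
    refine le_trans ?_ h2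
    refine le_trans (le_of_eq ?_) ((Complex.re_le_norm _).trans (hsp _))
    rw [← hg, h1]
    rfl

end Extension

/-! ### Operator spaces with prescribed matrix norms -/

section Diagonal

variable {ι : Type} {K : ι → Type} [∀ i, NormedAddCommGroup (K i)]

theorem hasSum_lp_norm_sq (f : lp K 2) : HasSum (fun i => ‖f i‖ ^ 2) (‖f‖ ^ 2) := by
  simpa using lp.hasSum_norm (p := 2) (by norm_num) f

theorem lp_sum_apply {κ : Type*} (s : Finset κ) (f : κ → lp K 2) (i : ι) :
    (∑ j ∈ s, f j : lp K 2) i = ∑ j ∈ s, f j i := by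
  rw [AddSubgroup.val_finsetSum]
  exact Finset.sum_apply i s fun j => (f j : ∀ i, K i)

variable [∀ i, InnerProductSpace ℂ (K i)]

theorem memℓp_diag (A : ∀ i, K i →L[ℂ] K i) (h : ∃ C, ∀ i, ‖A i‖ ≤ C) (f : lp K 2) :
    Memℓp (fun i => A i (f i)) 2 := by
  obtain ⟨C, hC⟩ := h
  refine memℓp_gen ?_
  refine Summable.of_nonneg_of_le (fun i => by positivity) (fun i => ?_)
    ((hasSum_lp_norm_sq f).summable.mul_left (C ^ 2))
  rw [← mul_pow]
  simp only [ENNReal.toReal_ofNat, Real.rpow_ofNat]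
  gcongr
  exact ((A i).le_opNorm _).trans (by gcongr; exact hC i)

/-- The block diagonal operator on a Hilbert space sum. -/
def diagOp (A : ∀ i, K i →L[ℂ] K i) (h : ∃ C, ∀ i, ‖A i‖ ≤ C) : lp K 2 →L[ℂ] lp K 2 :=
  LinearMap.mkContinuousOfExistsBound
    { toFun := fun f => ⟨fun i => A i (f i), memℓp_diag A h f⟩
      map_add' := fun f g => by ext i; simp; rfl
      map_smul' := fun c f => by ext i; simp } (by
      obtain ⟨C, hC⟩ := h
      refine ⟨|C|, fun f => ?_⟩
      refine le_of_sq_le_sq ?_ (by positivity)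
      rw [mul_pow, sq_abs]
      refine hasSum_le (fun i => ?_) (hasSum_lp_norm_sq _)
        ((hasSum_lp_norm_sq f).mul_left (C ^ 2))
      rw [← mul_pow]
      change ‖A i (f i)‖ ^ 2 ≤ _
      gcongr
      exact ((A i).le_opNorm _).trans (by gcongr; exact hC i))

theorem diagOp_apply (A : ∀ i, K i →L[ℂ] K i) (h : ∃ C, ∀ i, ‖A i‖ ≤ C) (f : lp K 2) (i : ι) :
    diagOp A h f i = A i (f i) := rfl

variable {V : Type*} [AddCommGroup V] [Module ℂ V]

/-- The direct sum of a pointwise bounded family of representations by operators. -/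
def diagMap (F : ∀ i, V →ₗ[ℂ] (K i →L[ℂ] K i)) (h : ∀ v, ∃ C, ∀ i, ‖F i v‖ ≤ C) :
    V →ₗ[ℂ] (lp K 2 →L[ℂ] lp K 2) where
  toFun v := diagOp (fun i => F i v) (h v)
  map_add' v w := by ext f i; simp [diagOp_apply]
  map_smul' c v := by ext f i; simp [diagOp_apply]

theorem diagMap_apply (F : ∀ i, V →ₗ[ℂ] (K i →L[ℂ] K i)) (h : ∀ v, ∃ C, ∀ i, ‖F i v‖ ≤ C)
    (v : V) (f : lp K 2) (i : ι) : diagMap F h v f i = F i v (f i) := rfl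

theorem ampNorm_diagMap_le_iff (F : ∀ i, V →ₗ[ℂ] (K i →L[ℂ] K i))
    (h : ∀ v, ∃ C, ∀ i, ‖F i v‖ ≤ C) {r : ℕ} (x : Matrix (Fin r) (Fin r) V) {C : ℝ} (hC : 0 ≤ C) :
    ampNorm (diagMap F h) x ≤ C ↔ ∀ i, ampNorm (F i) x ≤ C := by
  classical
  constructor
  · intro hx i
    rw [ampNorm_le_iff hC] at hx ⊢
    intro ξ
    have h1 := hx fun j => lp.single 2 i (ξ j)
    have h2 : ∀ a, ∑ j, diagMap F h (x a j) (lp.single 2 i (ξ j)) =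
        lp.single 2 i (∑ j, F i (x a j) (ξ j)) := by
      intro a
      ext k
      rw [lp_sum_apply]
      simp only [diagMap_apply]
      by_cases hk : k = i
      · subst hk
        simp
      · simp [Pi.single_eq_of_ne hk]
    simpa only [h2, lp.norm_single (p := 2) (by norm_num)] using h1
  · intro hx
    rw [ampNorm_le_iff hC]
    intro ξ
    have h1 : HasSum (fun i => ∑ a, ‖∑ j, F i (x a j) (ξ j i)‖ ^ 2)
        (∑ a, ‖∑ j, diagMap F h (x a j) (ξ j)‖ ^ 2) := by
      refine hasSum_sum fun a _ => ?_
      have := hasSum_lp_norm_sq (∑ j, diagMap F h (x a j) (ξ j))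
      simpa only [lp_sum_apply, diagMap_apply] using this
    have h2 : HasSum (fun i => C ^ 2 * ∑ j, ‖ξ j i‖ ^ 2) (C ^ 2 * ∑ j, ‖ξ j‖ ^ 2) :=
      (hasSum_sum fun j _ => hasSum_lp_norm_sq (ξ j)).mul_left _
    exact hasSum_le (fun i => (ampNorm_le_iff hC).1 (hx i) _) h1 h2

end Diagonal

theorem matNorm_eq (X : OperatorSpace) {r : ℕ} (x : Matrix (Fin r) (Fin r) X) :
    X.matNorm x = ampNorm X.carrier.subtype x := rfl

theorem matNorm_nonneg (X : OperatorSpace) {r : ℕ} (x : Matrix (Fin r) (Fin r) X) :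
    0 ≤ X.matNorm x := ampNorm_nonneg X.carrier.subtype x

theorem matNorm_map {X : OperatorSpace} {V : Type*} [AddCommGroup V] [Module ℂ V]
    (s : V →ₗ[ℂ] X) {r : ℕ} (x : Matrix (Fin r) (Fin r) V) :
    X.matNorm (x.map s) = ampNorm (X.carrier.subtype ∘ₗ s) x := rfl

theorem eq_zero_of_matNorm_nonpos {X : OperatorSpace} {v : X}
    (h : X.matNorm (Matrix.of fun _ _ : Fin 1 => v) ≤ 0) : v = 0 := by
  rw [matNorm_eq, ampNorm_one] at h
  exact norm_le_zero_iff.1 h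

/-- A pointwise bounded family of maps from a finite-dimensional vector space into matrix algebras
is the family of coordinates of a concrete operator space, whose matrix norms are the suprema of
those of the family. (Vectors on which all the maps vanish are identified with zero.) -/
theorem exists_realization {V : Type*} [AddCommGroup V] [Module ℂ V] [FiniteDimensional ℂ V]
    {ι : Type} (n : ι → ℕ)
    (F : ∀ i, V →ₗ[ℂ] MatOp (n i))
    (h : ∀ v, ∃ C, ∀ i, ‖F i v‖ ≤ C) :
    ∃ (Z : OperatorSpace) (π : V →ₗ[ℂ] Z)
      (φ : ∀ i, Z →ₗ[ℂ] MatOp (n i)),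
      FiniteDimensional ℂ Z ∧ Function.Surjective π ∧ (∀ i, φ i ∘ₗ π = F i) ∧
      ∀ (r : ℕ) (w : Matrix (Fin r) (Fin r) Z) (C : ℝ), 0 ≤ C →
        (Z.matNorm w ≤ C ↔ ∀ i, ampNorm (φ i) w ≤ C) := by
  let D := diagMap F h
  let Z : OperatorSpace :=
    { H := lp (fun i => EuclideanSpace ℂ (Fin (n i))) 2
      carrier := LinearMap.range D
      isClosed := Submodule.closed_of_finiteDimensional _ }
  let π : V →ₗ[ℂ] Z := D.rangeRestrict
  have hπ : Function.Surjective π := D.surjective_rangeRestrict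
  have hφ : ∀ i, ∃ φ : Z →ₗ[ℂ] MatOp (n i),
      φ ∘ₗ π = F i := by
    intro i
    refine exists_comp_eq_of_surjective π hπ (F i) fun v hv => ?_
    have h0 : D v = 0 := congrArg Subtype.val hv
    have := (ampNorm_diagMap_le_iff F h (Matrix.of fun _ _ : Fin 1 => v) le_rfl).1 (by
      rw [ampNorm_one]; exact norm_le_zero_iff.2 h0) i
    rw [ampNorm_one] at this
    exact norm_le_zero_iff.1 this
  choose φ hφ using hφ
  refine ⟨Z, π, φ, inferInstanceAs (FiniteDimensional ℂ (LinearMap.range D)), hπ, hφ,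
    fun r w C hC => ?_⟩
  obtain ⟨σ, hσ⟩ := π.exists_rightInverse_of_surjective (LinearMap.range_eq_top.2 hπ)
  have hw : w = (w.map σ).map π := by
    ext1 a b
    exact (LinearMap.congr_fun hσ (w a b)).symm
  rw [hw, matNorm_map]
  refine (ampNorm_diagMap_le_iff F h (w.map σ) hC).trans (forall_congr' fun i => ?_)
  rw [← hφ i, ← ampNorm_comp (φ i) π]

/-! ### Completely bounded maps on finite-dimensional spaces -/

/-- The amplifications of a functional do not exceed its norm. -/
theorem ampNorm_smulRight_le (X : OperatorSpace) (g : X →ₗ[ℂ] ℂ) {c : ℝ} (hc : 0 ≤ c)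
    (hg : ∀ x, ‖g x‖ ≤ c * ‖x‖) {H : Type} [NormedAddCommGroup H] [InnerProductSpace ℂ H]
    (A : H →L[ℂ] H) {r : ℕ} (w : Matrix (Fin r) (Fin r) X) :
    ampNorm (g.smulRight A) w ≤ c * ‖A‖ * X.matNorm w := by
  have hN : 0 ≤ X.matNorm w := X.matNorm_nonneg w
  refine (ampNorm_le_iff (by positivity)).2 fun ξ => ?_
  have hscal : ∀ z : Fin r → ℂ, ∑ i, ‖∑ k, (w.map g) i k * z k‖ ^ 2 ≤
      (c * X.matNorm w) ^ 2 * ∑ k, ‖z k‖ ^ 2 := by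
    intro z
    -- Test against an arbitrary vector `y`, then choose `y` to be the image of `z`.
    have key : ∀ y : Fin r → ℂ, ‖∑ i, star (y i) * ∑ k, g (w i k) * z k‖ ≤
        c * X.matNorm w * √(∑ i, ‖y i‖ ^ 2) * √(∑ k, ‖z k‖ ^ 2) := by
      intro y
      have e : ∑ i, star (y i) * ∑ k, g (w i k) * z k =
          g (∑ i, star (y i) • ∑ k, z k • w i k) := by
        simp [map_sum, mul_comm]
      rw [e]
      refine (hg _).trans ?_
      rw [mul_assoc, mul_assoc]
      refine mul_le_mul_of_nonneg_left ?_ hc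
      refine ContinuousLinearMap.opNorm_le_bound _ (by positivity) fun ξ => ?_
      have h1 := sum_norm_sq_le_ampNorm X.carrier.subtype w (fun k => z k • ξ)
      have e2 : ((∑ i, star (y i) • ∑ k, z k • w i k : X) : X.H →L[ℂ] X.H) ξ =
          ∑ i, star (y i) • ∑ k, X.carrier.subtype (w i k) (z k • ξ) := by
        simp [_root_.sum_apply]
      change ‖((∑ i, star (y i) • ∑ k, z k • w i k : X) : X.H →L[ℂ] X.H) ξ‖ ≤ _
      rw [e2]
      have h2 : ‖∑ i, star (y i) • ∑ k, X.carrier.subtype (w i k) (z k • ξ)‖ ≤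
          ∑ i, ‖y i‖ * ‖∑ k, X.carrier.subtype (w i k) (z k • ξ)‖ := by
        refine (norm_sum_le _ _).trans (le_of_eq ?_)
        simp [norm_smul]
      refine h2.trans ((Real.sum_mul_le_sqrt_mul_sqrt _ _ _).trans ?_)
      have h3 : √(∑ i, ‖∑ k, X.carrier.subtype (w i k) (z k • ξ)‖ ^ 2) ≤
          X.matNorm w * √(∑ k, ‖z k‖ ^ 2) * ‖ξ‖ := by
        refine Real.sqrt_le_iff.2 ⟨by positivity, h1.trans (le_of_eq ?_)⟩
        rw [mul_pow, mul_pow, Real.sq_sqrt (by positivity)]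
        simp only [norm_smul, mul_pow, ← Finset.sum_mul]
        rw [mul_assoc]; rfl
      calc _ ≤ √(∑ i, ‖y i‖ ^ 2) * (X.matNorm w * √(∑ k, ‖z k‖ ^ 2) * ‖ξ‖) := by gcongr
        _ = _ := by ring
    have k1 := key fun i => ∑ k, g (w i k) * z k
    set S := ∑ i, ‖∑ k, g (w i k) * z k‖ ^ 2 with hS
    have hS0 : 0 ≤ S := by positivity
    have e3 : (∑ i, star (∑ k, g (w i k) * z k) * ∑ k, g (w i k) * z k) = (S : ℂ) := by
      rw [hS, Complex.ofReal_sum]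
      refine Finset.sum_congr rfl fun i _ => ?_
      rw [RCLike.star_def, Complex.conj_mul']; simp
    rw [e3, Complex.norm_real, Real.norm_of_nonneg hS0] at k1
    change S ≤ _
    rcases hS0.eq_or_lt with h0 | h0
    · rw [← h0]; positivity
    · have hs : 0 < √S := Real.sqrt_pos.2 h0
      have hs2 : √S * √S = S := Real.mul_self_sqrt hS0
      have k2 : √S ≤ c * X.matNorm w * √(∑ k, ‖z k‖ ^ 2) := by
        refine le_of_mul_le_mul_right ?_ hs
        rw [hs2]
        linarith
      calc S = √S ^ 2 := (Real.sq_sqrt hS0).symm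
        _ ≤ (c * X.matNorm w * √(∑ k, ‖z k‖ ^ 2)) ^ 2 := by gcongr
        _ = _ := by rw [mul_pow, Real.sq_sqrt (by positivity)]
  have h := sum_norm_sq_smul_le_of_scalar (w.map g) hscal fun k => A (ξ k)
  calc _ = ∑ i, ‖∑ k, (w.map g) i k • A (ξ k)‖ ^ 2 := by simp
    _ ≤ _ := h
    _ ≤ (c * X.matNorm w) ^ 2 * ∑ k, (‖A‖ * ‖ξ k‖) ^ 2 := by
        gcongr with k
        exact A.le_opNorm _
    _ = _ := by simp only [mul_pow, ← Finset.mul_sum]; ring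

/-- Linear maps on a finite-dimensional operator space are completely bounded, uniformly in terms of
the images of a fixed spanning system. -/
theorem exists_ampNorm_comp_le (X : OperatorSpace) [FiniteDimensional ℂ X] {k : ℕ}
    (s : X →ₗ[ℂ] (Fin k → ℂ)) :
    ∃ C : ℝ, 0 ≤ C ∧ ∀ (H : Type) [NormedAddCommGroup H] [InnerProductSpace ℂ H]
      (Δ : (Fin k → ℂ) →ₗ[ℂ] (H →L[ℂ] H)) (η : ℝ), 0 ≤ η → (∀ i, ‖Δ (Pi.single i 1)‖ ≤ η) →
      ∀ (r : ℕ) (w : Matrix (Fin r) (Fin r) X), ampNorm (Δ ∘ₗ s) w ≤ C * η * X.matNorm w := by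
  have hb : ∀ i, ∃ c : ℝ, 0 ≤ c ∧ ∀ x, ‖(LinearMap.proj i ∘ₗ s) x‖ ≤ c * ‖x‖ := fun i =>
    ⟨‖LinearMap.toContinuousLinearMap (LinearMap.proj i ∘ₗ s)‖, norm_nonneg _,
      (LinearMap.toContinuousLinearMap (LinearMap.proj i ∘ₗ s)).le_opNorm⟩
  choose c hc hcs using hb
  refine ⟨∑ i, c i, Finset.sum_nonneg fun i _ => hc i, fun H _ _ Δ η hη hΔ r w => ?_⟩
  have e : Δ ∘ₗ s = ∑ i, (LinearMap.proj i ∘ₗ s).smulRight (Δ (Pi.single i 1)) := by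
    ext1 x
    have : s x = ∑ i, s x i • Pi.single i (1 : ℂ) := by
      ext j; simp [Finset.sum_apply, Pi.single_apply]
    rw [LinearMap.comp_apply, this, map_sum]
    simp [LinearMap.sum_apply]
  rw [e]
  refine (ampNorm_sum_le _ _ _).trans ?_
  rw [Finset.sum_mul, Finset.sum_mul]
  refine Finset.sum_le_sum fun i _ => (ampNorm_smulRight_le X _ (hc i) (hcs i) _ w).trans ?_
  have : 0 ≤ X.matNorm w := X.matNorm_nonneg w
  have := hc i
  gcongr
  exact hΔ i

/-! ### One-exactness -/

section CompleteIsometry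

variable {X Y Z : OperatorSpace}

theorem IsCompleteIsometry.norm_map {φ : X →ₗ[ℂ] Y} (h : IsCompleteIsometry φ) (x : X) :
    ‖φ x‖ = ‖x‖ := by
  have h1 := h 1 (Matrix.of fun _ _ => x)
  rw [matNorm_map, matNorm_eq, ampNorm_one, ampNorm_one] at h1
  exact h1

theorem IsCompleteIsometry.injective {φ : X →ₗ[ℂ] Y} (h : IsCompleteIsometry φ) :
    Function.Injective φ := by
  refine (injective_iff_map_eq_zero φ).2 fun x hx => ?_
  rw [← norm_eq_zero, ← h.norm_map, hx, norm_zero]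

theorem IsCompleteIsometry.comp {ψ : Y →ₗ[ℂ] Z} {φ : X →ₗ[ℂ] Y} (hψ : IsCompleteIsometry ψ)
    (hφ : IsCompleteIsometry φ) : IsCompleteIsometry (ψ ∘ₗ φ) := fun n x =>
  (hψ n (x.map φ)).trans (hφ n x)

theorem IsCompleteIsometry.compLE {φ : X →ₗ[ℂ] Y} (h : IsCompleteIsometry φ) :
    CompLE (Y.carrier.subtype ∘ₗ φ) X.carrier.subtype := fun r x => (h r x).le

theorem IsCompleteIsometry.compLE_symm {φ : X →ₗ[ℂ] Y} (h : IsCompleteIsometry φ) :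
    CompLE X.carrier.subtype (Y.carrier.subtype ∘ₗ φ) := fun r x => (h r x).ge

theorem isCompleteIsometry_genInclusion (X : OperatorSpace) {m : ℕ} (a : Fin m → X) :
    IsCompleteIsometry (X.genInclusion a) := fun _ _ => rfl

theorem cbNorm_le_iff (φ : X →ₗ[ℂ] Y) {C : ℝ} (hC : 0 ≤ C) : cbNorm φ ≤ ENNReal.ofReal C ↔
    ∀ (r : ℕ) (x : Matrix (Fin r) (Fin r) X), Y.matNorm (x.map φ) ≤ C * X.matNorm x := by
  simp only [cbNorm, iSup_le_iff, ENNReal.ofReal_le_ofReal_iff hC]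
  constructor
  · intro h r x
    have key : ∀ D, X.matNorm x < D → Y.matNorm (x.map φ) ≤ C * D := by
      intro D hD
      have hD0 : 0 < D := (X.matNorm_nonneg x).trans_lt hD
      have hn : ‖(D : ℂ)⁻¹‖ = D⁻¹ := by
        rw [norm_inv, Complex.norm_real, Real.norm_of_nonneg hD0.le]
      have h1 := h r (x.map ((D : ℂ)⁻¹ • LinearMap.id : X →ₗ[ℂ] X))
      rw [matNorm_map, matNorm_map, ← ampNorm_comp, LinearMap.comp_smul,
        LinearMap.comp_smul, ampNorm_smul, ampNorm_smul, hn, inv_mul_le_iff₀ hD0,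
        inv_mul_le_iff₀ hD0, mul_one, mul_comm D] at h1
      exact h1 hD.le
    have h2 : Filter.Tendsto (fun D : ℝ => C * D) (𝓝[>] (X.matNorm x)) (𝓝 (C * X.matNorm x)) :=
      ((continuous_const.mul continuous_id).tendsto _).mono_left nhdsWithin_le_nhds
    refine ge_of_tendsto h2 ?_
    filter_upwards [self_mem_nhdsWithin] with D hD using key D hD
  · intro h r x hx
    exact (h r x).trans (mul_le_of_le_one_right hC hx)

theorem cbNorm_ne_zero [Nontrivial X] (φ : X ≃ₗ[ℂ] Y) : cbNorm (φ : X →ₗ[ℂ] Y) ≠ 0 := by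
  intro h0
  obtain ⟨y, hy⟩ := exists_ne (0 : X)
  have h2 := (cbNorm_le_iff (φ : X →ₗ[ℂ] Y) le_rfl).1 (by rw [h0]; exact zero_le)
    1 (Matrix.of fun _ _ => y)
  rw [zero_mul] at h2
  have : (φ : X →ₗ[ℂ] Y) y = 0 := eq_zero_of_matNorm_nonpos h2
  exact hy (φ.map_eq_zero_iff.1 this)

/-- An isomorphism of small completely bounded distortion is, up to a scalar factor, an almost
completely isometric complete contraction. -/
theorem exists_scaling_of_cbNorm_mul_lt [Nontrivial X] (φ : X ≃ₗ[ℂ] Y) {c : ℝ}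
    (hφ : cbNorm (φ : X →ₗ[ℂ] Y) * cbNorm (φ.symm : Y →ₗ[ℂ] X) < ENNReal.ofReal c) :
    ∃ a : ℝ, 0 < a ∧ ∀ (r : ℕ) (x : Matrix (Fin r) (Fin r) X),
      Y.matNorm (x.map φ) ≤ a * X.matNorm x ∧ a * X.matNorm x ≤ c * Y.matNorm (x.map φ) := by
  have : Nontrivial Y := φ.symm.toEquiv.nontrivial
  have ha0 := cbNorm_ne_zero φ
  have hb0 := cbNorm_ne_zero φ.symm
  have hlt := hφ.trans ENNReal.ofReal_lt_top
  have ha : cbNorm (φ : X →ₗ[ℂ] Y) ≠ ∞ := fun ht => by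
    rw [ht, ENNReal.top_mul hb0] at hlt; exact lt_irrefl _ hlt
  have hb : cbNorm (φ.symm : Y →ₗ[ℂ] X) ≠ ∞ := fun ht => by
    rw [ht, ENNReal.mul_top ha0] at hlt; exact lt_irrefl _ hlt
  set a := (cbNorm (φ : X →ₗ[ℂ] Y)).toReal
  set b := (cbNorm (φ.symm : Y →ₗ[ℂ] X)).toReal
  have hapos : 0 < a := ENNReal.toReal_pos ha0 ha
  have hbpos : 0 < b := ENNReal.toReal_pos hb0 hb
  have hab : a * b ≤ c := by
    have := (ENNReal.toReal_lt_of_lt_ofReal hφ).le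
    rwa [ENNReal.toReal_mul] at this
  refine ⟨a, hapos, fun r x =>
    ⟨(cbNorm_le_iff (φ : X →ₗ[ℂ] Y) hapos.le).1 (ENNReal.ofReal_toReal ha).ge r x, ?_⟩⟩
  have hB := (cbNorm_le_iff (φ.symm : Y →ₗ[ℂ] X) hbpos.le).1 (ENNReal.ofReal_toReal hb).ge
    r (x.map φ)
  have h4 : (x.map φ).map (φ.symm : Y →ₗ[ℂ] X) = x := by ext1; simp
  rw [h4] at hB
  have h5 := Y.matNorm_nonneg (x.map φ)
  calc a * X.matNorm x ≤ a * (b * Y.matNorm (x.map φ)) := by gcongr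
    _ = (a * b) * Y.matNorm (x.map φ) := by ring
    _ ≤ _ := by gcongr

theorem cbNorm_mul_le (φ : X ≃ₗ[ℂ] Y) {c : ℝ} (hc : 0 ≤ c)
    (h : ∀ (r : ℕ) (x : Matrix (Fin r) (Fin r) X),
      Y.matNorm (x.map φ) ≤ X.matNorm x ∧ X.matNorm x ≤ c * Y.matNorm (x.map φ)) :
    cbNorm (φ : X →ₗ[ℂ] Y) * cbNorm (φ.symm : Y →ₗ[ℂ] X) ≤ ENNReal.ofReal c := by
  have h1 : cbNorm (φ : X →ₗ[ℂ] Y) ≤ ENNReal.ofReal 1 :=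
    (cbNorm_le_iff _ zero_le_one).2 fun r x => by rw [one_mul]; exact (h r x).1
  have h2 : cbNorm (φ.symm : Y →ₗ[ℂ] X) ≤ ENNReal.ofReal c := by
    refine (cbNorm_le_iff _ hc).2 fun r y => ?_
    have h4 : (y.map φ.symm).map φ = y := by ext1; simp
    have h3 := (h r (y.map φ.symm)).2
    rwa [h4] at h3
  calc _ ≤ ENNReal.ofReal 1 * ENNReal.ofReal c := mul_le_mul' h1 h2
    _ = ENNReal.ofReal c := by rw [ENNReal.ofReal_one, one_mul]

end CompleteIsometry

theorem ampNorm_of_subsingleton {V : Type*} [AddCommGroup V] [Module ℂ V] [Subsingleton V]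
    {H : Type} [NormedAddCommGroup H] [InnerProductSpace ℂ H] (f : V →ₗ[ℂ] (H →L[ℂ] H)) {r : ℕ}
    (x : Matrix (Fin r) (Fin r) V) : ampNorm f x = 0 := by
  rw [Subsingleton.elim f 0, ampNorm_zero]

/-- A map into a subspace of `M_n`, regarded as a map into `M_n`. -/
def toMatOp {X : OperatorSpace} {n : ℕ} {F : Submodule ℂ (MatOp n)}
    (φ : X →ₗ[ℂ] ofMatrixSubspace n F) : X →ₗ[ℂ] MatOp n :=
  (ofMatrixSubspace n F).carrier.subtype ∘ₗ φ

theorem ampNorm_toMatOp {X : OperatorSpace} {n : ℕ} {F : Submodule ℂ (MatOp n)}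
    (φ : X →ₗ[ℂ] ofMatrixSubspace n F) {r : ℕ} (x : Matrix (Fin r) (Fin r) X) :
    ampNorm (toMatOp φ) x = (ofMatrixSubspace n F).matNorm (x.map φ) := rfl

/-- An injective map into `M_n`, as an isomorphism onto its range. -/
def rangeEquiv {X : OperatorSpace} {n : ℕ} (T : X →ₗ[ℂ] MatOp n) (hT : Function.Injective T) :
    X ≃ₗ[ℂ] ofMatrixSubspace n (LinearMap.range T) :=
  LinearEquiv.ofInjective T hT

theorem matNorm_map_rangeEquiv {X : OperatorSpace} {n : ℕ} (T : X →ₗ[ℂ] MatOp n)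
    (hT : Function.Injective T) {r : ℕ} (x : Matrix (Fin r) (Fin r) X) :
    (ofMatrixSubspace n (LinearMap.range T)).matNorm (x.map (rangeEquiv T hT)) = ampNorm T x := rfl

/-- A finite-dimensional space is `1`-exact if and only if it has complete contractions into matrix
algebras that are almost completely isometric. -/
theorem E1_iff (X : OperatorSpace) : E1 X ↔ FiniteDimensional ℂ X ∧ ∀ ε : ℝ, 0 < ε →
    ∃ (n : ℕ) (T : X →ₗ[ℂ] MatOp n), CompLE T X.carrier.subtype ∧
      ∀ (r : ℕ) (x : Matrix (Fin r) (Fin r) X), X.matNorm x ≤ (1 + ε) * ampNorm T x := by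
  refine and_congr_right fun hfd => ⟨fun h ε hε => ?_, fun h => ?_⟩
  · rcases subsingleton_or_nontrivial X with hX | hX
    · exact ⟨0, 0, fun r x => by rw [ampNorm_zero]; exact ampNorm_nonneg _ _, fun r x => by
        rw [matNorm_eq, ampNorm_of_subsingleton, ampNorm_zero, mul_zero]⟩
    have h1 : exactnessConstant X < ENNReal.ofReal (1 + ε) := by
      refine h.trans_lt ?_
      rw [← ENNReal.ofReal_one]
      exact (ENNReal.ofReal_lt_ofReal_iff (by positivity)).2 (by linarith)
    simp only [exactnessConstant, dcb, iInf_lt_iff] at h1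
    obtain ⟨n, F, φ, hφ⟩ := h1
    obtain ⟨a, ha, hA⟩ := exists_scaling_of_cbNorm_mul_lt φ hφ
    have hn : ‖(a : ℂ)⁻¹‖ = a⁻¹ := by
      rw [norm_inv, Complex.norm_real, Real.norm_of_nonneg ha.le]
    refine ⟨n, (a : ℂ)⁻¹ • toMatOp φ.toLinearMap, fun r x => ?_, fun r x => ?_⟩
    · rw [ampNorm_smul, hn, inv_mul_le_iff₀ ha, ampNorm_toMatOp]
      exact (hA r x).1
    · rw [ampNorm_smul, hn, mul_left_comm, le_inv_mul_iff₀ ha, ampNorm_toMatOp]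
      exact (hA r x).2
  · refine le_of_forall_gt_imp_ge_of_dense fun c hc => ?_
    rcases eq_or_ne c ∞ with rfl | hct
    · exact le_top
    have hc1 : 1 < c.toReal := by
      rw [← ENNReal.toReal_one]
      exact (ENNReal.toReal_lt_toReal (by simp) hct).2 hc
    obtain ⟨n, T, hT, hT'⟩ := h (c.toReal - 1) (by linarith)
    simp only [add_sub_cancel] at hT'
    have hinj : Function.Injective T := by
      refine (injective_iff_map_eq_zero T).2 fun x hx => eq_zero_of_matNorm_nonpos ?_
      refine (hT' 1 _).trans (le_of_eq ?_)
      rw [ampNorm_one, hx, norm_zero, mul_zero]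
    refine (iInf₂_le n (LinearMap.range T)).trans ((iInf_le _ (rangeEquiv T hinj)).trans ?_)
    refine (cbNorm_mul_le (rangeEquiv T hinj) (by linarith) fun r x => ?_).trans
      (ENNReal.ofReal_toReal hct).le
    rw [matNorm_map_rangeEquiv]
    exact ⟨hT r x, hT' r x⟩

theorem E1.of_isCompleteIsometry {X Y : OperatorSpace} (hY : E1 Y) {φ : X →ₗ[ℂ] Y}
    (hφ : IsCompleteIsometry φ) : E1 X := by
  have := hY.1
  refine (E1_iff X).2 ⟨FiniteDimensional.of_injective φ hφ.injective, fun ε hε => ?_⟩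
  obtain ⟨n, T, hT, hT'⟩ := ((E1_iff Y).1 hY).2 ε hε
  exact ⟨n, T ∘ₗ φ, (hT.comp φ).trans hφ.compLE, fun r x => (hφ r x).ge.trans (hT' r (x.map φ))⟩

theorem E1_matrixAlgebra (n : ℕ) : E1 (matrixAlgebra n) := by
  refine (E1_iff _).2 ⟨inferInstanceAs (FiniteDimensional ℂ (⊤ : Submodule ℂ (MatOp n))),
    fun ε hε => ⟨n, (matrixAlgebra n).carrier.subtype, CompLE.refl _, fun r x => ?_⟩⟩
  have := (matrixAlgebra n).matNorm_nonneg x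
  change _ ≤ (1 + ε) * (matrixAlgebra n).matNorm x
  nlinarith

section Conjugation

variable {H K : Type} [NormedAddCommGroup H] [InnerProductSpace ℂ H] [NormedAddCommGroup K]
  [InnerProductSpace ℂ K] {V : Type*} [AddCommGroup V] [Module ℂ V]

/-- Conjugation of operators by a unitary. -/
def conjMap (e : H ≃ₗᵢ[ℂ] K) : (H →L[ℂ] H) →ₗ[ℂ] (K →L[ℂ] K) where
  toFun A := (e : H →L[ℂ] K) ∘L A ∘L (e.symm : K →L[ℂ] H)
  map_add' A B := by ext; simp
  map_smul' c A := by ext; simp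

theorem conjMap_apply (e : H ≃ₗᵢ[ℂ] K) (A : H →L[ℂ] H) (ξ : K) :
    conjMap e A ξ = e (A (e.symm ξ)) := rfl

theorem ampNorm_conjMap_le (e : H ≃ₗᵢ[ℂ] K) (f : V →ₗ[ℂ] (H →L[ℂ] H)) :
    CompLE (conjMap e ∘ₗ f) f := by
  intro r x
  rw [ampNorm_le_iff (ampNorm_nonneg _ _)]
  intro ξ
  have h := sum_norm_sq_le_ampNorm f x fun j => e.symm (ξ j)
  simp only [LinearIsometryEquiv.norm_map] at h
  refine le_trans (le_of_eq ?_) h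
  simp only [LinearMap.comp_apply, conjMap_apply, ← map_sum, LinearIsometryEquiv.norm_map]

theorem compLE_conjMap (e : H ≃ₗᵢ[ℂ] K) (f : V →ₗ[ℂ] (H →L[ℂ] H)) :
    CompLE f (conjMap e ∘ₗ f) := by
  have h := ampNorm_conjMap_le e.symm (conjMap e ∘ₗ f)
  have e1 : conjMap e.symm ∘ₗ conjMap e ∘ₗ f = f := by
    ext v ξ
    simp [conjMap_apply]
  rwa [e1] at h

end Conjugation

/-- It suffices for `1`-exactness to have finite families of complete contractions into matrix
algebras whose joint matrix norms are almost the given ones. -/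
theorem E1_of_finite_families (X : OperatorSpace) (hX : FiniteDimensional ℂ X)
    (h : ∀ ε : ℝ, 0 < ε → ∃ (J : Type) (_ : Finite J) (n : J → ℕ) (T : ∀ j, X →ₗ[ℂ] MatOp (n j)),
      (∀ j, CompLE (T j) X.carrier.subtype) ∧
      ∀ (r : ℕ) (x : Matrix (Fin r) (Fin r) X) (C : ℝ), 0 ≤ C → (∀ j, ampNorm (T j) x ≤ C) →
        X.matNorm x ≤ (1 + ε) * C) : E1 X := by
  refine (E1_iff X).2 ⟨hX, fun ε hε => ?_⟩
  obtain ⟨J, _, n, T, hT, hT'⟩ := h ε hε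
  let D := diagMap T fun v => ⟨‖v‖, fun j => (hT j).norm_le v⟩
  have : FiniteDimensional ℂ (lp (fun j => EuclideanSpace ℂ (Fin (n j))) 2) := by
    let L : lp (fun j => EuclideanSpace ℂ (Fin (n j))) 2 →ₗ[ℂ]
        (∀ j, EuclideanSpace ℂ (Fin (n j))) :=
      { toFun := fun f j => f j
        map_add' := fun f g => rfl
        map_smul' := fun c f => rfl }
    exact FiniteDimensional.of_injective L fun f g hfg => by
      ext1
      exact hfg
  let e := (stdOrthonormalBasis ℂ (lp (fun j => EuclideanSpace ℂ (Fin (n j))) 2)).repr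
  refine ⟨_, conjMap e ∘ₗ D, (ampNorm_conjMap_le e D).trans fun r x => ?_, fun r x => ?_⟩
  · exact (ampNorm_diagMap_le_iff _ _ x (X.matNorm_nonneg x)).2 fun j => hT j r x
  · have h0 := ampNorm_nonneg D x
    refine (hT' r x _ h0 ((ampNorm_diagMap_le_iff _ _ x h0).1 le_rfl)).trans ?_
    gcongr
    exact compLE_conjMap e D r x

/-- The direct sum of two `1`-exact spaces, with the maximum of the matrix norms. -/
theorem exists_directSum {X Y : OperatorSpace} (hX : E1 X) (hY : E1 Y) :
    ∃ (Z : OperatorSpace) (π : X × Y →ₗ[ℂ] Z), E1 Z ∧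
      ∀ (r : ℕ) (w : Matrix (Fin r) (Fin r) (X × Y)),
        Z.matNorm (w.map π) = max (X.matNorm (w.map Prod.fst)) (Y.matNorm (w.map Prod.snd)) := by
  have hX' := ((E1_iff X).1 hX).2
  have hY' := ((E1_iff Y).1 hY).2
  have := hX.1
  have := hY.1
  have hpos : ∀ k : ℕ, (0 : ℝ) < 1 / (k + 1) := fun k => by positivity
  choose n T hT hT' using fun k : ℕ => hX' (1 / (k + 1)) (hpos k)
  choose m S hS hS' using fun k : ℕ => hY' (1 / (k + 1)) (hpos k)
  obtain ⟨Z, π, φ, hfd, hπ, hφ, hZ⟩ := exists_realization (V := X × Y) (ι := ℕ ⊕ ℕ) (Sum.elim n m)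
    (Sum.rec (fun k => T k ∘ₗ LinearMap.fst ℂ X Y) (fun k => S k ∘ₗ LinearMap.snd ℂ X Y))
    (fun v => ⟨max ‖v.1‖ ‖v.2‖, by
      rintro (k | k)
      · exact ((hT k).norm_le v.1).trans (le_max_left _ _)
      · exact ((hS k).norm_le v.2).trans (le_max_right _ _)⟩)
  have hlim : ∀ a C : ℝ, (∀ k : ℕ, a ≤ (1 + 1 / (k + 1)) * C) → a ≤ C := by
    intro a C h
    have h1 : Filter.Tendsto (fun k : ℕ => (1 + 1 / ((k : ℝ) + 1)) * C) Filter.atTop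
        (𝓝 ((1 + 0) * C)) :=
      (tendsto_one_div_add_atTop_nhds_zero_nat.const_add 1).mul_const C
    simp only [add_zero, one_mul] at h1
    exact ge_of_tendsto' h1 h
  have key : ∀ (r : ℕ) (w : Matrix (Fin r) (Fin r) (X × Y)),
      Z.matNorm (w.map π) = max (X.matNorm (w.map Prod.fst)) (Y.matNorm (w.map Prod.snd)) := by
    intro r w
    apply le_antisymm
    · rw [hZ r _ _ (le_max_of_le_left (matNorm_nonneg _ _))]
      intro i
      rw [← ampNorm_comp, hφ]
      rcases i with k | k
      · exact (hT k r (w.map Prod.fst)).trans (le_max_left _ _)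
      · exact (hS k r (w.map Prod.snd)).trans (le_max_right _ _)
    · have h1 := (hZ r (w.map π) _ (matNorm_nonneg _ _)).1 le_rfl
      refine max_le (hlim _ _ fun k => ?_) (hlim _ _ fun k => ?_)
      · refine (hT' k r _).trans ?_
        have h2 := h1 (Sum.inl k)
        rw [← ampNorm_comp, hφ] at h2
        have := (hpos k).le
        exact mul_le_mul_of_nonneg_left h2 (by linarith)
      · refine (hS' k r _).trans ?_
        have h2 := h1 (Sum.inr k)
        rw [← ampNorm_comp, hφ] at h2
        have := (hpos k).le
        exact mul_le_mul_of_nonneg_left h2 (by linarith)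
  refine ⟨Z, π, ?_, key⟩
  obtain ⟨σ, hσ⟩ := π.exists_rightInverse_of_surjective (LinearMap.range_eq_top.2 hπ)
  have hw : ∀ (r : ℕ) (w : Matrix (Fin r) (Fin r) Z), w = (w.map σ).map π := fun r w => by
    ext1 a b
    exact (LinearMap.congr_fun hσ (w a b)).symm
  refine E1_of_finite_families Z hfd fun ε hε => ?_
  obtain ⟨p, A, hA, hA'⟩ := hX' ε hε
  obtain ⟨q, B, hB, hB'⟩ := hY' ε hε
  refine ⟨Unit ⊕ Unit, inferInstance, Sum.elim (fun _ => p) (fun _ => q),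
    Sum.rec (fun _ => A ∘ₗ LinearMap.fst ℂ X Y ∘ₗ σ) (fun _ => B ∘ₗ LinearMap.snd ℂ X Y ∘ₗ σ),
    ?_, ?_⟩
  · rintro (_ | _) r w
    · rw [← matNorm_eq, hw r w, key, ← hw]
      exact (hA r ((w.map σ).map Prod.fst)).trans (le_max_left _ _)
    · rw [← matNorm_eq, hw r w, key, ← hw]
      exact (hB r ((w.map σ).map Prod.snd)).trans (le_max_right _ _)
  · intro r w C hC h
    rw [hw r w, key]
    refine max_le ((hA' r _).trans ?_) ((hB' r _).trans ?_)
    · exact mul_le_mul_of_nonneg_left (h (Sum.inl ())) (by linarith)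
    · exact mul_le_mul_of_nonneg_left (h (Sum.inr ())) (by linarith)

/-! ### Nuclear embeddings of one-exact spaces -/

theorem exists_extension_to_space {V : Type*} [AddCommGroup V] [Module ℂ V] {X : OperatorSpace}
    {φ : V →ₗ[ℂ] X} {m : ℕ} {f : V →ₗ[ℂ] MatOp m} (hf : CompLE f (X.carrier.subtype ∘ₗ φ)) :
    ∃ g : X →ₗ[ℂ] MatOp m, g ∘ₗ φ = f ∧ CompLE g X.carrier.subtype := by
  obtain ⟨g, hg, hg'⟩ := exists_extension hf
  exact ⟨g ∘ₗ X.carrier.subtype, hg, hg'.comp X.carrier.subtype⟩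

theorem exists_matNorm_map_le {X Y : OperatorSpace} [FiniteDimensional ℂ X] (f : X →ₗ[ℂ] Y) :
    ∃ C : ℝ, 0 ≤ C ∧ ∀ (r : ℕ) (w : Matrix (Fin r) (Fin r) X),
      Y.matNorm (w.map f) ≤ C * X.matNorm w := by
  let s := (Module.finBasis ℂ X).equivFun
  obtain ⟨C, hC, h⟩ := exists_ampNorm_comp_le X s.toLinearMap
  let Δ := Y.carrier.subtype ∘ₗ f ∘ₗ s.symm.toLinearMap
  have hη : ∀ i, ‖Δ (Pi.single i 1)‖ ≤ ∑ j, ‖Δ (Pi.single j 1)‖ := fun i =>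
    Finset.single_le_sum (f := fun j => ‖Δ (Pi.single j 1)‖) (fun _ _ => norm_nonneg _)
      (Finset.mem_univ i)
  have h0 : 0 ≤ ∑ j, ‖Δ (Pi.single j 1)‖ := Finset.sum_nonneg fun _ _ => norm_nonneg _
  refine ⟨C * ∑ j, ‖Δ (Pi.single j 1)‖, mul_nonneg hC h0, fun r w => ?_⟩
  have h1 := h Y.H Δ _ h0 hη r w
  have e : Δ ∘ₗ s.toLinearMap = Y.carrier.subtype ∘ₗ f := by
    ext1 x
    simp [Δ]
  rw [e] at h1
  exact h1

/-- A decreasing sequence from `1` to `1 - ε`. -/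
def towerScale (ε : ℝ) (l : ℕ) : ℝ := 1 - ε + ε * (1 / 2) ^ l

section TowerScale

variable {ε : ℝ}

theorem towerScale_zero : towerScale ε 0 = 1 := by simp [towerScale]

theorem towerScale_succ_lt (hε : 0 < ε) (l : ℕ) : towerScale ε (l + 1) < towerScale ε l := by
  have : (0 : ℝ) < (1 / 2) ^ l := by positivity
  simp only [towerScale, pow_succ]
  nlinarith

theorem towerScale_antitone (hε : 0 < ε) : Antitone (towerScale ε) :=
  antitone_nat_of_succ_le fun l => (towerScale_succ_lt hε l).le

theorem lt_towerScale (hε : 0 < ε) (l : ℕ) : 1 - ε < towerScale ε l := by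
  have : (0 : ℝ) < (1 / 2) ^ l := by positivity
  simp only [towerScale]
  nlinarith

theorem towerScale_le_one (hε : 0 < ε) (l : ℕ) : towerScale ε l ≤ 1 :=
  towerScale_zero (ε := ε) ▸ towerScale_antitone hε (Nat.zero_le l)

theorem tendsto_towerScale : Filter.Tendsto (towerScale ε) Filter.atTop (𝓝 (1 - ε)) := by
  have h := (tendsto_pow_atTop_nhds_zero_of_lt_one (r := (1 / 2 : ℝ)) (by norm_num)
    (by norm_num)).const_mul ε
  rw [mul_zero] at h
  have h2 := h.const_add (1 - ε)
  rw [add_zero] at h2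
  exact h2

end TowerScale

/-- A `1`-exact space has a sequence of maps into matrix algebras, of norms decreasing to `1 - ε`
and close to multiples of complete isometries, in which every map factors through the first one by
way of complete contractions between the matrix algebras. -/
theorem exists_tower {B : OperatorSpace} (hB : E1 B) {ε : ℝ} (hε : 0 < ε) (hε1 : ε < 1) :
    ∃ (n : ℕ → ℕ) (S : ∀ l, B →ₗ[ℂ] MatOp (n l)) (E : ∀ l, MatOp (n 0) →ₗ[ℂ] MatOp (n l)),
      (∀ (l r : ℕ) (x : Matrix (Fin r) (Fin r) B),
        towerScale ε (l + 1) * B.matNorm x ≤ ampNorm (S l) x ∧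
        ampNorm (S l) x ≤ towerScale ε l * B.matNorm x) ∧
      (∀ l, E l ∘ₗ S 0 = S l) ∧ E 0 = LinearMap.id ∧ ∀ k l, k ≤ l → CompLE (E l) (E k) := by
  have hpos : ∀ l, 0 < towerScale ε l := fun l => by linarith [lt_towerScale hε l]
  have h1 : ∀ l, ∃ (n : ℕ) (S : B →ₗ[ℂ] MatOp n), ∀ (r : ℕ) (x : Matrix (Fin r) (Fin r) B),
      towerScale ε (l + 1) * B.matNorm x ≤ ampNorm S x ∧
        ampNorm S x ≤ towerScale ε l * B.matNorm x := by
    intro l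
    have hδ : 0 < towerScale ε l / towerScale ε (l + 1) - 1 := by
      rw [sub_pos, one_lt_div (hpos _)]
      exact towerScale_succ_lt hε l
    obtain ⟨n, T, hT, hT'⟩ := ((E1_iff B).1 hB).2 _ hδ
    refine ⟨n, (towerScale ε l : ℂ) • T, fun r x => ?_⟩
    rw [ampNorm_smul, Complex.norm_real, Real.norm_of_nonneg (hpos l).le]
    constructor
    · have h := hT' r x
      rw [add_sub_cancel, div_mul_eq_mul_div, le_div_iff₀' (hpos _)] at h
      exact h
    · exact mul_le_mul_of_nonneg_left (hT r x) (hpos l).le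
  choose n S hS using h1
  have h2 : ∀ l, ∃ R : MatOp (n l) →ₗ[ℂ] MatOp (n (l + 1)), R ∘ₗ S l = S (l + 1) ∧
      CompLE R LinearMap.id := fun l =>
    exists_extension fun r x => ((hS (l + 1) r x).2).trans (hS l r x).1
  choose R hR hR' using h2
  let E : ∀ l, MatOp (n 0) →ₗ[ℂ] MatOp (n l) := fun l =>
    Nat.rec (motive := fun l => MatOp (n 0) →ₗ[ℂ] MatOp (n l)) LinearMap.id
      (fun l e => R l ∘ₗ e) l
  refine ⟨n, S, E, hS, fun l => ?_, rfl, fun k l hkl => ?_⟩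
  · induction l with
    | zero => rfl
    | succ l ih => rw [← hR l, ← ih]; rfl
  · induction l, hkl using Nat.le_induction with
    | base => exact CompLE.refl _
    | succ l _ ih =>
      refine CompLE.trans ?_ ih
      exact (hR' l).comp (E l)

/-- A `1`-exact space `B` embeds into a `1`-exact space `Z` in such a way that the embedding almost
factors through a matrix algebra. The space `Z` is spanned by copies of `B` and of a matrix algebra
inside the product of the matrix algebras of a tower, the element `(b, y)` having coordinates
`E l (c l • S 0 b + y)`. Since `c l` converges and the maps `E l` are decreasing, finitely many
coordinates determine the matrix norms up to a small error, so that `Z` is again `1`-exact. -/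
theorem exists_nuclear_embedding {B : OperatorSpace} (hB : E1 B) {ε : ℝ} (hε : 0 < ε)
    (hε1 : ε < 1) : ∃ (Z : OperatorSpace) (ψ : B →ₗ[ℂ] Z) (n : ℕ) (T : B →ₗ[ℂ] MatOp n)
      (χ : MatOp n →ₗ[ℂ] Z), E1 Z ∧ IsCompleteIsometry ψ ∧ CompLE T B.carrier.subtype ∧
      CompLE (Z.carrier.subtype ∘ₗ χ) LinearMap.id ∧ ∀ b, ‖ψ b - χ (T b)‖ ≤ ε * ‖b‖ := by
  obtain ⟨n, S, E, hS, hES, hE0, hE⟩ := exists_tower hB hε hε1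
  have := hB.1
  have hpos : ∀ l, 0 < towerScale ε l := fun l => by linarith [lt_towerScale hε l]
  have hnorm : ∀ l, ‖((towerScale ε l : ℝ) : ℂ)⁻¹‖ = (towerScale ε l)⁻¹ := fun l => by
    rw [norm_inv, Complex.norm_real, Real.norm_of_nonneg (hpos l).le]
  have hS1 : ∀ (l r : ℕ) (x : Matrix (Fin r) (Fin r) B),
      ampNorm (((towerScale ε l : ℝ) : ℂ)⁻¹ • S l) x ≤ B.matNorm x := fun l r x => by
    rw [ampNorm_smul, hnorm, inv_mul_le_iff₀ (hpos l)]
    exact (hS l r x).2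
  let F : ∀ l, B × MatOp (n 0) →ₗ[ℂ] MatOp (n l) := fun l =>
    (((towerScale ε l : ℝ) : ℂ)⁻¹ • S l) ∘ₗ LinearMap.fst ℂ _ _ + E l ∘ₗ LinearMap.snd ℂ _ _
  have hEnorm : ∀ l (y : MatOp (n 0)), ‖E l y‖ ≤ ‖y‖ := fun l y => by
    have := (hE 0 l (Nat.zero_le l)).norm_le y
    rwa [hE0] at this
  obtain ⟨Z, π, φ, hfd, hπ, hφ, hZ⟩ := exists_realization n F (fun v => ⟨‖v.1‖ + ‖v.2‖, fun l =>
    (norm_add_le _ _).trans (add_le_add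
      (CompLE.norm_le (f := ((towerScale ε l : ℝ) : ℂ)⁻¹ • S l) (g := B.carrier.subtype)
        (hS1 l) v.1) (hEnorm l v.2))⟩)
  obtain ⟨σ, hσ⟩ := π.exists_rightInverse_of_surjective (LinearMap.range_eq_top.2 hπ)
  have hF1 : ∀ l, F l ∘ₗ LinearMap.inl ℂ B (MatOp (n 0)) =
      ((towerScale ε l : ℝ) : ℂ)⁻¹ • S l := fun l => by ext1 b; simp [F]
  have hF2 : ∀ l, F l ∘ₗ LinearMap.inr ℂ B (MatOp (n 0)) = E l := fun l => by ext1 y; simp [F]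
  refine ⟨Z, π ∘ₗ LinearMap.inl ℂ _ _, n 0, S 0, π ∘ₗ LinearMap.inr ℂ _ _, ?_, ?_, ?_, ?_, ?_⟩
  · refine E1_of_finite_families Z hfd fun δ hδ => ?_
    obtain ⟨C₀, hC₀, hC₀'⟩ := exists_matNorm_map_le (LinearMap.fst ℂ B (MatOp (n 0)) ∘ₗ σ)
    -- `L` is chosen so that the coordinates beyond `L` contribute a relative error `δ / (1 + δ)`.
    obtain ⟨L, hL⟩ : ∃ L : ℕ, (1 - (1 - ε) / towerScale ε L) * C₀ ≤ δ / (1 + δ) := by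
      have h1 : Filter.Tendsto (fun L => (1 - (1 - ε) / towerScale ε L) * C₀) Filter.atTop
          (𝓝 ((1 - (1 - ε) / (1 - ε)) * C₀)) :=
        ((tendsto_const_nhds.div tendsto_towerScale (by linarith)).const_sub 1).mul_const C₀
      rw [div_self (by linarith), sub_self, zero_mul] at h1
      obtain ⟨L, hL⟩ := (h1.eventually (gt_mem_nhds (show 0 < δ / (1 + δ) by positivity))).exists
      exact ⟨L, hL.le⟩
    refine ⟨Fin (L + 1), inferInstance, fun j => n j, fun j => φ j, fun j r w =>
      (hZ r w _ (matNorm_nonneg _ _)).1 le_rfl j, fun r w C hC h => ?_⟩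
    have hN := Z.matNorm_nonneg w
    have hBN := B.matNorm_nonneg ((w.map σ).map Prod.fst)
    have hρ : B.matNorm ((w.map σ).map Prod.fst) ≤ C₀ * Z.matNorm w := hC₀' r w
    have hφF : ∀ l, ampNorm (φ l) w = ampNorm (F l) (w.map σ) := fun l => by
      rw [← hφ l, ampNorm_comp]
      congr 1
      ext1 a b
      exact (LinearMap.congr_fun hσ (w a b)).symm
    have hmain : Z.matNorm w ≤ C + δ / (1 + δ) * Z.matNorm w := by
      refine (hZ r w _ (by positivity)).2 fun l => ?_
      rcases lt_or_ge l (L + 1) with hl | hl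
      · refine (h ⟨l, hl⟩).trans ?_
        have : 0 ≤ δ / (1 + δ) * Z.matNorm w := by positivity
        linarith
      · have hdl := hpos l
        have hdL := hpos L
        have hle : towerScale ε l ≤ towerScale ε L := towerScale_antitone hε (by omega)
        have e : F l = E l ∘ₗ ((((towerScale ε L : ℝ) : ℂ)⁻¹ • S 0) ∘ₗ LinearMap.fst ℂ _ _ +
            LinearMap.snd ℂ _ _) +
            (((towerScale ε l)⁻¹ - (towerScale ε L)⁻¹ : ℝ) : ℂ) • (S l ∘ₗ LinearMap.fst ℂ _ _) := by
          refine LinearMap.ext fun v => ?_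
          have := LinearMap.congr_fun (hES l) v.1
          simp only [LinearMap.comp_apply] at this
          simp [F, this, sub_smul]
          abel
        have eL : F L = E L ∘ₗ ((((towerScale ε L : ℝ) : ℂ)⁻¹ • S 0) ∘ₗ LinearMap.fst ℂ _ _ +
            LinearMap.snd ℂ _ _) := by
          refine LinearMap.ext fun v => ?_
          have := LinearMap.congr_fun (hES L) v.1
          simp only [LinearMap.comp_apply] at this
          simp [F, this]
        rw [hφF, e]
        refine (ampNorm_add_le _ _ _).trans (add_le_add ?_ ?_)
        · refine ((hE L l (by omega)).comp _ r _).trans ?_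
          rw [← eL, ← hφF]
          exact h ⟨L, by omega⟩
        · have hinv : (towerScale ε L)⁻¹ ≤ (towerScale ε l)⁻¹ := inv_anti₀ hdl hle
          rw [ampNorm_smul, Complex.norm_real, Real.norm_of_nonneg (by linarith), ampNorm_comp]
          calc _ ≤ ((towerScale ε l)⁻¹ - (towerScale ε L)⁻¹) *
                (towerScale ε l * (C₀ * Z.matNorm w)) := by
                refine mul_le_mul_of_nonneg_left (((hS l r _).2).trans ?_) (by linarith)
                exact mul_le_mul_of_nonneg_left hρ hdl.le
            _ = (1 - towerScale ε l / towerScale ε L) * C₀ * Z.matNorm w := by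
                field_simp
            _ ≤ (1 - (1 - ε) / towerScale ε L) * C₀ * Z.matNorm w := by
                have := (lt_towerScale hε l).le
                gcongr
            _ ≤ _ := by gcongr
    have : Z.matNorm w * (1 / (1 + δ)) ≤ C := by
      have : Z.matNorm w * (1 / (1 + δ)) = Z.matNorm w - δ / (1 + δ) * Z.matNorm w := by
        field_simp; ring
      linarith
    rwa [mul_one_div, div_le_iff₀ (by positivity), mul_comm] at this
  · intro r x
    have hcoord : ∀ l, ampNorm (φ l) (x.map (π ∘ₗ LinearMap.inl ℂ _ _)) =
        (towerScale ε l)⁻¹ * ampNorm (S l) x := fun l => by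
      rw [← hnorm, ← ampNorm_smul, ← hF1, ← hφ l]; rfl
    apply le_antisymm
    · refine (hZ r _ _ (matNorm_nonneg _ _)).2 fun l => ?_
      rw [hcoord, inv_mul_le_iff₀ (hpos l)]
      exact (hS l r x).2
    · have h1 := (hZ r _ _ (matNorm_nonneg _ _)).1
        (le_refl (Z.matNorm (x.map (π ∘ₗ LinearMap.inl ℂ _ _))))
      set N := Z.matNorm (x.map (π ∘ₗ LinearMap.inl ℂ _ _))
      have h2 : ∀ l, towerScale ε (l + 1) * B.matNorm x ≤ towerScale ε l * N := fun l => by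
        have h3 := h1 l
        rw [hcoord, inv_mul_le_iff₀ (hpos l)] at h3
        exact ((hS l r x).1).trans h3
      have h3 := le_of_tendsto_of_tendsto'
        (((Filter.tendsto_add_atTop_iff_nat 1).2 (tendsto_towerScale (ε := ε))).mul_const
          (B.matNorm x)) ((tendsto_towerScale (ε := ε)).mul_const N) h2
      exact le_of_mul_le_mul_left h3 (by linarith)
  · intro r x
    have := (hS 0 r x).2
    rwa [towerScale_zero, one_mul] at this
  · intro r y
    refine (hZ r (y.map (π ∘ₗ LinearMap.inr ℂ _ _)) _ (ampNorm_nonneg _ _)).2 fun l => ?_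
    have h1 := hE 0 l (Nat.zero_le l) r y
    rw [hE0] at h1
    refine le_trans (le_of_eq ?_) h1
    rw [← ampNorm_comp, ← LinearMap.comp_assoc, hφ, hF2]
  · intro b
    set z := (π ∘ₗ LinearMap.inl ℂ _ _) b - (π ∘ₗ LinearMap.inr ℂ _ _) (S 0 b) with hz
    have h1 := (hZ 1 (Matrix.of fun _ _ => z) (ε * ‖b‖) (by positivity)).2 fun l => by
      rw [ampNorm_one]
      have e : φ l z = (((towerScale ε l)⁻¹ - 1 : ℝ) : ℂ) • S l b := by
        have h2 := LinearMap.congr_fun (hF1 l) b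
        have h3 := LinearMap.congr_fun (hF2 l) (S 0 b)
        have h4 := LinearMap.congr_fun (hES l) b
        rw [← hφ l] at h2 h3
        simp only [LinearMap.comp_apply, LinearMap.smul_apply] at h2 h3 h4
        rw [hz, map_sub]
        simp only [LinearMap.comp_apply]
        rw [h2, h3, h4, Complex.ofReal_sub, Complex.ofReal_inv, Complex.ofReal_one]
        exact ((sub_smul _ (1 : ℂ) (S l b)).trans (by rw [one_smul])).symm
      have hb : ‖S l b‖ ≤ towerScale ε l * ‖b‖ := by
        have := (hS l 1 (Matrix.of fun _ _ => b)).2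
        rwa [ampNorm_one, matNorm_eq, ampNorm_one] at this
      have hinv : 1 ≤ (towerScale ε l)⁻¹ := (one_le_inv₀ (hpos l)).2 (towerScale_le_one hε l)
      rw [e, norm_smul, Complex.norm_real, Real.norm_of_nonneg (by linarith)]
      calc _ ≤ ((towerScale ε l)⁻¹ - 1) * (towerScale ε l * ‖b‖) :=
            mul_le_mul_of_nonneg_left hb (by linarith)
        _ = (1 - towerScale ε l) * ‖b‖ := by
            have := (hpos l).ne'
            field_simp
        _ ≤ ε * ‖b‖ := by
            have := lt_towerScale hε l
            gcongr
            linarith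
    rw [matNorm_eq, ampNorm_one] at h1
    exact h1

/-! ### Comparison of tuples by complete contractions into matrix algebras -/

section Approximates

variable {X Y Z : OperatorSpace} {k : ℕ}

/-- The tuple `a` of `X` is approximated by the tuple `b` of `Y` up to `δ`: every image of `a` under
a complete contraction into a matrix algebra is within `δ` of such an image of `b`. -/
def Approximates (a : Fin k → X) (b : Fin k → Y) (δ : ℝ) : Prop :=
  ∀ (n : ℕ) (f : X →ₗ[ℂ] MatOp n), CompLE f X.carrier.subtype →
    ∃ g : Y →ₗ[ℂ] MatOp n, CompLE g Y.carrier.subtype ∧ ∀ i, ‖f (a i) - g (b i)‖ ≤ δ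

theorem Approximates.trans {a : Fin k → X} {b : Fin k → Y} {c : Fin k → Z} {δ δ' : ℝ}
    (h : Approximates a b δ) (h' : Approximates b c δ') : Approximates a c (δ + δ') := by
  intro n f hf
  obtain ⟨g, hg, hfg⟩ := h n f hf
  obtain ⟨e, he, hge⟩ := h' n g hg
  exact ⟨e, he, fun i => (norm_sub_le_norm_sub_add_norm_sub _ _ _).trans
    (add_le_add (hfg i) (hge i))⟩

theorem Approximates.mono {a : Fin k → X} {b : Fin k → Y} {δ δ' : ℝ} (h : Approximates a b δ)
    (hδ : δ ≤ δ') : Approximates a b δ' := fun n f hf =>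
  let ⟨g, hg, hfg⟩ := h n f hf
  ⟨g, hg, fun i => (hfg i).trans hδ⟩

/-- The linear map of `ℂ^k` into `X` sending the standard basis to a tuple. -/
def tupleMap {E : Type*} [AddCommGroup E] [Module ℂ E] (a : Fin k → E) : (Fin k → ℂ) →ₗ[ℂ] E :=
  Fintype.linearCombination ℂ a

theorem tupleMap_apply {E : Type*} [AddCommGroup E] [Module ℂ E] (a : Fin k → E) (c : Fin k → ℂ) :
    tupleMap a c = ∑ i, c i • a i := rfl

theorem tupleMap_single {E : Type*} [AddCommGroup E] [Module ℂ E] (a : Fin k → E) (i : Fin k) :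
    tupleMap a (Pi.single i 1) = a i := by
  simp [tupleMap_apply, Pi.single_apply]

theorem range_tupleMap {E : Type*} [AddCommGroup E] [Module ℂ E] (a : Fin k → E) :
    LinearMap.range (tupleMap a) = Submodule.span ℂ (Set.range a) :=
  Fintype.range_linearCombination ℂ a

theorem comp_tupleMap {E F : Type*} [AddCommGroup E] [Module ℂ E] [AddCommGroup F] [Module ℂ F]
    (f : E →ₗ[ℂ] F) (a : Fin k → E) : f ∘ₗ tupleMap a = tupleMap fun i => f (a i) := by
  refine LinearMap.ext fun c => ?_
  simp [tupleMap_apply]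

theorem tupleMap_sub {E : Type*} [AddCommGroup E] [Module ℂ E] (a b : Fin k → E) :
    tupleMap (fun i => a i - b i) = tupleMap a - tupleMap b := by
  refine LinearMap.ext fun c => ?_
  simp [tupleMap_apply, smul_sub]

theorem norm_tupleMap_le {E : Type*} [NormedAddCommGroup E] [NormedSpace ℂ E] {a : Fin k → E}
    {δ : ℝ} (h : ∀ i, ‖a i‖ ≤ δ) (c : Fin k → ℂ) : ‖tupleMap a c‖ ≤ δ * ∑ i, ‖c i‖ := by
  rw [tupleMap_apply, Finset.mul_sum]
  refine (norm_sum_le _ _).trans (Finset.sum_le_sum fun i _ => ?_)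
  rw [norm_smul, mul_comm]
  exact mul_le_mul_of_nonneg_right (h i) (norm_nonneg _)

/-- Approximation of tuples controls the matrix norms of their linear combinations. -/
theorem Approximates.matNorm_le {a : Fin k → X} {b : Fin k → Y} {δ : ℝ} (h : Approximates a b δ)
    (hX : E1 X) {r : ℕ} (x : Matrix (Fin r) (Fin r) (Fin k → ℂ)) :
    X.matNorm (x.map (tupleMap a)) ≤
      Y.matNorm (x.map (tupleMap b)) + δ * ∑ p, ∑ q, ∑ i, ‖x p q i‖ := by
  set D := Y.matNorm (x.map (tupleMap b)) + δ * ∑ p, ∑ q, ∑ i, ‖x p q i‖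
  have key : ∀ ε : ℝ, 0 < ε → X.matNorm (x.map (tupleMap a)) ≤ (1 + ε) * D := by
    intro ε hε
    obtain ⟨n, T, hT, hT'⟩ := ((E1_iff X).1 hX).2 ε hε
    obtain ⟨g, hg, hTg⟩ := h n T hT
    refine (hT' r _).trans (mul_le_mul_of_nonneg_left ?_ (by linarith))
    have e : T ∘ₗ tupleMap a = g ∘ₗ tupleMap b + tupleMap fun i => T (a i) - g (b i) := by
      rw [tupleMap_sub, comp_tupleMap, comp_tupleMap]; abel
    rw [← ampNorm_comp, e]
    refine (ampNorm_add_le _ _ _).trans (add_le_add (hg r (x.map (tupleMap b))) ?_)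
    refine (ampNorm_le_sum _ _).trans ?_
    simp only [Finset.mul_sum]
    refine Finset.sum_le_sum fun p _ => Finset.sum_le_sum fun q _ => ?_
    rw [← Finset.mul_sum]
    exact norm_tupleMap_le hTg _
  have h2 : Filter.Tendsto (fun ε : ℝ => (1 + ε) * D) (𝓝[>] 0) (𝓝 ((1 + 0) * D)) :=
    (((continuous_const.add continuous_id).mul continuous_const).tendsto _).mono_left
      nhdsWithin_le_nhds
  rw [add_zero, one_mul] at h2
  refine ge_of_tendsto h2 ?_
  filter_upwards [self_mem_nhdsWithin] with ε hε using key ε hε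

theorem exists_nuclear_embedding_tuple (hX : E1 X) (a : Fin k → X) {ε : ℝ} (hε : 0 < ε) :
    ∃ (Z : OperatorSpace) (ψ : X →ₗ[ℂ] Z) (n : ℕ) (T : X →ₗ[ℂ] MatOp n)
      (χ : MatOp n →ₗ[ℂ] Z), E1 Z ∧ IsCompleteIsometry ψ ∧ CompLE T X.carrier.subtype ∧
      CompLE (Z.carrier.subtype ∘ₗ χ) LinearMap.id ∧ ∀ i, ‖ψ (a i) - χ (T (a i))‖ ≤ ε := by
  set M := ∑ i, ‖a i‖
  have hM : 0 ≤ M := Finset.sum_nonneg fun _ _ => norm_nonneg _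
  have hε' : 0 < min (1 / 2) (ε / (1 + M)) := by positivity
  obtain ⟨Z, ψ, n, T, χ, h1, h2, h3, h4, h5⟩ := exists_nuclear_embedding hX hε'
    ((min_le_left _ _).trans_lt (by norm_num))
  refine ⟨Z, ψ, n, T, χ, h1, h2, h3, h4, fun i => (h5 (a i)).trans ?_⟩
  have hi : ‖a i‖ ≤ 1 + M := (Finset.single_le_sum (f := fun i => ‖a i‖)
    (fun _ _ => norm_nonneg _) (Finset.mem_univ i)).trans (by linarith)
  calc _ ≤ ε / (1 + M) * (1 + M) := by gcongr; exact min_le_right _ _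
    _ = ε := by field_simp

/-- Tuples of `1`-exact spaces that approximate each other become close in a common `1`-exact
space. The space is a direct sum of two spaces from `exists_nuclear_embedding`; each summand
receives the other given space through a matrix algebra. -/
theorem exists_common_embedding (hX : E1 X) (hY : E1 Y) {a : Fin k → X} {b : Fin k → Y} {δ : ℝ}
    (hab : Approximates a b δ) (hba : Approximates b a δ) {ε : ℝ} (hε : 0 < ε) :
    ∃ (Z : OperatorSpace) (ψ₀ : X →ₗ[ℂ] Z) (ψ₁ : Y →ₗ[ℂ] Z), E1 Z ∧ IsCompleteIsometry ψ₀ ∧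
      IsCompleteIsometry ψ₁ ∧ ∀ i, ‖ψ₀ (a i) - ψ₁ (b i)‖ ≤ δ + ε := by
  obtain ⟨ZX, ψX, n, TX, χX, hZX, hψX, hTX, hχX, hX'⟩ := exists_nuclear_embedding_tuple hX a hε
  obtain ⟨ZY, ψY, m, TY, χY, hZY, hψY, hTY, hχY, hY'⟩ := exists_nuclear_embedding_tuple hY b hε
  obtain ⟨g, hg, hga⟩ := hab n TX hTX
  obtain ⟨g', hg', hgb⟩ := hba m TY hTY
  obtain ⟨Z, π, hZ, hπ⟩ := exists_directSum hZX hZY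
  have hnorm : ∀ v, ‖π v‖ = max ‖v.1‖ ‖v.2‖ := by
    intro v
    have h1 := hπ 1 (Matrix.of fun _ _ => v)
    rw [matNorm_map, ampNorm_one] at h1
    have h2 := ampNorm_one (ZX.carrier.subtype ∘ₗ LinearMap.fst ℂ ZX ZY) v
    have h3 := ampNorm_one (ZY.carrier.subtype ∘ₗ LinearMap.snd ℂ ZX ZY) v
    exact h1.trans (congrArg₂ max h2 h3)
  refine ⟨Z, π ∘ₗ (ψX.prod (χY ∘ₗ g')), π ∘ₗ ((χX ∘ₗ g).prod ψY), hZ, fun r x => ?_,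
    fun r x => ?_, fun i => ?_⟩
  · refine (hπ r (x.map (ψX.prod (χY ∘ₗ g')))).trans ?_
    refine (max_eq_left ?_).trans (hψX r x)
    exact ((hχY r (x.map g')).trans (hg' r x)).trans (hψX r x).ge
  · refine (hπ r (x.map ((χX ∘ₗ g).prod ψY))).trans ?_
    refine (max_eq_right ?_).trans (hψY r x)
    exact ((hχX r (x.map g)).trans (hg r x)).trans (hψY r x).ge
  · rw [LinearMap.comp_apply, LinearMap.comp_apply, ← map_sub, hnorm]
    refine max_le ?_ ?_
    · change ‖ψX (a i) - χX (g (b i))‖ ≤ _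
      have h1 : ‖χX (TX (a i)) - χX (g (b i))‖ ≤ δ := by
        rw [← map_sub]
        exact (hχX.norm_le _).trans (hga i)
      linarith [norm_sub_le_norm_sub_add_norm_sub (ψX (a i)) (χX (TX (a i))) (χX (g (b i))), hX' i]
    · change ‖χY (g' (a i)) - ψY (b i)‖ ≤ _
      have h1 : ‖χY (TY (b i)) - χY (g' (a i))‖ ≤ δ := by
        rw [← map_sub]
        exact (hχY.norm_le _).trans (hgb i)
      rw [norm_sub_rev]
      linarith [norm_sub_le_norm_sub_add_norm_sub (ψY (b i)) (χY (TY (b i))) (χY (g' (a i))), hY' i]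

end Approximates

theorem hereditaryProperty_E1 : HereditaryProperty E1 := fun X hX _ a =>
  hX.of_isCompleteIsometry (isCompleteIsometry_genInclusion X a)

theorem jointEmbeddingProperty_E1 : JointEmbeddingProperty E1 := by
  intro X Y hX hY
  have h : ∀ {X Y : OperatorSpace}, Approximates (X := X) (Y := Y) (k := 0) Fin.elim0 Fin.elim0 0 :=
    fun n f _ => ⟨0, fun r x => by rw [ampNorm_zero]; exact ampNorm_nonneg _ _, fun i => i.elim0⟩
  obtain ⟨Z, φ, ψ, hZ, hφ, hψ, -⟩ := exists_common_embedding hX hY h h one_pos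
  exact ⟨Z, hZ, φ, ψ, hφ, hψ⟩

theorem nearAmalgamationProperty_E1 : NearAmalgamationProperty E1 := by
  intro A B₀ B₁ _ h₀ h₁ ι φ hι hφ m a ε hε
  have h : ∀ {B B' : OperatorSpace} {ι : A →ₗ[ℂ] B} {φ : A →ₗ[ℂ] B'}, IsCompleteIsometry ι →
      IsCompleteIsometry φ → Approximates (fun i => ι (a i)) (fun i => φ (a i)) 0 := by
    intro B B' ι φ hι hφ n f hf
    obtain ⟨g, hg, hg'⟩ := exists_extension_to_space
      (((hf.comp ι).trans hι.compLE).trans hφ.compLE_symm)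
    refine ⟨g, hg', fun i => ?_⟩
    have := LinearMap.congr_fun hg (a i)
    simp only [LinearMap.comp_apply] at this
    rw [this, sub_self, norm_zero]
  obtain ⟨Z, ψ₀, ψ₁, hZ, hψ₀, hψ₁, hd⟩ := exists_common_embedding h₀ h₁ (h hι hφ) (h hφ hι) hε
  refine ⟨Z, hZ, ψ₀, ψ₁, hψ₀, hψ₁, fun i => ?_⟩
  rw [dist_eq_norm]
  simpa using hd i

/-! ### The Fraïssé metric -/

section Distance

variable {X Y Z : OperatorSpace} {k : ℕ}

/-- Closeness of tuples in the sense of partial isomorphisms into a common operator space implies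
approximation. -/
theorem approximates_of_partial {m m' : ℕ} {c : Fin m → X} {c' : Fin m' → Y}
    {f₀ : X.gen c →ₗ[ℂ] Z} {g₀ : Y.gen c' →ₗ[ℂ] Z} (hf₀ : IsCompleteIsometry f₀)
    (hg₀ : IsCompleteIsometry g₀) {a : Fin k → X} {b : Fin k → Y} {δ : ℝ}
    (h : ∀ i, ∃ (x : X.gen c) (y : Y.gen c') (z : Z),
      ‖a i - X.genInclusion c x‖ + ‖f₀ x - z‖ + (‖b i - Y.genInclusion c' y‖ + ‖g₀ y - z‖) ≤ δ) :
    Approximates a b δ := by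
  intro n f hf
  obtain ⟨G, hG, hG'⟩ := exists_extension_to_space
    ((hf.comp (X.genInclusion c)).trans hf₀.compLE_symm)
  obtain ⟨g, hg, hg'⟩ := exists_extension_to_space (φ := Y.genInclusion c') (f := G ∘ₗ g₀)
    ((hG'.comp g₀).trans hg₀.compLE)
  refine ⟨g, hg', fun i => ?_⟩
  obtain ⟨x, y, z, hi⟩ := h i
  have e1 : G (f₀ x) = f (X.genInclusion c x) := LinearMap.congr_fun hG x
  have e2 : g (Y.genInclusion c' y) = G (g₀ y) := LinearMap.congr_fun hg y
  have h1 : ‖f (a i) - f (X.genInclusion c x)‖ ≤ ‖a i - X.genInclusion c x‖ := by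
    rw [← map_sub]; exact hf.norm_le _
  have h2 : ‖f (X.genInclusion c x) - G z‖ ≤ ‖f₀ x - z‖ := by
    rw [← e1, ← map_sub]; exact hG'.norm_le _
  have h3 : ‖G z - g (Y.genInclusion c' y)‖ ≤ ‖g₀ y - z‖ := by
    rw [e2, norm_sub_rev, ← map_sub]; exact hG'.norm_le _
  have h4 : ‖g (Y.genInclusion c' y) - g (b i)‖ ≤ ‖b i - Y.genInclusion c' y‖ := by
    rw [norm_sub_rev, ← map_sub]; exact hg'.norm_le _
  have e : f (a i) - g (b i) = (f (a i) - f (X.genInclusion c x)) +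
      (f (X.genInclusion c x) - G z) + (G z - g (Y.genInclusion c' y)) +
      (g (Y.genInclusion c' y) - g (b i)) := by abel
  rw [e]
  refine (norm_add_le _ _).trans ?_
  have := norm_add₃_le (a := f (a i) - f (X.genInclusion c x))
    (b := f (X.genInclusion c x) - G z) (c := G z - g (Y.genInclusion c' y))
  linarith

theorem genInclusion_surjective {a : Fin k → X} (ha : Submodule.span ℂ (Set.range a) = ⊤) :
    Function.Surjective (X.genInclusion a) := by
  intro x
  have hx : (x : X.H →L[ℂ] X.H) ∈
      Submodule.span ℂ (Set.range fun i => (a i : X.H →L[ℂ] X.H)) := by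
    have h1 : X.carrier.subtype x ∈ (Submodule.span ℂ (Set.range a)).map X.carrier.subtype :=
      Submodule.mem_map_of_mem (ha ▸ Submodule.mem_top)
    rw [Submodule.map_span, ← Set.range_comp] at h1
    exact h1
  exact ⟨⟨(x : X.H →L[ℂ] X.H), hx⟩, rfl⟩

theorem tupleMap_surjective {a : Fin k → X} (ha : Submodule.span ℂ (Set.range a) = ⊤) :
    Function.Surjective (tupleMap a) := by
  rw [← LinearMap.range_eq_top, range_tupleMap, ha]

end Distance

section Metric

variable {k : ℕ}

/-- The distance of tuples is witnessed by partial isomorphisms into a common space, up to an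
arbitrarily small change of the finitely many values that matter. -/
theorem approximates_of_fraisseDist_lt {C : OperatorSpace → Prop} {p q : GenTuple C k} {δ : ℝ}
    (h : fraisseDist C p q < ENNReal.ofReal δ) :
    Approximates p.a q.a δ ∧ Approximates q.a p.a δ := by
  simp only [fraisseDist, iInf_lt_iff] at h
  obtain ⟨φ, hφ, h⟩ := h
  -- The closure in the definition of approximate morphisms is for pointwise convergence.
  have hopen : IsOpen (⋂ i : Fin k,
      {θ : p.X → q.X → ℝ≥0∞ | θ (p.a i) (q.a i) < ENNReal.ofReal δ}) :=
    isOpen_iInter_of_finite fun i => isOpen_lt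
      ((continuous_apply _).comp (continuous_apply _)) continuous_const
  obtain ⟨θ, hθ, -, ψ, hψ, hle⟩ := mem_closure_iff.1 hφ _ hopen
    (Set.mem_iInter.2 fun i => (le_iSup (fun i => φ (p.a i) (q.a i)) i).trans_lt h)
  obtain ⟨Z, -, _, ⟨m, c, f₀, hf₀, rfl⟩, _, ⟨m', c', g₀, hg₀, rfl⟩, rfl⟩ := hψ
  have key : ∀ i, ∃ (x : p.X.gen c) (y : q.X.gen c') (z : Z),
      ‖p.a i - p.X.genInclusion c x‖ + ‖f₀ x - z‖ +
        (‖q.a i - q.X.genInclusion c' y‖ + ‖g₀ y - z‖) ≤ δ := by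
    intro i
    have h1 := (hle _ _).trans_lt (Set.mem_iInter.1 hθ i)
    simp only [graphDist, ENNReal.iInf_add, ENNReal.add_iInf, iInf_lt_iff] at h1
    obtain ⟨z, y, x, h1⟩ := h1
    refine ⟨x, y, z, ?_⟩
    simp only [edist_dist, dist_eq_norm] at h1
    rw [← ENNReal.ofReal_add (by positivity) (by positivity),
      ← ENNReal.ofReal_add (by positivity) (by positivity),
      ← ENNReal.ofReal_add (by positivity) (by positivity)] at h1
    exact ((ENNReal.ofReal_lt_ofReal_iff_of_nonneg (by positivity)).1 h1).le
  exact ⟨approximates_of_partial hf₀ hg₀ key, approximates_of_partial hg₀ hf₀ fun i =>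
    let ⟨x, y, z, h⟩ := key i
    ⟨y, x, z, by rwa [add_comm]⟩⟩

/-- For embeddings into a common space of the class, the distance between the images is an
approximate morphism. -/
theorem fraisseDist_le_of_embeddings {C : OperatorSpace → Prop} (hC : HereditaryProperty C)
    {p q : GenTuple C k} {Z : OperatorSpace} (hZ : C Z) {ψ₀ : p.X →ₗ[ℂ] Z} {ψ₁ : q.X →ₗ[ℂ] Z}
    (h₀ : IsCompleteIsometry ψ₀) (h₁ : IsCompleteIsometry ψ₁) {δ : ℝ}
    (h : ∀ i, ‖ψ₀ (p.a i) - ψ₁ (q.a i)‖ ≤ δ) : fraisseDist C p q ≤ ENNReal.ofReal δ := by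
  have hi₀ : ∀ x y, edist (ψ₀ x) (ψ₀ y) = edist x y := fun x y => by
    rw [edist_dist, edist_dist, dist_eq_norm, dist_eq_norm, ← map_sub, h₀.norm_map]
  have hi₁ : ∀ x y, edist (ψ₁ x) (ψ₁ y) = edist x y := fun x y => by
    rw [edist_dist, edist_dist, dist_eq_norm, dist_eq_norm, ← map_sub, h₁.norm_map]
  let θ : p.X → q.X → ℝ≥0∞ := fun x y => edist (ψ₀ x) (ψ₁ y)
  have hθ : ∀ x y, θ x y = edist (ψ₀ x) (ψ₁ y) := fun _ _ => rfl
  have hθ' : IsApproxIsometry θ := by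
    refine ⟨fun a a' b => ?_, fun a b b' => ?_⟩
    · rw [hθ, hθ, ← hi₀ a a', add_comm]
      exact ⟨edist_triangle _ _ _, edist_triangle_right _ _ _⟩
    · rw [hθ, hθ, ← hi₁ b b']
      refine ⟨?_, edist_triangle_left _ _ _⟩
      rw [edist_comm (ψ₁ b)]
      exact edist_triangle _ _ _
  have hf := h₀.comp (isCompleteIsometry_genInclusion p.X p.a)
  have hg := h₁.comp (isCompleteIsometry_genInclusion q.X q.a)
  have hmem : θ ∈ Apx C p.X q.X := by
    refine subset_closure ⟨hθ', _, ⟨Z, fun m a => hC Z hZ m a, _, ⟨k, p.a, _, hf, rfl⟩, _,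
      ⟨k, q.a, _, hg, rfl⟩, rfl⟩, fun x y => ?_⟩
    obtain ⟨x, rfl⟩ := genInclusion_surjective p.span_eq_top x
    obtain ⟨y, rfl⟩ := genInclusion_surjective q.span_eq_top y
    refine (iInf_le _ (ψ₀ (p.X.genInclusion p.a x))).trans ?_
    refine (add_le_add (iInf_le _ x) (iInf_le _ y)).trans (le_of_eq ?_)
    rw [edist_self, edist_self, zero_add, zero_add, LinearMap.comp_apply, edist_self, zero_add,
      edist_comm]
    rfl
  refine (iInf₂_le _ hmem).trans (iSup_le fun i => ?_)
  rw [hθ, edist_dist, dist_eq_norm]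
  exact ENNReal.ofReal_le_ofReal (h i)

/-- Together with `approximates_of_fraisseDist_lt` this describes the Fraïssé distance in `𝓔₁(k)` as
the infimum of the errors of mutual approximation. -/
theorem fraisseDist_le {p q : GenTuple E1 k} {δ : ℝ} (h : Approximates p.a q.a δ)
    (h' : Approximates q.a p.a δ) : fraisseDist E1 p q ≤ ENNReal.ofReal δ := by
  have key : ∀ ε : ℝ, 0 < ε → fraisseDist E1 p q ≤ ENNReal.ofReal (δ + ε) := fun ε hε => by
    obtain ⟨Z, ψ₀, ψ₁, hZ, h₀, h₁, hd⟩ := exists_common_embedding p.mem q.mem h h' hε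
    exact fraisseDist_le_of_embeddings hereditaryProperty_E1 hZ h₀ h₁ hd
  have hl : Filter.Tendsto (fun ε : ℝ => ENNReal.ofReal (δ + ε)) (𝓝[>] 0)
      (𝓝 (ENNReal.ofReal (δ + 0))) :=
    ((ENNReal.continuous_ofReal.comp (continuous_const.add continuous_id)).tendsto _).mono_left
      nhdsWithin_le_nhds
  rw [add_zero] at hl
  refine ge_of_tendsto hl ?_
  filter_upwards [self_mem_nhdsWithin] with ε hε using key ε hε

theorem fraisseDist_comm (p q : GenTuple E1 k) : fraisseDist E1 p q = fraisseDist E1 q p := by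
  have key : ∀ p q : GenTuple E1 k, fraisseDist E1 p q ≤ fraisseDist E1 q p := fun p q => by
    refine le_of_forall_gt_imp_ge_of_dense fun c hc => ?_
    rcases eq_or_ne c ∞ with rfl | hct
    · exact le_top
    rw [← ENNReal.ofReal_toReal hct] at hc ⊢
    obtain ⟨h1, h2⟩ := approximates_of_fraisseDist_lt hc
    exact fraisseDist_le h2 h1
  exact le_antisymm (key p q) (key q p)

theorem fraisseDist_triangle (p q s : GenTuple E1 k) :
    fraisseDist E1 p s ≤ fraisseDist E1 p q + fraisseDist E1 q s := by
  refine ENNReal.le_of_forall_pos_le_add fun ε hε hlt => ?_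
  rw [ENNReal.add_lt_top] at hlt
  have hlt' : ∀ x : ℝ≥0∞, x < ∞ → x < ENNReal.ofReal (x.toReal + ε / 2) := fun x hx => by
    rw [ENNReal.ofReal_add ENNReal.toReal_nonneg (by positivity), ENNReal.ofReal_toReal hx.ne]
    refine ENNReal.lt_add_right hx.ne ?_
    rw [Ne, ENNReal.ofReal_eq_zero, not_le]
    positivity
  obtain ⟨h1, h2⟩ := approximates_of_fraisseDist_lt (hlt' _ hlt.1)
  obtain ⟨h3, h4⟩ := approximates_of_fraisseDist_lt (hlt' _ hlt.2)
  refine (fraisseDist_le (h1.trans h3) ((h4.trans h2).mono (by rw [add_comm]))).trans (le_of_eq ?_)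
  rw [show (fraisseDist E1 p q).toReal + (ε : ℝ) / 2 + ((fraisseDist E1 q s).toReal + (ε : ℝ) / 2)
      = (fraisseDist E1 p q).toReal + (fraisseDist E1 q s).toReal + ε by ring,
    ENNReal.ofReal_add (by positivity) (by positivity),
    ENNReal.ofReal_add (by positivity) (by positivity), ENNReal.ofReal_toReal hlt.1.ne,
    ENNReal.ofReal_toReal hlt.2.ne, ENNReal.ofReal_coe_nnreal]

theorem fraisseDist_ne_top (p q : GenTuple E1 k) : fraisseDist E1 p q ≠ ∞ := by
  obtain ⟨δ, hδ⟩ : ∃ δ : ℝ, ∀ i, ‖p.a i‖ ≤ δ ∧ ‖q.a i‖ ≤ δ := by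
    refine ⟨∑ i, ‖p.a i‖ + ∑ i, ‖q.a i‖, fun i => ?_⟩
    have h1 := Finset.single_le_sum (f := fun i => ‖p.a i‖) (fun _ _ => norm_nonneg _)
      (Finset.mem_univ i)
    have h2 := Finset.single_le_sum (f := fun i => ‖q.a i‖) (fun _ _ => norm_nonneg _)
      (Finset.mem_univ i)
    have h3 := norm_nonneg (p.a i)
    have h4 := norm_nonneg (q.a i)
    constructor <;> linarith
  have h : ∀ {X Y : OperatorSpace} (a : Fin k → X) (b : Fin k → Y), (∀ i, ‖a i‖ ≤ δ) →
      Approximates a b δ := fun a b ha n f hf =>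
    -- The zero map approximates within the norms of the tuple.
    ⟨0, fun r x => by rw [ampNorm_zero]; exact ampNorm_nonneg _ _, fun i => by
      rw [LinearMap.zero_apply, sub_zero]
      exact (hf.norm_le _).trans (ha i)⟩
  exact ((fraisseDist_le (h p.a q.a fun i => (hδ i).1)
    (h q.a p.a fun i => (hδ i).2)).trans_lt ENNReal.ofReal_lt_top).ne

theorem fraisseDist_eq_zero_of_rel {p q : GenTuple E1 k}
    (h : ∃ φ : p.X ≃ₗ[ℂ] q.X, IsCompleteIsometry (φ : p.X →ₗ[ℂ] q.X) ∧ ∀ i, φ (p.a i) = q.a i) :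
    fraisseDist E1 p q = 0 := by
  obtain ⟨φ, hφ, hφa⟩ := h
  refine nonpos_iff_eq_zero.1 ?_
  rw [← ENNReal.ofReal_zero]
  refine fraisseDist_le_of_embeddings hereditaryProperty_E1 q.mem hφ
    (ψ₁ := LinearMap.id) (fun _ _ => rfl) fun i => ?_
  rw [LinearEquiv.coe_coe, hφa, LinearMap.id_apply, sub_self, norm_zero]

/-- At distance zero all matrix norms of linear combinations agree, so that the map sending one
tuple to the other is a complete isometry. -/
theorem rel_of_fraisseDist_eq_zero {p q : GenTuple E1 k} (h : fraisseDist E1 p q = 0) :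
    ∃ φ : p.X ≃ₗ[ℂ] q.X, IsCompleteIsometry (φ : p.X →ₗ[ℂ] q.X) ∧ ∀ i, φ (p.a i) = q.a i := by
  have hle : ∀ {p q : GenTuple E1 k}, fraisseDist E1 p q = 0 → ∀ (r : ℕ)
      (x : Matrix (Fin r) (Fin r) (Fin k → ℂ)),
      p.X.matNorm (x.map (tupleMap p.a)) ≤ q.X.matNorm (x.map (tupleMap q.a)) := by
    intro p q h r x
    have hl : Filter.Tendsto (fun δ : ℝ => q.X.matNorm (x.map (tupleMap q.a)) +
        δ * ∑ i, ∑ j, ∑ l, ‖x i j l‖) (𝓝[>] 0) (𝓝 (q.X.matNorm (x.map (tupleMap q.a)) +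
        0 * ∑ i, ∑ j, ∑ l, ‖x i j l‖)) :=
      ((continuous_const.add (continuous_id.mul continuous_const)).tendsto _).mono_left
        nhdsWithin_le_nhds
    rw [zero_mul, add_zero] at hl
    refine ge_of_tendsto hl ?_
    filter_upwards [self_mem_nhdsWithin] with δ hδ
    exact (approximates_of_fraisseDist_lt (h ▸ ENNReal.ofReal_pos.2 hδ)).1.matNorm_le p.mem x
  have heq : ∀ (r : ℕ) (x : Matrix (Fin r) (Fin r) (Fin k → ℂ)),
      p.X.matNorm (x.map (tupleMap p.a)) = q.X.matNorm (x.map (tupleMap q.a)) := fun r x =>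
    le_antisymm (hle h r x) (hle (fraisseDist_comm p q ▸ h) r x)
  have hnorm : ∀ c, ‖tupleMap p.a c‖ = ‖tupleMap q.a c‖ := fun c => by
    have := heq 1 (Matrix.of fun _ _ => c)
    rwa [matNorm_map, matNorm_map, ampNorm_one, ampNorm_one] at this
  have hker : LinearMap.ker (tupleMap p.a) = LinearMap.ker (tupleMap q.a) := by
    ext c
    rw [LinearMap.mem_ker, LinearMap.mem_ker, ← norm_eq_zero, hnorm, norm_eq_zero]
  let φ : p.X ≃ₗ[ℂ] q.X :=
    ((tupleMap p.a).quotKerEquivOfSurjective (tupleMap_surjective p.span_eq_top)).symm.trans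
      ((Submodule.quotEquivOfEq _ _ hker).trans
        ((tupleMap q.a).quotKerEquivOfSurjective (tupleMap_surjective q.span_eq_top)))
  have hφ : ∀ c, φ (tupleMap p.a c) = tupleMap q.a c := by
    intro c
    have h1 : ((tupleMap p.a).quotKerEquivOfSurjective
        (tupleMap_surjective p.span_eq_top)).symm (tupleMap p.a c) = Submodule.Quotient.mk c := by
      rw [LinearEquiv.symm_apply_eq]; rfl
    have h2 : φ (tupleMap p.a c) = ((Submodule.quotEquivOfEq _ _ hker).trans
        ((tupleMap q.a).quotKerEquivOfSurjective (tupleMap_surjective q.span_eq_top)))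
        (((tupleMap p.a).quotKerEquivOfSurjective
          (tupleMap_surjective p.span_eq_top)).symm (tupleMap p.a c)) := rfl
    rw [h2, h1]
    rfl
  refine ⟨φ, fun r x => ?_, fun i => ?_⟩
  · obtain ⟨σ, hσ⟩ := (tupleMap p.a).exists_rightInverse_of_surjective
      (LinearMap.range_eq_top.2 (tupleMap_surjective p.span_eq_top))
    have hx : x = (x.map σ).map (tupleMap p.a) := by
      ext1 i j
      exact (LinearMap.congr_fun hσ (x i j)).symm
    have hx' : x.map φ = (x.map σ).map (tupleMap q.a) := by
      ext1 i j
      refine (congrArg φ (LinearMap.congr_fun hσ (x i j)).symm).trans (hφ _)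
    refine Eq.trans ?_ ((heq r (x.map σ)).symm.trans (congrArg _ hx.symm))
    exact congrArg _ hx'
  · rw [← tupleMap_single p.a i, hφ, tupleMap_single]

/-- The Fraïssé metric on `𝓔₁(k)`. -/
@[reducible]
def fraisseMetricSpace (k : ℕ) : MetricSpace (FraisseSpace E1 k) :=
  letI : EMetricSpace (FraisseSpace E1 k) :=
    { edist := Quotient.lift₂ (fraisseDist E1) (by
        have key : ∀ {p q p' q' : GenTuple E1 k}, p ≈ p' → q ≈ q' →
            fraisseDist E1 p q ≤ fraisseDist E1 p' q' := by
          intro p q p' q' hp hq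
          refine (fraisseDist_triangle p p' q).trans ?_
          rw [fraisseDist_eq_zero_of_rel hp, zero_add]
          refine (fraisseDist_triangle p' q' q).trans ?_
          rw [fraisseDist_comm q' q, fraisseDist_eq_zero_of_rel hq, add_zero]
        intro p q p' q' hp hq
        exact le_antisymm (key hp hq) (key (Setoid.symm hp) (Setoid.symm hq)))
      edist_self := by
        rintro ⟨p⟩
        exact fraisseDist_eq_zero_of_rel (Setoid.refl p)
      edist_comm := by
        rintro ⟨p⟩ ⟨q⟩
        exact fraisseDist_comm p q
      edist_triangle := by
        rintro ⟨p⟩ ⟨q⟩ ⟨s⟩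
        exact fraisseDist_triangle p q s
      eq_of_edist_eq_zero := by
        rintro ⟨p⟩ ⟨q⟩ h
        exact Quotient.sound (rel_of_fraisseDist_eq_zero h) }
  EMetricSpace.toMetricSpace (by
    rintro ⟨p⟩ ⟨q⟩
    exact fraisseDist_ne_top p q)

theorem isFraisseMetric_fraisseMetricSpace (k : ℕ) :
    @IsFraisseMetric E1 k (fraisseMetricSpace k) := fun _ _ => rfl

end Metric

/-! ### Completeness -/

section Limits

variable {X Y : OperatorSpace} {k : ℕ}

/-- A limit of tuples of `1`-exact spaces generates a `1`-exact space, provided that its matrix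
norms are determined by the complete contractions into matrix algebras: an almost completely
isometric map on a nearby space yields one on the limit. -/
theorem E1_of_approximates (hfd : FiniteDimensional ℂ X)
    (hX : ∀ (r : ℕ) (w : Matrix (Fin r) (Fin r) X) (C : ℝ), 0 ≤ C → (∀ (n : ℕ)
      (g : X →ₗ[ℂ] MatOp n), CompLE g X.carrier.subtype → ampNorm g w ≤ C) → X.matNorm w ≤ C)
    {a : Fin k → X} (ha : Submodule.span ℂ (Set.range a) = ⊤)
    (h : ∀ η : ℝ, 0 < η → ∃ (Y : OperatorSpace) (b : Fin k → Y), E1 Y ∧ Approximates a b η ∧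
      Approximates b a η) : E1 X := by
  refine (E1_iff X).2 ⟨hfd, fun ε hε => ?_⟩
  obtain ⟨s, hs⟩ := (tupleMap a).exists_rightInverse_of_surjective
    (LinearMap.range_eq_top.2 (tupleMap_surjective ha))
  obtain ⟨C, hC, hCs⟩ := exists_ampNorm_comp_le X s
  -- The errors below amount to `(2 + ε / 2) * (C * η)` times the norm.
  set t : ℝ := ε / 2 / (1 + ε)
  have ht : 0 < t := by positivity
  set η : ℝ := t / ((2 + ε / 2) * (C + 1))
  have hη : 0 < η := by positivity
  have hηt : (2 + ε / 2) * (C * η) ≤ t := by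
    have h1 : η * ((2 + ε / 2) * (C + 1)) = t := div_mul_cancel₀ _ (by positivity)
    have h2 : 0 ≤ (2 + ε / 2) * η := by positivity
    nlinarith
  obtain ⟨Y, b, hY, hab, hba⟩ := h η hη
  obtain ⟨n, T₀, hT₀, hT₀'⟩ := ((E1_iff Y).1 hY).2 (ε / 2) (by positivity)
  obtain ⟨T, hT, hTT⟩ := hba n T₀ hT₀
  refine ⟨n, T, hT, fun r w => ?_⟩
  have hw : ∀ {m : ℕ} (g : X →ₗ[ℂ] MatOp m), ampNorm g w =
      ampNorm (tupleMap fun i => g (a i)) (w.map s) := by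
    intro m g
    rw [← comp_tupleMap, ← ampNorm_comp, LinearMap.comp_assoc, hs, LinearMap.comp_id]
  have hdiff : ∀ {m : ℕ} (u v : Fin k → MatOp m), (∀ i, ‖u i - v i‖ ≤ η) →
      ampNorm (tupleMap u) (w.map s) ≤
        ampNorm (tupleMap v) (w.map s) + C * η * X.matNorm w := by
    intro m u v huv
    have e : tupleMap u = tupleMap v + tupleMap fun i => u i - v i := by
      rw [tupleMap_sub]; abel
    rw [e]
    refine (ampNorm_add_le _ _ _).trans (add_le_add le_rfl ?_)
    exact hCs _ (tupleMap fun i => u i - v i) η hη.le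
      (fun i => by rw [tupleMap_single]; exact huv i) r w
  have hN := X.matNorm_nonneg w
  have hA := ampNorm_nonneg T w
  have key : X.matNorm w ≤ (1 + ε / 2) * (ampNorm T w + C * η * X.matNorm w) +
      C * η * X.matNorm w := by
    refine hX r w _ (by positivity) fun m g hg => ?_
    obtain ⟨g', hg', hgg⟩ := hab m g hg
    rw [hw g]
    refine (hdiff _ (fun i => g' (b i)) hgg).trans (add_le_add ?_ le_rfl)
    rw [← comp_tupleMap, ampNorm_comp]
    refine (hg' r _).trans ((hT₀' r ((w.map s).map (tupleMap b))).trans ?_)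
    refine mul_le_mul_of_nonneg_left ?_ (by positivity)
    rw [← ampNorm_comp, comp_tupleMap, hw T]
    exact hdiff _ _ hTT
  have h1 : (1 - t) * X.matNorm w ≤ (1 + ε / 2) * ampNorm T w := by nlinarith
  have h2 : 1 + ε / 2 = (1 - t) * (1 + ε) := by
    have : t * (1 + ε) = ε / 2 := div_mul_cancel₀ _ (by positivity)
    linarith
  have h3 : 0 < 1 - t := by
    by_contra hcon
    nlinarith
  rw [h2, mul_assoc] at h1
  exact le_of_mul_le_mul_left h1 h3

/-- Let `X` carry the matrix norms given by a family of maps `F i` on `ℂ^k`. If every `F i` is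
close on the standard basis to the values at `b` of a complete contraction, then `b` approximates
the generators of `X`. Indeed the `F i` and the complete contractions together define a space into
which `X` embeds, and complete contractions on `X` extend to it. -/
theorem approximates_of_coordinates (hY : FiniteDimensional ℂ Y) {ι : Type} {n : ι → ℕ}
    {F : ∀ i, (Fin k → ℂ) →ₗ[ℂ] MatOp (n i)} (hF : ∀ c, ∃ C, ∀ i, ‖F i c‖ ≤ C)
    {π : (Fin k → ℂ) →ₗ[ℂ] X} (hπ : ∀ (r : ℕ) (x : Matrix (Fin r) (Fin r) (Fin k → ℂ)) (C : ℝ),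
      0 ≤ C → (∀ i, ampNorm (F i) x ≤ C) → X.matNorm (x.map π) ≤ C)
    {b : Fin k → Y} {δ : ℝ} (hδ : 0 ≤ δ) {f : ∀ i, Y →ₗ[ℂ] MatOp (n i)}
    (hf : ∀ i, CompLE (f i) Y.carrier.subtype)
    (hfF : ∀ i j, ‖f i (b j) - F i (Pi.single j 1)‖ ≤ δ) :
    Approximates (fun j => π (Pi.single j 1)) b δ := by
  intro m g hg
  obtain ⟨Z, π', φ, -, -, hφ, hZ⟩ := exists_realization (V := (Fin k → ℂ) × Y) n
    (fun i => (F i).coprod (f i)) (fun v => by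
      obtain ⟨C, hC⟩ := hF v.1
      exact ⟨C + ‖v.2‖, fun i => (norm_add_le _ _).trans
        (add_le_add (hC i) ((hf i).norm_le v.2))⟩)
  have h1 : CompLE (g ∘ₗ π) (Z.carrier.subtype ∘ₗ (π' ∘ₗ LinearMap.inl ℂ (Fin k → ℂ) Y)) := by
    intro r x
    refine (hg r (x.map π)).trans (hπ r x _ (ampNorm_nonneg _ _) fun i => ?_)
    refine le_trans (le_of_eq ?_)
      ((hZ r (x.map (π' ∘ₗ LinearMap.inl ℂ (Fin k → ℂ) Y)) _ (Z.matNorm_nonneg _)).1 le_rfl i)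
    rw [← ampNorm_comp, ← LinearMap.comp_assoc, hφ, LinearMap.coprod_inl]
  obtain ⟨G, hG, hG'⟩ := exists_extension_to_space h1
  refine ⟨G ∘ₗ (π' ∘ₗ LinearMap.inr ℂ (Fin k → ℂ) Y), fun r x => ?_, fun j => ?_⟩
  · refine (hG' r (x.map (π' ∘ₗ LinearMap.inr ℂ (Fin k → ℂ) Y))).trans
      ((hZ r _ _ (Y.matNorm_nonneg x)).2 fun i => ?_)
    rw [← ampNorm_comp, ← LinearMap.comp_assoc, hφ, LinearMap.coprod_inr]
    exact hf i r x
  · have e : g (π (Pi.single j 1)) - (G ∘ₗ (π' ∘ₗ LinearMap.inr ℂ (Fin k → ℂ) Y)) (b j) =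
        G (π' (Pi.single j 1, -b j)) := by
      have h2 := LinearMap.congr_fun hG (Pi.single j 1)
      simp only [LinearMap.comp_apply] at h2 ⊢
      rw [← h2, ← map_sub, ← map_sub]
      simp
    rw [e]
    refine (hG'.norm_le _).trans ?_
    have h3 := (hZ 1 (Matrix.of fun _ _ => π' (Pi.single j 1, -b j)) δ hδ).2 fun i => by
      have h4 : φ i (π' (Pi.single j 1, -b j)) = F i (Pi.single j 1) - f i (b j) := by
        rw [← LinearMap.comp_apply, hφ]
        simp [sub_eq_add_neg]
      rw [ampNorm_one, h4, norm_sub_rev]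
      exact hfF i j
    rwa [matNorm_eq, ampNorm_one] at h3

/-- Along a fast Cauchy sequence of tuples, the values of a complete contraction at one tuple are
close to a tuple of matrices that is approximated by values of complete contractions at all the
tuples. -/
theorem exists_limit_values {p : ℕ → GenTuple E1 k}
    (h : ∀ j l, j ≤ l → Approximates (p j).a (p l).a ((1 / 2) ^ j) ∧
      Approximates (p l).a (p j).a ((1 / 2) ^ j)) (j : ℕ) {n : ℕ} (f : (p j).X →ₗ[ℂ] MatOp n)
    (hf : CompLE f (p j).X.carrier.subtype) :
    ∃ κ : Fin k → MatOp n, (∀ l, ∃ g : (p l).X →ₗ[ℂ] MatOp n, CompLE g (p l).X.carrier.subtype ∧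
      ∀ i, ‖g ((p l).a i) - κ i‖ ≤ 2 * (1 / 2) ^ l) ∧
      ∀ i, ‖f ((p j).a i) - κ i‖ ≤ 2 * (1 / 2) ^ j := by
  have hstep : ∀ m (g : {g : (p (j + m)).X →ₗ[ℂ] MatOp n //
      CompLE g (p (j + m)).X.carrier.subtype}),
      ∃ g' : {g : (p (j + (m + 1))).X →ₗ[ℂ] MatOp n //
        CompLE g (p (j + (m + 1))).X.carrier.subtype},
      ∀ i, ‖g.1 ((p (j + m)).a i) - g'.1 ((p (j + (m + 1))).a i)‖ ≤ (1 / 2) ^ (j + m) := by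
    intro m g
    obtain ⟨g', hg', hgg⟩ := (h (j + m) (j + (m + 1)) (by omega)).1 n g.1 g.2
    exact ⟨⟨g', hg'⟩, hgg⟩
  choose next hnext using hstep
  let G : ∀ m, {g : (p (j + m)).X →ₗ[ℂ] MatOp n // CompLE g (p (j + m)).X.carrier.subtype} :=
    fun m => Nat.rec ⟨f, hf⟩ next m
  let u : ℕ → Fin k → MatOp n := fun m i => (G m).1 ((p (j + m)).a i)
  have hu : ∀ m, dist (u m) (u (m + 1)) ≤ 2 * (1 / 2) ^ j / 2 / 2 ^ m := by
    intro m
    refine (dist_pi_le_iff (by positivity)).2 fun i => ?_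
    rw [dist_eq_norm]
    refine (hnext m (G m) i).trans (le_of_eq ?_)
    rw [pow_add, one_div_pow (2 : ℝ) m]
    ring
  obtain ⟨κ, hκ⟩ := cauchySeq_tendsto_of_complete (cauchySeq_of_le_geometric_two hu)
  have hlim : ∀ m i, ‖u m i - κ i‖ ≤ 2 * (1 / 2) ^ (j + m) := by
    intro m i
    rw [← dist_eq_norm]
    refine (dist_le_pi_dist _ _ i).trans
      ((dist_le_of_le_geometric_two_of_tendsto hu hκ m).trans (le_of_eq ?_))
    rw [pow_add, one_div_pow (2 : ℝ) m]
    ring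
  refine ⟨κ, fun l => ?_, hlim 0⟩
  rcases le_or_gt j l with hl | hl
  · obtain ⟨m, rfl⟩ := Nat.exists_eq_add_of_le hl
    exact ⟨(G m).1, (G m).2, hlim m⟩
  · obtain ⟨g, hg, hgf⟩ := (h l j hl.le).2 n f hf
    refine ⟨g, hg, fun i => (norm_sub_le_norm_sub_add_norm_sub _ (f ((p j).a i)) _).trans ?_⟩
    have h1 := hlim 0 i
    have h2 : (1 / 2 : ℝ) ^ (j + 0) ≤ (1 / 2) ^ (l + 1) :=
      pow_le_pow_of_le_one (by norm_num) (by norm_num) hl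
    have h3 := hgf i
    rw [norm_sub_rev] at h3
    rw [pow_succ] at h2
    have h4 : ‖f ((p j).a i) - κ i‖ ≤ 2 * (1 / 2) ^ (j + 0) := h1
    linarith

/-- The limit of a fast Cauchy sequence of tuples. Its matrix norms are given by the tuples of
matrices that are close to images of all the tuples of the sequence under complete contractions. -/
theorem exists_limit {p : ℕ → GenTuple E1 k}
    (h : ∀ j l, j ≤ l → Approximates (p j).a (p l).a ((1 / 2) ^ j) ∧
      Approximates (p l).a (p j).a ((1 / 2) ^ j)) :
    ∃ q : GenTuple E1 k, ∀ j, Approximates (p j).a q.a (2 * (1 / 2) ^ j) ∧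
      Approximates q.a (p j).a (2 * (1 / 2) ^ j) := by
  -- `κ` enumerates the tuples of matrices that are approximated along the whole sequence.
  obtain ⟨ι, n, κ, hκ, hall⟩ : ∃ (ι : Type) (n : ι → ℕ) (κ : ∀ i, Fin k → MatOp (n i)),
      (∀ i l, ∃ g : (p l).X →ₗ[ℂ] MatOp (n i), CompLE g (p l).X.carrier.subtype ∧
        ∀ j, ‖g ((p l).a j) - κ i j‖ ≤ 2 * (1 / 2) ^ l) ∧
      ∀ (m : ℕ) (u : Fin k → MatOp m), (∀ l, ∃ g : (p l).X →ₗ[ℂ] MatOp m,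
        CompLE g (p l).X.carrier.subtype ∧ ∀ j, ‖g ((p l).a j) - u j‖ ≤ 2 * (1 / 2) ^ l) →
        ∃ i, n i = m ∧ HEq (κ i) u :=
    ⟨Σ m : ℕ, {u : Fin k → MatOp m // ∀ l, ∃ g : (p l).X →ₗ[ℂ] MatOp m,
      CompLE g (p l).X.carrier.subtype ∧ ∀ j, ‖g ((p l).a j) - u j‖ ≤ 2 * (1 / 2) ^ l},
      fun i => i.1, fun i => i.2.1, fun i => i.2.2, fun m u hu => ⟨⟨m, u, hu⟩, rfl, HEq.rfl⟩⟩
  have hb : ∀ i j, ‖κ i j‖ ≤ ∑ j, ‖(p 0).a j‖ + 2 := by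
    intro i j
    obtain ⟨g, hg, hgκ⟩ := hκ i 0
    have h0 : ‖g ((p 0).a j)‖ ≤ ‖(p 0).a j‖ := hg.norm_le _
    have h1 := Finset.single_le_sum (f := fun j => ‖(p 0).a j‖) (fun _ _ => norm_nonneg _)
      (Finset.mem_univ j)
    have h2 := norm_sub_norm_le (κ i j) (g ((p 0).a j))
    have h3 := hgκ j
    rw [norm_sub_rev] at h3
    linarith
  let F : ∀ i, (Fin k → ℂ) →ₗ[ℂ] MatOp (n i) := fun i => tupleMap (κ i)
  have hF : ∀ c, ∃ C, ∀ i, ‖F i c‖ ≤ C := fun c =>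
    ⟨(∑ j, ‖(p 0).a j‖ + 2) * ∑ j, ‖c j‖, fun i => norm_tupleMap_le (hb i) c⟩
  obtain ⟨X, π, φ, hfd, hsurj, hφ, hX⟩ := exists_realization n F hF
  have hφX : ∀ i, CompLE (φ i) X.carrier.subtype := fun i r w =>
    (hX r w _ (X.matNorm_nonneg w)).1 le_rfl i
  let a : Fin k → X := fun j => π (Pi.single j 1)
  have hπa : tupleMap a = π := by
    refine (Pi.basisFun ℂ (Fin k)).ext fun i => ?_
    rw [Pi.basisFun_apply, tupleMap_single]
  have hspan : Submodule.span ℂ (Set.range a) = ⊤ := by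
    rw [← range_tupleMap, hπa, LinearMap.range_eq_top.2 hsurj]
  have hfwd : ∀ j, Approximates (p j).a a (2 * (1 / 2) ^ j) := by
    intro j m f hf
    obtain ⟨u, hu, hfu⟩ := exists_limit_values h j f hf
    obtain ⟨i, rfl, hi⟩ := hall m u hu
    obtain rfl := eq_of_heq hi
    refine ⟨φ i, hφX i, fun l => ?_⟩
    have h1 : φ i (a l) = κ i l :=
      (LinearMap.congr_fun (hφ i) (Pi.single l 1)).trans (tupleMap_single (κ i) l)
    rw [h1]
    exact hfu l
  have hbwd : ∀ j, Approximates a (p j).a (2 * (1 / 2) ^ j) := by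
    intro j
    choose f hf hfκ using fun i => hκ i j
    refine approximates_of_coordinates (p j).mem.1 hF (fun r x C hC hx => ?_) (by positivity) hf
      fun i l => ?_
    · refine (hX r (x.map π) C hC).2 fun i => ?_
      rw [← ampNorm_comp, hφ]
      exact hx i
    · rw [show F i (Pi.single l 1) = κ i l from tupleMap_single _ l]
      exact hfκ i l
  refine ⟨⟨X, E1_of_approximates hfd (fun r w C hC hw => (hX r w C hC).2 fun i =>
    hw _ (φ i) (hφX i)) hspan fun η hη => ?_, a, hspan⟩, fun j => ⟨hfwd j, hbwd j⟩⟩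
  obtain ⟨j, hj⟩ := exists_pow_lt_of_lt_one (show 0 < η / 2 by positivity)
    (show (1 / 2 : ℝ) < 1 by norm_num)
  exact ⟨(p j).X, (p j).a, (p j).mem, (hbwd j).mono (by linarith), (hfwd j).mono (by linarith)⟩

end Limits

theorem completeSpace_fraisseMetricSpace (k : ℕ) :
    @CompleteSpace (FraisseSpace E1 k) (fraisseMetricSpace k).toUniformSpace := by
  let := fraisseMetricSpace k
  refine EMetric.complete_of_convergent_controlled_sequences
    (fun j => ENNReal.ofReal ((1 / 2) ^ j)) (fun j => ENNReal.ofReal_pos.2 (by positivity))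
    fun P hP => ?_
  choose p hp using fun j => Quotient.exists_rep (P j)
  have hdist : ∀ j l, edist (P j) (P l) = fraisseDist E1 (p j) (p l) := fun j l => by
    rw [← hp j, ← hp l]; rfl
  obtain ⟨q, hq⟩ := exists_limit (p := p) fun j l hl =>
    approximates_of_fraisseDist_lt (by rw [← hdist]; exact hP j j l le_rfl hl)
  refine ⟨q.toSpace, ?_⟩
  have h1 : ∀ j, edist (P j) q.toSpace ≤ ENNReal.ofReal (2 * (1 / 2) ^ j) := fun j => by
    rw [← hp j]
    exact fraisseDist_le (hq j).1 (hq j).2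
  rw [tendsto_iff_edist_tendsto_0]
  refine tendsto_of_tendsto_of_tendsto_of_le_of_le tendsto_const_nhds ?_ (fun _ => zero_le) h1
  have h2 := (tendsto_pow_atTop_nhds_zero_of_lt_one (r := (1 / 2 : ℝ)) (by norm_num)
    (by norm_num)).const_mul 2
  have h3 := (ENNReal.continuous_ofReal.tendsto _).comp h2
  rw [mul_zero, ENNReal.ofReal_zero] at h3
  exact h3

/-! ### Tuples of matrices -/

theorem norm_sub_inv_smul_le {E : Type*} [NormedAddCommGroup E] [NormedSpace ℂ E] {η : ℝ}
    (hη : 0 ≤ η) (v : E) : ‖v - ((1 + η : ℝ) : ℂ)⁻¹ • v‖ ≤ η * ‖v‖ := by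
  have h : (1 : ℂ) - ((1 + η : ℝ) : ℂ)⁻¹ = ((η / (1 + η) : ℝ) : ℂ) := by
    rw [← Complex.ofReal_inv, ← Complex.ofReal_one, ← Complex.ofReal_sub]
    congr 1
    have : 1 + η ≠ 0 := by positivity
    field_simp
    ring
  nth_rewrite 1 [← one_smul ℂ v]
  rw [← sub_smul, h, norm_smul, Complex.norm_real, Real.norm_of_nonneg (by positivity)]
  exact mul_le_mul_of_nonneg_right (div_le_self hη (by linarith)) (norm_nonneg v)

/-- If `T` has distortion at most `1 + η`, then a complete contraction on `X`, divided by `1 + η`,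
is dominated by `T` and so extends to `M_n`. -/
theorem approximates_of_apply_eq {X Y : OperatorSpace} {n k : ℕ} {T : X →ₗ[ℂ] MatOp n}
    {S : Y →ₗ[ℂ] MatOp n} {η : ℝ} (hη : 0 ≤ η)
    (hT : ∀ (r : ℕ) (x : Matrix (Fin r) (Fin r) X), X.matNorm x ≤ (1 + η) * ampNorm T x)
    (hS : CompLE S Y.carrier.subtype) {a : Fin k → X} {b : Fin k → Y}
    (hab : ∀ i, S (b i) = T (a i)) {M : ℝ} (hM : ∀ i, ‖a i‖ ≤ M) : Approximates a b (η * M) := by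
  intro m f hf
  have hc : ‖((1 + η : ℝ) : ℂ)⁻¹‖ = (1 + η)⁻¹ := by
    rw [norm_inv, Complex.norm_real, Real.norm_of_nonneg (by positivity)]
  have h1 : CompLE (((1 + η : ℝ) : ℂ)⁻¹ • f) T := by
    intro r x
    rw [ampNorm_smul, hc, inv_mul_le_iff₀ (by positivity)]
    exact (hf r x).trans (hT r x)
  obtain ⟨G, hG, hG'⟩ := exists_extension h1
  refine ⟨G ∘ₗ S, (hG'.comp S).trans hS, fun i => ?_⟩
  have h2 : G (T (a i)) = ((1 + η : ℝ) : ℂ)⁻¹ • f (a i) := LinearMap.congr_fun hG (a i)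
  have h3 : ‖f (a i)‖ ≤ ‖a i‖ := hf.norm_le _
  rw [LinearMap.comp_apply, hab, h2]
  exact (norm_sub_inv_smul_le hη (f (a i))).trans
    (mul_le_mul_of_nonneg_left (h3.trans (hM i)) hη)

/-- The tuple `a`, as a tuple of generators of its span. -/
def genTuple {X : OperatorSpace} (hX : E1 X) {k : ℕ} (a : Fin k → X) : GenTuple E1 k where
  X := X.gen a
  mem := hereditaryProperty_E1 X hX k a
  a i := (⟨(a i : X.H →L[ℂ] X.H), Submodule.subset_span ⟨i, rfl⟩⟩ :
    Submodule.span ℂ (Set.range fun i => (a i : X.H →L[ℂ] X.H)))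
  span_eq_top := by
    refine Submodule.map_injective_of_injective (Submodule.injective_subtype (X.gen a).carrier) ?_
    rw [Submodule.map_span, Submodule.map_top, Submodule.range_subtype]
    exact congrArg (Submodule.span ℂ) (Set.range_comp _ _).symm

/-- A matrix as an element of the operator space `M_n`. -/
def toMatrixAlgebra (n : ℕ) : MatOp n →ₗ[ℂ] matrixAlgebra n :=
  LinearMap.codRestrict (⊤ : Submodule ℂ (MatOp n)) LinearMap.id fun _ => Submodule.mem_top

section MatrixTuple

variable {k n : ℕ}

/-- A tuple of `n × n` matrices, as a point of `𝓔₁(k)` over its span in `M_n`. -/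
def matrixTuple (u : Fin k → MatOp n) : GenTuple E1 k :=
  genTuple (E1_matrixAlgebra n) fun i => toMatrixAlgebra n (u i)

/-- The inclusion of the span of a tuple of matrices into `M_n`. -/
def matrixTupleInclusion (u : Fin k → MatOp n) : (matrixTuple u).X →ₗ[ℂ] matrixAlgebra n :=
  (matrixAlgebra n).genInclusion fun i => toMatrixAlgebra n (u i)

theorem isCompleteIsometry_matrixTupleInclusion (u : Fin k → MatOp n) :
    IsCompleteIsometry (matrixTupleInclusion u) := isCompleteIsometry_genInclusion _ _

theorem matrixTupleInclusion_apply (u : Fin k → MatOp n) (i : Fin k) :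
    matrixTupleInclusion u ((matrixTuple u).a i) = toMatrixAlgebra n (u i) := rfl

/-- The inclusion of the span of a tuple of matrices into the bounded operators on `ℂⁿ`. -/
def matrixTupleVal (u : Fin k → MatOp n) : (matrixTuple u).X →ₗ[ℂ] MatOp n :=
  (matrixTuple u).X.carrier.subtype

theorem matrixTupleVal_apply (u : Fin k → MatOp n) (i : Fin k) :
    matrixTupleVal u ((matrixTuple u).a i) = u i := rfl

theorem compLE_matrixTupleVal (u : Fin k → MatOp n) :
    CompLE (matrixTupleVal u) (matrixTuple u).X.carrier.subtype := fun _ _ => le_rfl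

theorem compLE_matrixTupleVal_symm (u : Fin k → MatOp n) :
    CompLE (matrixTuple u).X.carrier.subtype (matrixTupleVal u) := fun _ _ => le_rfl

theorem matrixTuple_mem_matricialPoints (u : Fin k → MatOp n) :
    (matrixTuple u).toSpace ∈ matricialPoints E1 k :=
  ⟨_, rfl, n, _, isCompleteIsometry_matrixTupleInclusion u⟩

theorem fraisseDist_matrixTuple_le (u v : Fin k → MatOp n) {δ : ℝ} (h : ∀ i, ‖u i - v i‖ ≤ δ) :
    fraisseDist E1 (matrixTuple u) (matrixTuple v) ≤ ENNReal.ofReal δ := by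
  refine fraisseDist_le_of_embeddings hereditaryProperty_E1 (E1_matrixAlgebra n)
    (isCompleteIsometry_matrixTupleInclusion u) (isCompleteIsometry_matrixTupleInclusion v)
    fun i => ?_
  rw [matrixTupleInclusion_apply, matrixTupleInclusion_apply]
  exact h i

/-- A point of `𝓔₁(k)` whose space embeds into `M_n` is represented by a tuple of matrices. -/
theorem exists_matrixTuple_of_mem {P : FraisseSpace E1 k} (hP : P ∈ matricialPoints E1 k) :
    ∃ (n : ℕ) (u : Fin k → MatOp n), (matrixTuple u).toSpace = P := by
  obtain ⟨p, rfl, n, φ, hφ⟩ := hP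
  let u : Fin k → MatOp n := fun i => (matrixAlgebra n).carrier.subtype (φ (p.a i))
  refine ⟨n, u, Quotient.sound (rel_of_fraisseDist_eq_zero (nonpos_iff_eq_zero.1 ?_))⟩
  rw [← ENNReal.ofReal_zero]
  refine fraisseDist_le_of_embeddings hereditaryProperty_E1 (E1_matrixAlgebra n)
    (isCompleteIsometry_matrixTupleInclusion u) hφ fun i => ?_
  have h1 : matrixTupleInclusion u ((matrixTuple u).a i) = φ (p.a i) := rfl
  rw [h1, sub_self, norm_zero]

/-- Every tuple in `𝓔₁(k)` is close to a tuple of matrices, its image under an almost completely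
isometric complete contraction. -/
theorem exists_matrixTuple_near (p : GenTuple E1 k) {ε : ℝ} (hε : 0 < ε) :
    ∃ (n : ℕ) (u : Fin k → MatOp n), fraisseDist E1 p (matrixTuple u) ≤ ENNReal.ofReal ε ∧
      (LinearIndependent ℂ p.a → LinearIndependent ℂ (matrixTuple u).a) := by
  set M := 1 + ∑ i, ‖p.a i‖
  have hM : 0 < M := add_pos_of_pos_of_nonneg one_pos (Finset.sum_nonneg fun _ _ => norm_nonneg _)
  have hpM : ∀ i, ‖p.a i‖ ≤ M := fun i => (Finset.single_le_sum (f := fun i => ‖p.a i‖)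
    (fun _ _ => norm_nonneg _) (Finset.mem_univ i)).trans (le_add_of_nonneg_left zero_le_one)
  have hη : 0 < ε / M := by positivity
  obtain ⟨n, T, hT, hT'⟩ := ((E1_iff p.X).1 p.mem).2 (ε / M) hη
  have hinj : Function.Injective T := by
    refine (injective_iff_map_eq_zero T).2 fun x hx => eq_zero_of_matNorm_nonpos ?_
    refine (hT' 1 _).trans ?_
    rw [ampNorm_one, hx, norm_zero, mul_zero]
  let u : Fin k → MatOp n := fun i => T (p.a i)
  have hpu : Approximates p.a (matrixTuple u).a ε :=
    (approximates_of_apply_eq hη.le hT' (compLE_matrixTupleVal u) (matrixTupleVal_apply u)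
      hpM).mono (div_mul_cancel₀ _ hM.ne').le
  have hup : Approximates (matrixTuple u).a p.a ε := by
    refine (approximates_of_apply_eq le_rfl (fun r x => ?_) hT
      (fun i => (matrixTupleVal_apply u i).symm) (M := ∑ i, ‖(matrixTuple u).a i‖)
      fun i => ?_).mono (by rw [zero_mul]; exact hε.le)
    · rw [add_zero, one_mul]
      exact compLE_matrixTupleVal_symm u r x
    · exact Finset.single_le_sum (f := fun i => ‖(matrixTuple u).a i‖)
        (fun _ _ => norm_nonneg _) (Finset.mem_univ i)
  exact ⟨n, u, fraisseDist_le hpu hup, fun h => LinearIndependent.of_comp (matrixTupleVal u)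
    (h.map' T (LinearMap.ker_eq_bot.2 hinj))⟩

end MatrixTuple

/-! ### Density, separability and Auerbach bases -/

section Topology

variable (k : ℕ)

attribute [local instance] fraisseMetricSpace

theorem edist_toSpace (p q : GenTuple E1 k) : edist p.toSpace q.toSpace = fraisseDist E1 p q := rfl

variable {k}

theorem exists_matrixTuple_edist_lt (p : GenTuple E1 k) {ε : ℝ≥0∞} (hε : 0 < ε) :
    ∃ (n : ℕ) (u : Fin k → MatOp n), edist p.toSpace (matrixTuple u).toSpace < ε ∧
      (LinearIndependent ℂ p.a → LinearIndependent ℂ (matrixTuple u).a) := by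
  obtain ⟨δ, hδ, hδε⟩ := ENNReal.lt_iff_exists_nnreal_btwn.1 hε
  obtain ⟨n, u, hu, hli⟩ := exists_matrixTuple_near p (ε := δ) (by exact_mod_cast hδ)
  refine ⟨n, u, ?_, hli⟩
  rw [edist_toSpace]
  rw [ENNReal.ofReal_coe_nnreal] at hu
  exact hu.trans_lt hδε

theorem dense_matricialPoints : Dense (matricialPoints E1 k) := by
  rintro ⟨p⟩
  refine EMetric.mem_closure_iff.2 fun ε hε => ?_
  obtain ⟨n, u, hu, -⟩ := exists_matrixTuple_edist_lt p hε
  exact ⟨_, matrixTuple_mem_matricialPoints u, hu⟩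

theorem basisPoints_subset_closure : basisPoints E1 k ⊆
    closure (basisPoints E1 k ∩ matricialPoints E1 k) := by
  rintro _ ⟨p, rfl, hp⟩
  refine EMetric.mem_closure_iff.2 fun ε hε => ?_
  obtain ⟨n, u, hu, hli⟩ := exists_matrixTuple_edist_lt p hε
  exact ⟨_, ⟨⟨_, rfl, hli hp⟩, matrixTuple_mem_matricialPoints u⟩, hu⟩

theorem lipschitzWith_matrixTuple (n : ℕ) :
    LipschitzWith 1 fun u : Fin k → MatOp n => (matrixTuple u).toSpace := by
  refine LipschitzWith.mk_one fun u v => ?_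
  rw [dist_edist, edist_toSpace]
  refine ENNReal.toReal_le_of_le_ofReal dist_nonneg (fraisseDist_matrixTuple_le u v fun i => ?_)
  rw [← dist_eq_norm]
  exact dist_le_pi_dist u v i

theorem separableSpace_fraisseSpace : TopologicalSpace.SeparableSpace (FraisseSpace E1 k) := by
  have h1 : TopologicalSpace.IsSeparable
      (⋃ n, Set.range fun u : Fin k → MatOp n => (matrixTuple u).toSpace) := by
    refine .iUnion fun n => ?_
    have : ProperSpace (MatOp n) := FiniteDimensional.proper ℂ _
    exact TopologicalSpace.isSeparable_range (lipschitzWith_matrixTuple n).continuous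
  have h2 : matricialPoints E1 k ⊆
      ⋃ n, Set.range fun u : Fin k → MatOp n => (matrixTuple u).toSpace := fun P hP =>
    let ⟨n, u, hu⟩ := exists_matrixTuple_of_mem hP
    Set.mem_iUnion.2 ⟨n, u, hu⟩
  rw [← TopologicalSpace.isSeparable_univ_iff, ← dense_matricialPoints.closure_eq]
  exact (h1.mono h2).closure

theorem separableSpace_subtype (s : Set (FraisseSpace E1 k)) :
    TopologicalSpace.SeparableSpace s :=
  ((TopologicalSpace.isSeparable_univ_iff.2 separableSpace_fraisseSpace).mono
    (Set.subset_univ s)).separableSpace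

theorem Approximates.norm_tupleMap_le {X Y : OperatorSpace} (hX : E1 X) {a : Fin k → X}
    {b : Fin k → Y} {δ : ℝ} (h : Approximates a b δ) (c : Fin k → ℂ) :
    ‖tupleMap a c‖ ≤ ‖tupleMap b c‖ + δ * ∑ i, ‖c i‖ := by
  have h1 := h.matNorm_le hX (Matrix.of fun _ _ : Fin 1 => c)
  rw [matNorm_map, matNorm_map, ampNorm_one, ampNorm_one] at h1
  simpa using h1

/-- The conditions on an Auerbach basis are inequalities between norms of linear combinations,
hence pass to limits; linear independence of the limit follows from the bound on the dual basis. -/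
theorem isClosed_auerbachPoints (N : ℝ) : IsClosed (auerbachPoints E1 k N) := by
  refine isClosed_of_closure_subset ?_
  rintro ⟨p⟩ hp
  have hp' : ∀ δ : ℝ, 0 < δ → ∃ q : GenTuple E1 k, Approximates p.a q.a δ ∧
      Approximates q.a p.a δ ∧
      ∀ i, ‖q.a i‖ ≤ N ∧ ∀ c : Fin k → ℂ, ‖c i‖ ≤ N * ‖tupleMap q.a c‖ := by
    intro δ hδ
    obtain ⟨_, ⟨q, rfl, -, hq⟩, hpq⟩ := EMetric.mem_closure_iff.1 hp _ (ENNReal.ofReal_pos.2 hδ)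
    obtain ⟨h1, h2⟩ := approximates_of_fraisseDist_lt hpq
    exact ⟨q, h1, h2, hq⟩
  have key : ∀ i, ‖p.a i‖ ≤ N ∧ ∀ c : Fin k → ℂ, ‖c i‖ ≤ N * ‖tupleMap p.a c‖ := by
    refine fun i => ⟨le_of_forall_pos_le_add fun δ hδ => ?_, fun c =>
      le_of_forall_pos_le_add fun ε hε => ?_⟩
    · obtain ⟨q, h1, -, hq⟩ := hp' δ hδ
      have h2 := h1.norm_tupleMap_le p.mem (Pi.single i 1)
      have h3 : ∑ j, ‖(Pi.single i 1 : Fin k → ℂ) j‖ = 1 := by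
        rw [Finset.sum_eq_single i (fun j _ hj => by simp [hj]) (by simp)]
        simp
      rw [tupleMap_single, tupleMap_single, h3, mul_one] at h2
      linarith [(hq i).1]
    · have hN : 0 ≤ N := by
        obtain ⟨q, -, -, hq⟩ := hp' 1 one_pos
        exact (norm_nonneg _).trans (hq i).1
      set S := ∑ j, ‖c j‖
      have hS : 0 ≤ S := Finset.sum_nonneg fun _ _ => norm_nonneg _
      obtain ⟨q, -, h1, hq⟩ := hp' (ε / (1 + N * S)) (by positivity)
      refine ((hq i).2 c).trans ((mul_le_mul_of_nonneg_left
        (h1.norm_tupleMap_le q.mem c) hN).trans ?_)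
      have h2 : ε / (1 + N * S) * (1 + N * S) = ε := div_mul_cancel₀ _ (by positivity)
      have h3 : 0 < ε / (1 + N * S) := by positivity
      nlinarith
  refine ⟨p, rfl, Fintype.linearIndependent_iff.2 fun c hc i => ?_, key⟩
  have h1 := (key i).2 c
  rw [tupleMap_apply, hc, norm_zero, mul_zero] at h1
  exact norm_le_zero_iff.1 h1

end Topology

theorem isFraisseClass_E1 : IsFraisseClass E1 where
  finitelyGenerated _ hX := hX.1
  hereditary := hereditaryProperty_E1
  jointEmbedding := jointEmbeddingProperty_E1
  nearAmalgamation := nearAmalgamationProperty_E1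
  complete_separable k := ⟨fraisseMetricSpace k, isFraisseMetric_fraisseMetricSpace k,
    completeSpace_fraisseMetricSpace k, separableSpace_fraisseSpace⟩

end OperatorSpace

end

theorem mainTheorem6 :
    (∀ k : ℕ, ∃ _ : MetricSpace (OperatorSpace.FraisseSpace OperatorSpace.E1 k),
      OperatorSpace.IsFraisseMetric OperatorSpace.E1 k ∧
      CompleteSpace (OperatorSpace.FraisseSpace OperatorSpace.E1 k) ∧
      Dense (OperatorSpace.matricialPoints OperatorSpace.E1 k) ∧
      TopologicalSpace.SeparableSpace (OperatorSpace.FraisseSpace OperatorSpace.E1 k) ∧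
      (∀ N : ℝ, IsComplete (OperatorSpace.auerbachPoints OperatorSpace.E1 k N)) ∧
      OperatorSpace.basisPoints OperatorSpace.E1 k ⊆
        closure (OperatorSpace.basisPoints OperatorSpace.E1 k ∩
          OperatorSpace.matricialPoints OperatorSpace.E1 k) ∧
      TopologicalSpace.SeparableSpace ↥(OperatorSpace.basisPoints OperatorSpace.E1 k)) ∧
    OperatorSpace.IsFraisseClass OperatorSpace.E1 := by
  refine ⟨fun k => ⟨OperatorSpace.fraisseMetricSpace k,
    OperatorSpace.isFraisseMetric_fraisseMetricSpace k,
    OperatorSpace.completeSpace_fraisseMetricSpace k, OperatorSpace.dense_matricialPoints,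
    OperatorSpace.separableSpace_fraisseSpace, fun N => ?_,
    OperatorSpace.basisPoints_subset_closure, OperatorSpace.separableSpace_subtype _⟩,
    OperatorSpace.isFraisseClass_E1⟩
  let := OperatorSpace.fraisseMetricSpace k
  have := OperatorSpace.completeSpace_fraisseMetricSpace k
  exact (OperatorSpace.isClosed_auerbachPoints N).isComplete
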